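/- Let $K$ be an algebraically closed field and let $\Lambda = KQ/I$ be a gentle algebra: $Q$ is a finite quiver, paths are composed from left to right, $I$ is an admissible ideal of the path algebra $KQ$ generated by paths of length two, at most two arrows start and at most two arrows end at every vertex of $Q$, and for every arrow $\alpha$ there is at most one arrow $\beta$ with $\alpha\beta\notin I$, at most one arrow $\gamma$ with $\gamma\alpha\notin I$, at most one arrow $\beta$ with $t(\alpha)=s(\beta)$ and $\alpha\beta\in I$, and at most one arrow $\gamma$ with $t(\gamma)=s(\alpha)$ and $\gamma\alpha\in I$. Modules are right $\Lambda$-modules. For an arrow $\alpha$ put $R(\alpha)=\alpha\Lambda$ and $U(\alpha)=D(\Lambda\alpha)$, where $D=\operatorname{Hom}_K(-,K)$. For a finitely generated module $M$ let $\Omega^0(M)=\Omega^{-0}(M)=M$; let $\Omega^1(M)$ be the kernel of a projective cover $P(M)\to M$ and $\Omega^{-1}(M)$ the cokernel of an injective hull $M\to I(M)$; and let $\Omega^{i+1}(M)=\Omega^1(\Omega^i(M))$ and $\Omega^{-(i+1)}(M)=\Omega^{-1}(\Omega^{-i}(M))$. These modules exist and are well defined up to isomorphism. Let $M$ be an (indecomposable)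 string module over $\Lambda$, that is, $M\cong M(w)$ for a string $w$ (possibly of length zero). Then: (1) $\Omega^1(M)\cong L_0\oplus\cdots\oplus L_k$ for some $k\ge 0$ and some modules $L_0,\dots,L_k$ such that $L_i$ is projective for $0<i<k$, and each of $L_0$ and $L_k$ is either zero or is uniserial and isomorphic to $R(\alpha)$ for some arrow $\alpha$. Furthermore, either $\Omega^i(M)=0$ for some $i>0$, or there are positive integers $n$ and $m$ such that $\Omega^{ln+i}(M)\cong\Omega^i(M)$ for all $i\ge m$ and all $l\ge 0$. (2) $\Omega^{-1}(M)\cong N_0\oplus\cdots\oplus N_{k}$ for some $k\ge 0$ and some modules $N_0,\dots,N_{k}$ such that $N_i$ is injective for $0<i<k$, and each of $N_0$ and $N_{k}$ is either zero or is uniserial and isomorphic to $U(\beta)$ for some arrow $\beta$. Furthermore, either $\Omega^{-i}(M)=0$ for some $i>0$, or there are positive integers $n$ and $m$ such that $\Omega^{-(ln+i)}(M)\cong\Omega^{-i}(M)$ for all $i\ge m$ and all $l\ge 0$. -/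

import Mathlib

universe u

noncomputable section

namespace GentleAlgebra

/-! ### Quivers, paths and the path algebra -/

/-- An arrow of the quiver, together with its source and its target. -/
structure Arrow (V : Type u) [Quiver.{u} V] : Type u where
  src : V
  tgt : V
  hom : src ⟶ tgt

/-- A path of the quiver (possibly of length zero), together with its source and its target. -/
structure QPath (V : Type u) [Quiver.{u} V] : Type u where
  src : V
  tgt : V
  path : Quiver.Path src tgt

/-- The path algebra `KQ`: its underlying vector space has the paths as a basis. -/
def PathAlgebra (K V : Type u) [Field K] [Quiver.{u} V] : Type u := QPath V →₀ K

section PathAlgebra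

variable {K V : Type u} [Field K] [Quiver.{u} V]

instance : AddCommGroup (PathAlgebra K V) := inferInstanceAs (AddCommGroup (QPath V →₀ K))

instance : Module K (PathAlgebra K V) := inferInstanceAs (Module K (QPath V →₀ K))

namespace PathAlgebra

variable (K) in
/-- The basis vector given by a path. -/
def ofPath (p : QPath V) : PathAlgebra K V := Finsupp.single p 1

variable (K) in
/-- An arrow, as an element of the path algebra. -/
def ofArrow (α : Arrow V) : PathAlgebra K V := ofPath K ⟨α.src, α.tgt, α.hom.toPath⟩

variable (K) in
/-- The product of two paths, read from left to right: first `p`, then `q`. It is zero if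
`q` does not start where `p` ends. -/
def pathMul (p q : QPath V) : PathAlgebra K V :=
  open Classical in
  if h : q.src = p.tgt then ofPath K ⟨p.src, q.tgt, p.path.comp (q.path.cast h rfl)⟩ else 0

/-- A linear map out of the path algebra, given by its values on paths. -/
def lin {M : Type*} [AddCommGroup M] [Module K M] (f : QPath V → M) : PathAlgebra K V →ₗ[K] M :=
  Finsupp.linearCombination K f

theorem lin_ofPath {M : Type*} [AddCommGroup M] [Module K M] (f : QPath V → M) (p : QPath V) :
    lin f (ofPath K p) = f p :=
  (Finsupp.linearCombination_single K (1 : K) p).trans (one_smul K (f p))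

theorem hom_ext {M : Type*} [AddCommGroup M] [Module K M] {f g : PathAlgebra K V →ₗ[K] M}
    (h : ∀ p, f (ofPath K p) = g (ofPath K p)) : f = g :=
  Finsupp.lhom_ext' fun p => LinearMap.ext_ring (h p)

variable (K V) in
/-- The multiplication of the path algebra, as a bilinear map. -/
def mulMap : PathAlgebra K V →ₗ[K] PathAlgebra K V →ₗ[K] PathAlgebra K V :=
  lin fun p => lin fun q => pathMul K p q

instance : Mul (PathAlgebra K V) := ⟨fun x y => mulMap K V x y⟩

theorem mul_def (x y : PathAlgebra K V) : x * y = mulMap K V x y := rfl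

theorem ofPath_mul (p q : QPath V) : ofPath K p * ofPath K q = pathMul K p q := by
  rw [mul_def, mulMap, lin_ofPath, lin_ofPath]

theorem pathMul_comp {a b c : V} (p : Quiver.Path a b) (q : Quiver.Path b c) :
    pathMul K ⟨a, b, p⟩ ⟨b, c, q⟩ = ofPath K ⟨a, c, p.comp q⟩ := by
  simp [pathMul]

theorem pathMul_of_ne {p q : QPath V} (h : q.src ≠ p.tgt) : pathMul K p q = 0 := by
  simp [pathMul, h]

theorem mul_assoc_ofPath (p q r : QPath V) :
    ofPath K p * ofPath K q * ofPath K r = ofPath K p * (ofPath K q * ofPath K r) := by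
  obtain ⟨a, b, p⟩ := p
  obtain ⟨c, d, q⟩ := q
  obtain ⟨e, f, r⟩ := r
  rw [ofPath_mul, ofPath_mul]
  by_cases h : c = b
  · subst h
    rw [pathMul_comp, ofPath_mul]
    by_cases h' : e = d
    · subst h'
      rw [pathMul_comp, pathMul_comp, ofPath_mul, pathMul_comp, Quiver.Path.comp_assoc]
    · rw [pathMul_of_ne (by simpa using h'), pathMul_of_ne (by simpa using h'), mul_def, map_zero]
  · rw [pathMul_of_ne (by simpa using h), mul_def, map_zero, LinearMap.zero_apply]
    by_cases h' : e = d
    · subst h'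
      rw [pathMul_comp, ofPath_mul, pathMul_of_ne (by simpa using h)]
    · rw [pathMul_of_ne (by simpa using h'), mul_def, map_zero]

instance [Fintype V] : One (PathAlgebra K V) :=
  ⟨∑ v : V, ofPath K ⟨v, v, Quiver.Path.nil⟩⟩

theorem one_def [Fintype V] :
    (1 : PathAlgebra K V) = ∑ v : V, ofPath K ⟨v, v, Quiver.Path.nil⟩ := rfl

theorem one_mul_aux [Fintype V] (x : PathAlgebra K V) : 1 * x = x := by
  have h : mulMap K V 1 = LinearMap.id := by
    refine hom_ext fun p => ?_
    obtain ⟨a, b, p⟩ := p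
    rw [one_def, map_sum, LinearMap.sum_apply, Finset.sum_eq_single a]
    · rw [← mul_def, ofPath_mul, pathMul_comp, Quiver.Path.nil_comp, LinearMap.id_apply]
    · intro v _ hv
      rw [← mul_def, ofPath_mul, pathMul_of_ne (by simpa using hv.symm)]
    · simp
  rw [mul_def, h, LinearMap.id_apply]

theorem mul_one_aux [Fintype V] (x : PathAlgebra K V) : x * 1 = x := by
  have h : (mulMap K V).flip 1 = LinearMap.id := by
    refine hom_ext fun p => ?_
    obtain ⟨a, b, p⟩ := p
    rw [one_def, map_sum, LinearMap.sum_apply, Finset.sum_eq_single b]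
    · rw [LinearMap.flip_apply, ← mul_def, ofPath_mul, pathMul_comp, Quiver.Path.comp_nil,
        LinearMap.id_apply]
    · intro v _ hv
      rw [LinearMap.flip_apply, ← mul_def, ofPath_mul, pathMul_of_ne (by simpa using hv)]
    · simp
  exact LinearMap.congr_fun h x

theorem induction_ofPath {P : PathAlgebra K V → Prop} (x : PathAlgebra K V) (zero : P 0)
    (add : ∀ x y, P x → P y → P (x + y)) (smul : ∀ (c : K) (p : QPath V), P (c • ofPath K p)) :
    P x := by
  refine Finsupp.induction_linear (motive := P) x zero add fun p c => ?_
  have h : c • ofPath K p = Finsupp.single p c :=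
    (Finsupp.smul_single c p (1 : K)).trans (by rw [smul_eq_mul, mul_one])
  exact h ▸ smul c p

theorem mul_assoc_aux (x y z : PathAlgebra K V) : x * y * z = x * (y * z) := by
  refine induction_ofPath (P := fun x => x * y * z = x * (y * z)) x ?_ ?_ fun a p => ?_
  · simp [mul_def]
  · intro x₁ x₂ h₁ h₂
    simp only [mul_def, map_add, LinearMap.add_apply] at *
    rw [h₁, h₂]
  refine induction_ofPath (P := fun y => a • ofPath K p * y * z = a • ofPath K p * (y * z))
    y ?_ ?_ fun b q => ?_
  · simp [mul_def]
  · intro x₁ x₂ h₁ h₂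
    simp only [mul_def, map_add, LinearMap.add_apply] at *
    rw [h₁, h₂]
  refine induction_ofPath
    (P := fun z => a • ofPath K p * b • ofPath K q * z = a • ofPath K p * (b • ofPath K q * z))
    z ?_ ?_ fun c r => ?_
  · simp [mul_def]
  · intro x₁ x₂ h₁ h₂
    simp only [mul_def, map_add] at *
    rw [h₁, h₂]
  have h := mul_assoc_ofPath (K := K) p q r
  simp only [mul_def, map_smul, LinearMap.smul_apply] at *
  rw [h]

instance [Fintype V] : Ring (PathAlgebra K V) :=
  { (inferInstance : AddCommGroup (PathAlgebra K V)) with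
    mul := (· * ·)
    one := 1
    left_distrib := fun x y z => by simp [mul_def]
    right_distrib := fun x y z => by simp [mul_def]
    zero_mul := fun x => by simp [mul_def]
    mul_zero := fun x => by simp [mul_def]
    mul_assoc := mul_assoc_aux
    one_mul := one_mul_aux
    mul_one := mul_one_aux }

instance [Fintype V] : Algebra K (PathAlgebra K V) :=
  Algebra.ofModule (fun c x y => by simp [mul_def]) (fun c x y => by simp [mul_def])

end PathAlgebra

/-! ### Gentle algebras -/

variable [Fintype V]

variable (K V) in
/-- The `n`-th power of the arrow ideal: the ideal generated by the paths of length `n`. -/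
def arrowIdealPow (n : ℕ) : TwoSidedIdeal (PathAlgebra K V) :=
  TwoSidedIdeal.span {x | ∃ p : QPath V, p.path.length = n ∧ x = PathAlgebra.ofPath K p}

/-- Admissible ideals of the path algebra. -/
def IsAdmissible (I : TwoSidedIdeal (PathAlgebra K V)) : Prop :=
  I ≤ arrowIdealPow K V 2 ∧ ∃ m, 2 ≤ m ∧ arrowIdealPow K V m ≤ I

open PathAlgebra in
/-- The ideal `I` is such that `KQ/I` is a gentle algebra. -/
structure IsGentle (I : TwoSidedIdeal (PathAlgebra K V)) : Prop where
  admissible : IsAdmissible I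
  starting_le_two : ∀ v : V, {α : Arrow V | α.src = v}.encard ≤ 2
  ending_le_two : ∀ v : V, {α : Arrow V | α.tgt = v}.encard ≤ 2
  next_not_mem : ∀ α : Arrow V, {β : Arrow V | ofArrow K α * ofArrow K β ∉ I}.Subsingleton
  prev_not_mem : ∀ α : Arrow V, {γ : Arrow V | ofArrow K γ * ofArrow K α ∉ I}.Subsingleton
  next_mem : ∀ α : Arrow V,
    {β : Arrow V | α.tgt = β.src ∧ ofArrow K α * ofArrow K β ∈ I}.Subsingleton
  prev_mem : ∀ α : Arrow V,
    {γ : Arrow V | γ.tgt = α.src ∧ ofArrow K γ * ofArrow K α ∈ I}.Subsingleton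
  generated : ∃ S : Set (QPath V), (∀ p ∈ S, p.path.length = 2) ∧
    I = TwoSidedIdeal.span (ofPath K '' S)

/-- The algebra `KQ/I`. -/
abbrev QuotAlgebra (I : TwoSidedIdeal (PathAlgebra K V)) : Type u := I.ringCon.Quotient

/-- The class of an arrow in `KQ/I`. -/
def arrowClass (I : TwoSidedIdeal (PathAlgebra K V)) (α : Arrow V) : QuotAlgebra I :=
  I.ringCon.mk' (PathAlgebra.ofArrow K α)

end PathAlgebra

/-! ### Strings -/

/-- An arrow or the formal inverse of an arrow. -/
inductive Letter (V : Type u) [Quiver.{u} V] : Type u where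
  | direct : Arrow V → Letter V
  | inverse : Arrow V → Letter V

namespace Letter

variable {V : Type u} [Quiver.{u} V]

/-- The source of a letter. -/
def src : Letter V → V
  | direct α => α.src
  | inverse α => α.tgt

/-- The target of a letter. -/
def tgt : Letter V → V
  | direct α => α.tgt
  | inverse α => α.src

/-- The formal inverse of a letter. -/
def inv : Letter V → Letter V
  | direct α => inverse α
  | inverse α => direct α

end Letter

section Strings

variable {K V : Type u} [Field K] [Quiver.{u} V] [Fintype V]

open PathAlgebra in
/-- A string `w = α₁ ⋯ αₘ` for `KQ/I`, running through the vertices `v₀, …, vₘ`. The letter with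
index `i : Fin m` leads from the vertex with index `i` to the vertex with index `i + 1`. -/
structure QString (I : TwoSidedIdeal (PathAlgebra K V)) where
  length : ℕ
  vertex : Fin (length + 1) → V
  letter : Fin length → Letter V
  src_letter : ∀ i, (letter i).src = vertex i.castSucc
  tgt_letter : ∀ i, (letter i).tgt = vertex i.succ
  reduced : ∀ i j : Fin length, j.val = i.val + 1 → letter j ≠ (letter i).inv
  direct_not_mem : ∀ i j : Fin length, j.val = i.val + 1 → ∀ α β : Arrow V,
    letter i = Letter.direct α → letter j = Letter.direct β → ofArrow K α * ofArrow K β ∉ I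
  inverse_not_mem : ∀ i j : Fin length, j.val = i.val + 1 → ∀ α β : Arrow V,
    letter i = Letter.inverse α → letter j = Letter.inverse β → ofArrow K β * ofArrow K α ∉ I

namespace QString

variable {I : TwoSidedIdeal (PathAlgebra K V)} (w : QString I)

/-- The arrow `α` sends the basis vector with index `i` of the string module to the one with
index `j`, along a letter `α` (from left to right) or `α⁻¹` (from right to left). -/
def Step (α : Arrow V) (i j : Fin (w.length + 1)) : Prop :=
  ∃ k : Fin w.length, (w.letter k = Letter.direct α ∧ i = k.castSucc ∧ j = k.succ) ∨
    (w.letter k = Letter.inverse α ∧ i = k.succ ∧ j = k.castSucc)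

open Classical in
/-- The matrix of the trivial path at `v` on the string module (acting on row vectors). -/
def vertexMat (v : V) : Matrix (Fin (w.length + 1)) (Fin (w.length + 1)) K :=
  Matrix.diagonal fun i => if w.vertex i = v then 1 else 0

open Classical in
/-- The matrix of an arrow on the string module (acting on row vectors). -/
def arrowMat (α : Arrow V) : Matrix (Fin (w.length + 1)) (Fin (w.length + 1)) K :=
  Matrix.of fun i j => if w.Step α i j then 1 else 0

/-- The matrix of a path on the string module (acting on row vectors). -/
def pathMat {a : V} :
    ∀ {b : V}, Quiver.Path a b → Matrix (Fin (w.length + 1)) (Fin (w.length + 1)) K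
  | _, Quiver.Path.nil => w.vertexMat a
  | _, @Quiver.Path.cons _ _ _ b c p α => pathMat p * w.arrowMat ⟨b, c, α⟩

theorem Step.vertex_src {w : QString I} {α : Arrow V} {i j : Fin (w.length + 1)}
    (h : w.Step α i j) : w.vertex i = α.src := by
  obtain ⟨k, ⟨hk, rfl, rfl⟩ | ⟨hk, rfl, rfl⟩⟩ := h
  · rw [← w.src_letter, hk, Letter.src]
  · rw [← w.tgt_letter, hk, Letter.tgt]

theorem Step.vertex_tgt {w : QString I} {α : Arrow V} {i j : Fin (w.length + 1)}
    (h : w.Step α i j) : w.vertex j = α.tgt := by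
  obtain ⟨k, ⟨hk, rfl, rfl⟩ | ⟨hk, rfl, rfl⟩⟩ := h
  · rw [← w.tgt_letter, hk, Letter.tgt]
  · rw [← w.src_letter, hk, Letter.src]

theorem vertexMat_mul_self (v : V) : w.vertexMat v * w.vertexMat v = w.vertexMat v := by
  simp [vertexMat, Matrix.diagonal_mul_diagonal]

theorem vertexMat_mul_of_ne {v v' : V} (h : v ≠ v') : w.vertexMat v * w.vertexMat v' = 0 := by
  rw [vertexMat, vertexMat, Matrix.diagonal_mul_diagonal, ← Matrix.diagonal_zero]
  congr 1
  funext i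
  by_cases h' : w.vertex i = v
  · simp [h', h]
  · simp [h']

theorem vertexMat_mul_arrowMat (α : Arrow V) :
    w.vertexMat α.src * w.arrowMat α = w.arrowMat α := by
  ext i j
  rw [vertexMat, Matrix.diagonal_mul, arrowMat, Matrix.of_apply]
  by_cases h : w.Step α i j
  · simp [h.vertex_src]
  · simp [h]

theorem arrowMat_mul_vertexMat (α : Arrow V) :
    w.arrowMat α * w.vertexMat α.tgt = w.arrowMat α := by
  ext i j
  rw [vertexMat, Matrix.mul_diagonal, arrowMat, Matrix.of_apply]
  by_cases h : w.Step α i j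
  · simp [h.vertex_tgt]
  · simp [h]

theorem vertexMat_mul_pathMat {a b : V} (p : Quiver.Path a b) :
    w.vertexMat a * w.pathMat p = w.pathMat p := by
  induction p with
  | nil => exact w.vertexMat_mul_self a
  | cons p α ih => rw [pathMat, ← mul_assoc, ih]

theorem pathMat_mul_vertexMat {a b : V} (p : Quiver.Path a b) :
    w.pathMat p * w.vertexMat b = w.pathMat p := by
  cases p with
  | nil => exact w.vertexMat_mul_self a
  | cons p α => rw [pathMat, mul_assoc, arrowMat_mul_vertexMat w ⟨_, _, α⟩]

theorem pathMat_comp {a b c : V} (p : Quiver.Path a b) (q : Quiver.Path b c) :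
    w.pathMat (p.comp q) = w.pathMat p * w.pathMat q := by
  induction q with
  | nil => exact (w.pathMat_mul_vertexMat p).symm
  | cons q α ih => rw [Quiver.Path.comp_cons, pathMat, pathMat, ih, mul_assoc]

theorem pathMat_mul_of_ne {a b c d : V} (p : Quiver.Path a b) (q : Quiver.Path c d)
    (h : b ≠ c) : w.pathMat p * w.pathMat q = 0 := by
  rw [← w.pathMat_mul_vertexMat p, ← w.vertexMat_mul_pathMat q, mul_assoc,
    ← mul_assoc (w.vertexMat b), w.vertexMat_mul_of_ne h, zero_mul, mul_zero]

theorem sum_vertexMat : ∑ v : V, w.vertexMat v = 1 := by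
  ext i j
  rw [Matrix.sum_apply]
  by_cases h : i = j
  · subst h
    rw [Finset.sum_eq_single (w.vertex i)]
    · simp [vertexMat]
    · intro v _ hv
      simp [vertexMat, hv.symm]
    · simp
  · simp [vertexMat, h]

/-- The linear extension of `pathMat` to the path algebra. -/
def repLin : PathAlgebra K V →ₗ[K] Matrix (Fin (w.length + 1)) (Fin (w.length + 1)) K :=
  PathAlgebra.lin fun p => w.pathMat p.path

theorem repLin_mul (x y : PathAlgebra K V) : w.repLin (x * y) = w.repLin x * w.repLin y := by
  refine PathAlgebra.induction_ofPath
    (P := fun x => w.repLin (x * y) = w.repLin x * w.repLin y) x ?_ ?_ fun a p => ?_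
  · simp
  · intro x₁ x₂ h₁ h₂
    simp only [add_mul, map_add, h₁, h₂]
  refine PathAlgebra.induction_ofPath
    (P := fun y => w.repLin (a • PathAlgebra.ofPath K p * y) =
      w.repLin (a • PathAlgebra.ofPath K p) * w.repLin y) y ?_ ?_ fun b q => ?_
  · simp
  · intro x₁ x₂ h₁ h₂
    simp only [mul_add, map_add, h₁, h₂]
  have h : w.repLin (PathAlgebra.ofPath K p * PathAlgebra.ofPath K q) =
      w.repLin (PathAlgebra.ofPath K p) * w.repLin (PathAlgebra.ofPath K q) := by
    obtain ⟨a, b, p⟩ := p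
    obtain ⟨c, d, q⟩ := q
    rw [PathAlgebra.ofPath_mul]
    by_cases h : c = b
    · subst h
      rw [PathAlgebra.pathMul_comp]
      simp only [repLin, PathAlgebra.lin_ofPath]
      exact w.pathMat_comp p q
    · rw [PathAlgebra.pathMul_of_ne (by simpa using h), map_zero]
      simp only [repLin, PathAlgebra.lin_ofPath]
      exact (w.pathMat_mul_of_ne p q (Ne.symm h)).symm
  simp only [smul_mul_assoc, mul_smul_comm, map_smul, h]

/-- The representation of the path algebra by matrices acting on row vectors that belongs to a
string. -/
def repPathAlgebra :
    PathAlgebra K V →ₐ[K] Matrix (Fin (w.length + 1)) (Fin (w.length + 1)) K :=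
  AlgHom.ofLinearMap w.repLin
    (by
      rw [PathAlgebra.one_def, map_sum, ← w.sum_vertexMat]
      refine Finset.sum_congr rfl fun v _ => ?_
      rw [repLin, PathAlgebra.lin_ofPath, pathMat])
    w.repLin_mul

theorem repPathAlgebra_ofPath (p : QPath V) :
    w.repPathAlgebra (PathAlgebra.ofPath K p) = w.pathMat p.path := by
  change w.repLin _ = _
  rw [repLin, PathAlgebra.lin_ofPath]

theorem arrowMat_mul_arrowMat {α β : Arrow V}
    (h : PathAlgebra.ofArrow K α * PathAlgebra.ofArrow K β ∈ I) :
    w.arrowMat α * w.arrowMat β = 0 := by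
  ext i j
  rw [Matrix.mul_apply, Matrix.zero_apply]
  refine Finset.sum_eq_zero fun k _ => ?_
  simp only [arrowMat, Matrix.of_apply]
  by_cases h₁ : w.Step α i k
  · by_cases h₂ : w.Step β k j
    · exfalso
      obtain ⟨a, ⟨ha, -, ha'⟩ | ⟨ha, -, ha'⟩⟩ := h₁ <;>
        obtain ⟨b, ⟨hb, hb', -⟩ | ⟨hb, hb', -⟩⟩ := h₂ <;>
        have hab := congrArg Fin.val (ha'.symm.trans hb')
      · exact w.direct_not_mem a b (by simpa using hab.symm) α β ha hb h
      · have : a = b := Fin.ext (by simpa using hab)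
        subst this
        rw [ha] at hb
        cases hb
      · have : a = b := Fin.ext (by simpa using hab)
        subst this
        rw [ha] at hb
        cases hb
      · exact w.inverse_not_mem b a (by simpa using hab) β α hb ha h
    · simp [h₂]
  · simp [h₁]

theorem ofPath_eq_mul {p : QPath V} (hp : p.path.length = 2) :
    ∃ α β : Arrow V, PathAlgebra.ofPath K p = PathAlgebra.ofArrow K α * PathAlgebra.ofArrow K β ∧
      w.pathMat p.path = w.arrowMat α * w.arrowMat β := by
  obtain ⟨a, b, p⟩ := p
  cases p with
  | nil => simp at hp
  | cons p β =>
    cases p with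
    | nil => simp at hp
    | cons p α =>
      cases p with
      | nil =>
        refine ⟨⟨_, _, α⟩, ⟨_, _, β⟩, ?_, ?_⟩
        · rw [PathAlgebra.ofArrow, PathAlgebra.ofArrow, PathAlgebra.ofPath_mul,
            PathAlgebra.pathMul_comp]
          rfl
        · simp only [pathMat]
          rw [vertexMat_mul_arrowMat w ⟨_, _, α⟩]
      | cons p γ => simp at hp

theorem le_ker (hI : IsGentle I) :
    I.ringCon ≤ RingCon.ker w.repPathAlgebra.toRingHom := by
  have h : I ≤ TwoSidedIdeal.ker w.repPathAlgebra := by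
    obtain ⟨S, hS, hIS⟩ := hI.generated
    have hmem : ∀ p ∈ S, PathAlgebra.ofPath K p ∈ I := fun p hp => by
      rw [hIS]
      exact TwoSidedIdeal.subset_span ⟨p, hp, rfl⟩
    conv_lhs => rw [hIS]
    refine TwoSidedIdeal.span_le.2 ?_
    rintro _ ⟨p, hp, rfl⟩
    obtain ⟨α, β, h₁, h₂⟩ := w.ofPath_eq_mul (hS p hp)
    refine (TwoSidedIdeal.mem_ker _).2 ?_
    rw [repPathAlgebra_ofPath, h₂]
    exact w.arrowMat_mul_arrowMat (h₁ ▸ hmem p hp)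
  exact TwoSidedIdeal.ringCon_le_iff.1 h

/-- The representation of `KQ/I` by matrices acting on row vectors that belongs to a string. -/
def rep (hI : IsGentle I) :
    QuotAlgebra I →ₐ[K] Matrix (Fin (w.length + 1)) (Fin (w.length + 1)) K :=
  RingCon.liftₐ I.ringCon w.repPathAlgebra (w.le_ker hI)

end QString

/-- The string module `M(w)`: it has a basis indexed by the vertices that the walk `w` runs
through. -/
def StringModule {I : TwoSidedIdeal (PathAlgebra K V)} (_hI : IsGentle I) (w : QString I) :
    Type u := Fin (w.length + 1) → K

section StringModule

variable {I : TwoSidedIdeal (PathAlgebra K V)} (hI : IsGentle I) (w : QString I)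

instance : AddCommGroup (StringModule hI w) :=
  inferInstanceAs (AddCommGroup (Fin (w.length + 1) → K))

/-- The string module is a right module over `KQ/I`, through the action of matrices on row
vectors. -/
instance : Module (QuotAlgebra I)ᵐᵒᵖ (StringModule hI w) where
  smul a x := Matrix.vecMul (show Fin (w.length + 1) → K from x) (w.rep hI a.unop)
  one_smul x := by
    change Matrix.vecMul _ (w.rep hI 1) = _
    rw [map_one, Matrix.vecMul_one]
  mul_smul a b x := by
    change Matrix.vecMul _ (w.rep hI (b.unop * a.unop)) =
      Matrix.vecMul (Matrix.vecMul _ (w.rep hI b.unop)) (w.rep hI a.unop)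
    rw [map_mul, Matrix.vecMul_vecMul]
  smul_zero _ := Matrix.zero_vecMul _
  smul_add _ _ _ := Matrix.add_vecMul _ _ _
  add_smul a b x := by
    change Matrix.vecMul _ (w.rep hI (a.unop + b.unop)) =
      Matrix.vecMul _ (w.rep hI a.unop) + Matrix.vecMul _ (w.rep hI b.unop)
    rw [map_add, Matrix.vecMul_add]
  zero_smul x := by
    change Matrix.vecMul _ (w.rep hI 0) = 0
    rw [map_zero, Matrix.vecMul_zero]

end StringModule

/-- A right module is a string module if it is isomorphic to `M(w)` for some string `w`. -/
def IsStringModule {I : TwoSidedIdeal (PathAlgebra K V)} (hI : IsGentle I)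
    (M : ModuleCat.{u} (QuotAlgebra I)ᵐᵒᵖ) : Prop :=
  ∃ w : QString I, Nonempty (M ≃ₗ[(QuotAlgebra I)ᵐᵒᵖ] StringModule hI w)

end Strings

/-! ### The modules generated by an arrow -/

/-- The dual `D(N) = Hom_K(N, K)` of a left module `N`. -/
def KDual (K Λ N : Type u) [Field K] [Ring Λ] [Algebra K Λ] [AddCommGroup N] [Module K N]
    [Module Λ N] [IsScalarTower K Λ N] : Type u := N →ₗ[K] K

section KDual

variable (K Λ N : Type u) [Field K] [Ring Λ] [Algebra K Λ] [AddCommGroup N] [Module K N]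
  [Module Λ N] [IsScalarTower K Λ N]

instance : AddCommGroup (KDual K Λ N) := inferInstanceAs (AddCommGroup (N →ₗ[K] K))

/-- The dual of a left module is a right module: `(f · a)(x) = f (a x)`. -/
instance : Module Λᵐᵒᵖ (KDual K Λ N) where
  smul a f := (show N →ₗ[K] K from f).comp (Algebra.lsmul K K N a.unop)
  one_smul f := LinearMap.ext fun x => congrArg (show N →ₗ[K] K from f) (one_smul Λ x)
  mul_smul a b f :=
    LinearMap.ext fun x => congrArg (show N →ₗ[K] K from f) (mul_smul b.unop a.unop x)
  smul_zero _ := LinearMap.zero_comp _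
  smul_add _ _ _ := LinearMap.add_comp _ _ _
  add_smul a b f := LinearMap.ext fun x =>
    (congrArg (show N →ₗ[K] K from f) (add_smul a.unop b.unop x)).trans
      (map_add (show N →ₗ[K] K from f) _ _)
  zero_smul f := LinearMap.ext fun x =>
    (congrArg (show N →ₗ[K] K from f) (zero_smul Λ x)).trans (map_zero (show N →ₗ[K] K from f))

end KDual

section ArrowModules

variable {K V : Type u} [Field K] [Quiver.{u} V] [Fintype V]

/-- The right module `R(α) = αΛ` for `Λ = KQ/I`. -/
abbrev arrowR (I : TwoSidedIdeal (PathAlgebra K V)) (α : Arrow V) :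
    Submodule (QuotAlgebra I)ᵐᵒᵖ (QuotAlgebra I) :=
  Submodule.span (QuotAlgebra I)ᵐᵒᵖ {arrowClass I α}

/-- The right module `U(α) = D(Λα)` for `Λ = KQ/I`. -/
abbrev arrowU (I : TwoSidedIdeal (PathAlgebra K V)) (α : Arrow V) : Type u :=
  KDual K (QuotAlgebra I) (Submodule.span (QuotAlgebra I) {arrowClass I α})

end ArrowModules

/-! ### Projective covers, injective hulls, syzygies and cosyzygies -/

section Syzygies

variable {R : Type u} [Ring R]

/-- `f : P → M` is a projective cover: `P` is projective, and `f` is onto with superfluous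
kernel. -/
structure IsProjectiveCover {P M : ModuleCat.{u} R} (f : P →ₗ[R] M) : Prop where
  projective : Module.Projective R P
  surjective : Function.Surjective f
  superfluous : ∀ N : Submodule R P, N ⊔ LinearMap.ker f = ⊤ → N = ⊤

/-- `g : M → E` is an injective hull: `E` is injective, and `g` is one-to-one with essential
image. -/
structure IsInjectiveHull {M E : ModuleCat.{u} R} (g : M →ₗ[R] E) : Prop where
  injective_module : Module.Injective R E
  injective : Function.Injective g
  essential : ∀ N : Submodule R E, N ⊓ LinearMap.range g = ⊥ → N = ⊥

/-- `N` is (isomorphic to) the first syzygy of `M`. -/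
def IsSyzygy (M N : ModuleCat.{u} R) : Prop :=
  ∃ (P : ModuleCat.{u} R) (f : P →ₗ[R] M), IsProjectiveCover f ∧
    Nonempty (N ≃ₗ[R] LinearMap.ker f)

/-- `N` is (isomorphic to) the first cosyzygy of `M`. -/
def IsCosyzygy (M N : ModuleCat.{u} R) : Prop :=
  ∃ (E : ModuleCat.{u} R) (g : M →ₗ[R] E), IsInjectiveHull g ∧
    Nonempty (N ≃ₗ[R] E ⧸ LinearMap.range g)

/-- `Ω i` is the `i`-th syzygy of `M`, for all `i` (with `Ω 0 = M`, all up to isomorphism). -/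
def IsSyzygySequence (M : ModuleCat.{u} R) (Ω : ℕ → ModuleCat.{u} R) : Prop :=
  Nonempty (Ω 0 ≃ₗ[R] M) ∧ ∀ i, IsSyzygy (Ω i) (Ω (i + 1))

/-- `Ω i` is the `i`-th cosyzygy of `M`, for all `i` (with `Ω 0 = M`, all up to isomorphism). -/
def IsCosyzygySequence (M : ModuleCat.{u} R) (Ω : ℕ → ModuleCat.{u} R) : Prop :=
  Nonempty (Ω 0 ≃ₗ[R] M) ∧ ∀ i, IsCosyzygy (Ω i) (Ω (i + 1))

/-- A sequence of modules is eventually periodic, up to isomorphism. -/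
def EventuallyPeriodic (Ω : ℕ → ModuleCat.{u} R) : Prop :=
  ∃ n > 0, ∃ m > 0, ∀ i ≥ m, ∀ l : ℕ, Nonempty (Ω (l * n + i) ≃ₗ[R] Ω i)

/-- A module is uniserial if its submodules form a chain. -/
def IsUniserial (R M : Type u) [Ring R] [AddCommGroup M] [Module R M] : Prop :=
  ∀ N N' : Submodule R M, N ≤ N' ∨ N' ≤ N

end Syzygies

end GentleAlgebra

end

open GentleAlgebra

open scoped Pointwise

noncomputable section

namespace GentleAlgebra

/-! ### Gentle presentations of an algebra -/

/-! Gentle algebras are monomial, and everything needed about Λ is recorded in `GentlePresentation`: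
idempotents and products of arrows span, long products vanish, the left ideals generated by two
different arrows meet in zero (`disjoint`), and right multiplication by a_α is injective on R a_β
whenever a_β a_α ≠ 0 (`cancel`). Both Λᵒᵖ (for right modules) and Λ (for left modules) have such a
presentation, because the paths without a subpath of length two in I give a basis of KQ/I
(`goodCoeff_eq_zero_iff`).

Let β be an arrow that ends at v. Then R e_v is the sum of K e_v and of the ideals R a_x and R a_y,
where x and y are the arrows that start at v. Gentleness says that at most one of them, x say, has
nonzero product with β and at most one, y, has product zero. Hence the kernel of R e_v → R a_β is R
a_y (`radSyzygy_arrow`): on modules generated by an arrow, Ω is given by a self-map of the finite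
set of optional arrows. These modules are uniserial because a path has at most one nonzero
continuation by an arrow (`isUniserial_optSpan`).

A string module is covered by the sum of the modules R e_v over its peaks. An inner valley is
reached from its two sides by two different arrows. The relation that identifies the two images,
together with the two pieces of the kernel that continue beyond the valley, forms a single copy of R
e_v for the vertex v of the valley (`IsCover.glue`). What remains is one module generated by an
optional arrow at either end of the string, so the first syzygy is arrow module ⊕ projective ⊕ arrow
module (`exists_radSyzygy`). From the second syzygy on only a pair of optional arrows is left, and
iterating a self-map of a finite set is eventually periodic (`eventuallyPeriodic_of_finite`).
Uniqueness of projective covers transfers the result to every syzygy sequence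
(`IsSyzygySequence.unique`).

For cosyzygies, M(w) is the dual of a left string module of column vectors (`stringModuleEquiv`),
and duality turns a projective presentation with kernel in the radical into an injective hull
together with its cokernel (`RadSyzygy.isCosyzygy`). -/

/-- A presentation of a finite-dimensional algebra `R` by arrows `a α` and idempotents `e v`, with
zero relations of length two, that satisfies the axioms of a gentle algebra. A product `a β * a α`
stands for the path that runs through `α` first, as befits left modules. -/
structure GentlePresentation (K R V E : Type u) [Field K] [Ring R] [Algebra K R] where
  e : V → R
  a : E → R
  src : E → V
  tgt : E → V
  e_mul_self : ∀ v, e v * e v = e v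
  e_mul_of_ne : ∀ v w, v ≠ w → e v * e w = 0
  a_mul_e : ∀ α, a α * e (src α) = a α
  e_mul_a : ∀ α, e (tgt α) * a α = a α
  a_ne_zero : ∀ α, a α ≠ 0
  generates : ∀ r, r ∈ Submodule.span K
    (Set.range e ∪ {x | ∃ l : List E, l ≠ [] ∧ x = (l.map a).prod})
  nilpotent : ∃ N, ∀ l : List E, N ≤ l.length → (l.map a).prod = 0
  disjoint : ∀ (r s : R) (α β : E), α ≠ β → r * a α = s * a β → r * a α = 0
  cancel : ∀ (r : R) (α β : E), a β * a α ≠ 0 → r * a β * a α = 0 → r * a β = 0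
  starting_le_two : ∀ α β γ, src α = src β → src β = src γ → α = β ∨ β = γ ∨ α = γ
  next_unique : ∀ α β β', a β * a α ≠ 0 → a β' * a α ≠ 0 → β = β'
  prev_unique : ∀ α β β', a α * a β ≠ 0 → a α * a β' ≠ 0 → β = β'
  next_zero_unique : ∀ α β β', src β = tgt α → src β' = tgt α → a β * a α = 0 →
    a β' * a α = 0 → β = β'
  prev_zero_unique : ∀ α β β', src α = tgt β → src α = tgt β' → a α * a β = 0 →
    a α * a β' = 0 → β = β'

namespace GentlePresentation

variable {K R V E : Type u} [Field K] [Ring R] [Algebra K R] (D : GentlePresentation K R V E)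

/-! ### The radical: products of arrows, their span and its powers. -/

/-- The products of arrows, of positive length. -/
def arrowProducts : Set R := {x | ∃ l : List E, l ≠ [] ∧ x = (l.map D.a).prod}

/-- The span of all arrow products, which is the radical of `R`. -/
def arrowSpan : Submodule K R := Submodule.span K D.arrowProducts

theorem a_mem_arrowSpan (α : E) : D.a α ∈ D.arrowSpan :=
  Submodule.subset_span ⟨[α], by simp, by simp⟩

theorem span_generators :
    Submodule.span K (Set.range D.e ∪ D.arrowProducts) = ⊤ :=
  eq_top_iff.2 fun r _ => D.generates r

theorem a_mul_e_of_ne {α : E} {v : V} (h : D.src α ≠ v) : D.a α * D.e v = 0 := by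
  rw [← D.a_mul_e, mul_assoc, D.e_mul_of_ne _ _ h, mul_zero]

theorem e_mul_a_of_ne {α : E} {v : V} (h : D.tgt α ≠ v) : D.e v * D.a α = 0 := by
  rw [← D.e_mul_a, ← mul_assoc, D.e_mul_of_ne _ _ h.symm, zero_mul]

theorem src_eq_tgt {α β : E} (h : D.a β * D.a α ≠ 0) : D.src β = D.tgt α := by
  by_contra h'
  refine h ?_
  rw [← D.e_mul_a α, ← mul_assoc, D.a_mul_e_of_ne h', zero_mul]

theorem arrowProducts_mul_e {x : R} (hx : x ∈ D.arrowProducts) (v : V) :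
    x * D.e v = x ∨ x * D.e v = 0 := by
  obtain ⟨l, hl, rfl⟩ := hx
  rw [← List.dropLast_append_getLast hl, List.map_append, List.prod_append]
  simp only [List.map_cons, List.map_nil, List.prod_singleton, mul_assoc]
  by_cases h : D.src (l.getLast hl) = v
  · left; rw [← h, D.a_mul_e]
  · right; rw [D.a_mul_e_of_ne h, mul_zero]

theorem e_mul_arrowProducts {x : R} (hx : x ∈ D.arrowProducts) (v : V) :
    D.e v * x = x ∨ D.e v * x = 0 := by
  obtain ⟨l, hl, rfl⟩ := hx
  cases l with
  | nil => exact absurd rfl hl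
  | cons α l =>
    simp only [List.map_cons, List.prod_cons, ← mul_assoc]
    by_cases h : D.tgt α = v
    · left; rw [← h, D.e_mul_a]
    · right; rw [D.e_mul_a_of_ne h, zero_mul]

theorem arrowProducts_mul {x y : R} (hx : x ∈ D.arrowProducts) (hy : y ∈ D.arrowProducts) :
    x * y ∈ D.arrowProducts := by
  obtain ⟨l, hl, rfl⟩ := hx
  obtain ⟨l', _, rfl⟩ := hy
  exact ⟨l ++ l', by simp [hl], by simp⟩

/-- An idempotent fixes or kills a product of arrows, and two products concatenate; so the arrow
span is an ideal, here on the left and in `arrowSpan_mul_top` on the right. -/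
theorem top_mul_arrowSpan : (⊤ : Submodule K R) * D.arrowSpan ≤ D.arrowSpan := by
  rw [← D.span_generators, arrowSpan, Submodule.span_mul_span, Submodule.span_le]
  rintro _ ⟨x, ⟨v, rfl⟩ | hx, y, hy, rfl⟩
  · rcases D.e_mul_arrowProducts hy v with h | h <;> simp only [h]
    · exact Submodule.subset_span hy
    · exact Submodule.zero_mem _
  · exact Submodule.subset_span (D.arrowProducts_mul hx hy)

theorem arrowSpan_mul_top : D.arrowSpan * (⊤ : Submodule K R) ≤ D.arrowSpan := by
  rw [← D.span_generators, arrowSpan, Submodule.span_mul_span, Submodule.span_le]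
  rintro _ ⟨y, hy, x, ⟨v, rfl⟩ | hx, rfl⟩
  · rcases D.arrowProducts_mul_e hy v with h | h <;> simp only [h]
    · exact Submodule.subset_span hy
    · exact Submodule.zero_mem _
  · exact Submodule.subset_span (D.arrowProducts_mul hy hx)

theorem mul_mem_arrowSpan (r : R) {x : R} (hx : x ∈ D.arrowSpan) : r * x ∈ D.arrowSpan :=
  D.top_mul_arrowSpan (Submodule.mul_mem_mul Submodule.mem_top hx)

theorem mem_arrowProducts_pow {n : ℕ} {x : R} (hx : x ∈ D.arrowProducts ^ n) :
    ∃ l : List E, n ≤ l.length ∧ x = (l.map D.a).prod := by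
  induction n generalizing x with
  | zero => exact ⟨[], le_rfl, by simpa using hx⟩
  | succ n ih =>
    rw [pow_succ] at hx
    obtain ⟨y, hy, z, ⟨l', hl', rfl⟩, rfl⟩ := hx
    obtain ⟨l, hl, rfl⟩ := ih hy
    refine ⟨l ++ l', ?_, by simp⟩
    have := List.length_pos_iff.2 hl'
    simp only [List.length_append]
    omega

theorem exists_arrowSpan_pow_eq_bot : ∃ N, D.arrowSpan ^ N = ⊥ := by
  obtain ⟨N, hN⟩ := D.nilpotent
  refine ⟨N, ?_⟩
  rw [arrowSpan, Submodule.span_pow, Submodule.span_eq_bot]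
  intro x hx
  obtain ⟨l, hl, rfl⟩ := D.mem_arrowProducts_pow hx
  exact hN l hl

/-- The powers of the radical, as right ideals. -/
def radPow (k : ℕ) : Submodule K R := D.arrowSpan ^ k * ⊤

theorem one_mem_radPow : (1 : R) ∈ D.radPow 0 := by
  rw [radPow, pow_zero, one_mul]
  exact Submodule.mem_top

theorem mul_mem_radPow {k : ℕ} {x : R} (hx : x ∈ D.radPow k) (r : R) : x * r ∈ D.radPow k := by
  have h₁ := Submodule.mul_mem_mul hx (Submodule.mem_top (x := r))
  have h₂ : D.arrowSpan ^ k * (⊤ * ⊤) ≤ D.radPow k := mul_le_mul' le_rfl le_top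
  rw [radPow, mul_assoc] at h₁
  exact h₂ h₁

theorem mul_a_mem_radPow {k : ℕ} {x : R} (hx : x ∈ D.radPow k) (α : E) :
    x * D.a α ∈ D.radPow (k + 1) := by
  rw [radPow, ← mul_one (x * D.a α)]
  refine Submodule.mul_mem_mul ?_ Submodule.mem_top
  have h₁ := Submodule.mul_mem_mul hx (D.a_mem_arrowSpan α)
  rw [radPow, mul_assoc] at h₁
  rw [pow_succ]
  exact mul_le_mul' le_rfl D.top_mul_arrowSpan h₁

theorem exists_radPow_eq_bot : ∃ N, D.radPow N = ⊥ := by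
  obtain ⟨N, hN⟩ := D.exists_arrowSpan_pow_eq_bot
  exact ⟨N, by rw [radPow, hN, Submodule.bot_mul]⟩

theorem isNilpotent_of_mem {x : R} (hx : x ∈ D.arrowSpan) : IsNilpotent x := by
  obtain ⟨N, hN⟩ := D.exists_arrowSpan_pow_eq_bot
  refine ⟨N, ?_⟩
  have := Submodule.pow_mem_pow D.arrowSpan hx N
  rwa [hN, Submodule.mem_bot] at this

/-- A nonzero scalar is a central unit, and adding a nilpotent element to it leaves a unit. -/
theorem isUnit_algebraMap_add {c : K} {r : R} (hr : r ∈ D.arrowSpan) (hc : c ≠ 0) :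
    IsUnit (algebraMap K R c + r) :=
  (D.isNilpotent_of_mem hr).isUnit_add_left_of_commute ((IsUnit.mk0 c hc).map _)
    (Algebra.commute_algebraMap_right c r)

theorem eq_zero_of_smul_add_eq_zero {c : K} {r x : R} (hr : r ∈ D.arrowSpan) (hx : x ≠ 0)
    (h : c • x + r * x = 0) : c = 0 := by
  by_contra hc
  refine hx ((D.isUnit_algebraMap_add hr hc).mul_right_eq_zero.1 ?_)
  rw [add_mul, ← Algebra.smul_def, h]

/-- Every element of `R` acts on `g = e v * g` as a scalar, up to terms `r * (a α * g)`. -/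
theorem exists_scalar (r g : R) (v : V) (hg : D.e v * g = g) (N : Submodule R R)
    (hN : ∀ α, D.a α * g ∈ N) : ∃ c : K, r * g - c • g ∈ N := by
  induction D.generates r using Submodule.span_induction with
  | mem x hx =>
    rcases hx with ⟨w, rfl⟩ | ⟨l, hl, rfl⟩
    · by_cases h : w = v
      · exact ⟨1, by simp [h, hg]⟩
      · refine ⟨0, ?_⟩
        rw [← hg, ← mul_assoc, D.e_mul_of_ne w v h]
        simp
    · refine ⟨0, ?_⟩
      rw [← List.dropLast_append_getLast hl, List.map_append, List.prod_append]
      simp only [List.map_cons, List.map_nil, List.prod_singleton, mul_assoc, zero_smul, sub_zero]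
      exact N.smul_mem _ (hN _)
  | zero => exact ⟨0, by simp⟩
  | add x y _ _ hx hy =>
    obtain ⟨c, hc⟩ := hx
    obtain ⟨d, hd⟩ := hy
    refine ⟨c + d, ?_⟩
    have := N.add_mem hc hd
    rwa [show x * g - c • g + (y * g - d • g) = (x + y) * g - (c + d) • g by
      rw [add_mul, add_smul]; abel] at this
  | smul k x _ hx =>
    obtain ⟨c, hc⟩ := hx
    refine ⟨k * c, ?_⟩
    have := N.smul_mem (algebraMap K R k) hc
    rwa [smul_eq_mul, ← Algebra.smul_def, smul_sub, ← smul_mul_assoc, smul_smul] at this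

/-! #### Optional arrows -/

/-- The element of `R` given by an optional arrow, which is zero if there is none. -/
def opt : Option E → R
  | none => 0
  | some α => D.a α

@[simp] theorem opt_none : D.opt none = 0 := rfl

@[simp] theorem opt_some (α : E) : D.opt (some α) = D.a α := rfl

theorem opt_mem_arrowSpan (x : Option E) : D.opt x ∈ D.arrowSpan := by
  cases x with
  | none => exact Submodule.zero_mem _
  | some α => exact D.a_mem_arrowSpan α

/-- The optional arrow `y` is the one that continues the arrow `β` with nonzero product. -/
def Continues (β : E) (y : Option E) : Prop := ∀ α, y = some α ↔ D.a α * D.a β ≠ 0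

theorem exists_continues (β : E) : ∃ y, D.Continues β y := by
  by_cases h : ∃ α, D.a α * D.a β ≠ 0
  · obtain ⟨α, hα⟩ := h
    refine ⟨some α, fun α' => ⟨?_, fun h' => by rw [D.next_unique β α α' hα h']⟩⟩
    rintro ⟨⟩
    exact hα
  · exact ⟨none, fun α => ⟨by simp, fun h' => absurd ⟨α, h'⟩ h⟩⟩

variable {D} in
-- All arrows other than `y` kill `a β` from the left, so R a_β = K a_β + R a_y a_β.
theorem Continues.exists_scalar {β : E} {y : Option E} (h : D.Continues β y) (r : R) :
    ∃ (c : K) (r' : R), r * D.a β = c • D.a β + r' * D.opt y * D.a β := by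
  obtain ⟨c, hc⟩ := D.exists_scalar r (D.a β) _ (D.e_mul_a β)
    (Submodule.span R {D.opt y * D.a β}) fun α => by
      by_cases h' : D.a α * D.a β = 0
      · rw [h']; exact Submodule.zero_mem _
      · rw [(h α).2 h']; exact Submodule.mem_span_singleton_self _
  obtain ⟨r', hr'⟩ := Submodule.mem_span_singleton.1 hc
  refine ⟨c, r', ?_⟩
  rw [smul_eq_mul, ← mul_assoc] at hr'
  rw [hr']; abel

variable {D} in
theorem Continues.cancel {β : E} {y : Option E} (h : D.Continues β y) {r : R}
    (hr : r * D.opt y * D.a β = 0) : r * D.opt y = 0 := by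
  cases y with
  | none => simp
  | some α => exact D.cancel r β α ((h α).1 rfl) hr

/-- The optional arrows `x` and `y` are distinct and are the only ones to start at `v`. -/
structure Starts (v : V) (x y : Option E) : Prop where
  src_left : ∀ α, x = some α → D.src α = v
  src_right : ∀ α, y = some α → D.src α = v
  ne : ∀ α, x = some α → y ≠ some α
  exhaust : ∀ α, D.src α = v → x = some α ∨ y = some α

variable {D} in
theorem Starts.symm {v : V} {x y : Option E} (h : D.Starts v x y) : D.Starts v y x :=
  ⟨h.src_right, h.src_left, fun α h₁ h₂ => h.ne α h₂ h₁, fun α hα => (h.exhaust α hα).symm⟩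

theorem exists_starts_some (v : V) (α : E) (hα : D.src α = v) :
    ∃ y, D.Starts v (some α) y := by
  by_cases h : ∃ β, D.src β = v ∧ β ≠ α
  · obtain ⟨β, hβ, hne⟩ := h
    refine ⟨some β, ?_, ?_, ?_, ?_⟩
    · rintro _ ⟨⟩; exact hα
    · rintro _ ⟨⟩; exact hβ
    · rintro _ ⟨⟩ ⟨⟩; exact hne rfl
    · intro γ hγ
      rcases D.starting_le_two α β γ (hα.trans hβ.symm) (hβ.trans hγ.symm) with h | h | h
      · exact absurd h.symm hne
      · exact Or.inr (by rw [h])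
      · exact Or.inl (by rw [h])
  · refine ⟨none, ?_, ?_, ?_, ?_⟩
    · rintro _ ⟨⟩; exact hα
    · simp
    · simp
    · intro γ hγ
      left
      by_contra h'
      exact h ⟨γ, hγ, fun h'' => h' (by rw [h''])⟩

/-- At a peak of a string up to two of the arrows at `v` are letters of the string. They are
assigned to the left and the right slope in advance, and the remaining arrows at `v` fill the free
places. -/
theorem exists_starts (v : V) (x y : Option E) (hx : ∀ α, x = some α → D.src α = v)
    (hy : ∀ α, y = some α → D.src α = v) (hne : ∀ α, x = some α → y ≠ some α) :
    ∃ x' y', D.Starts v x' y' ∧ (∀ α, x = some α → x' = some α) ∧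
      ∀ α, y = some α → y' = some α := by
  cases x with
  | some α =>
    obtain ⟨y', h⟩ := D.exists_starts_some v α (hx α rfl)
    refine ⟨some α, y', h, by simp, fun β hβ => ?_⟩
    rcases h.exhaust β (hy β hβ) with h' | h'
    · exact absurd hβ (hne β h')
    · exact h'
  | none =>
    cases y with
    | some β =>
      obtain ⟨x', h⟩ := D.exists_starts_some v β (hy β rfl)
      exact ⟨x', some β, h.symm, by simp, by simp⟩
    | none =>
      by_cases h : ∃ α, D.src α = v
      · obtain ⟨α, hα⟩ := h
        obtain ⟨y', h⟩ := D.exists_starts_some v α hα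
        exact ⟨_, _, h, by simp, by simp⟩
      · exact ⟨none, none, ⟨by simp, by simp, by simp, fun α hα => absurd ⟨α, hα⟩ h⟩,
          by simp, by simp⟩

variable {D} in
-- This is R e_v = K e_v + R a_x + R a_y; `Starts.disjoint` adds that the sum of the last two terms
-- is direct.
theorem Starts.exists_scalar {v : V} {x y : Option E} (h : D.Starts v x y) (r : R) :
    ∃ (c : K) (s t : R), r * D.e v = c • D.e v + s * D.opt x + t * D.opt y := by
  obtain ⟨c, hc⟩ := D.exists_scalar r (D.e v) v (D.e_mul_self v)
    (Submodule.span R {D.opt x, D.opt y}) fun α => by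
      by_cases h' : D.src α = v
      · rw [← h', D.a_mul_e]
        rcases h.exhaust α h' with rfl | rfl
        · exact Submodule.subset_span (by simp)
        · exact Submodule.subset_span (by simp)
      · rw [D.a_mul_e_of_ne h']; exact Submodule.zero_mem _
  obtain ⟨s, t, hst⟩ := Submodule.mem_span_pair.1 hc
  refine ⟨c, s, t, ?_⟩
  rw [smul_eq_mul, smul_eq_mul] at hst
  rw [add_assoc, hst]; abel

variable {D} in
theorem Starts.disjoint {v : V} {x y : Option E} (h : D.Starts v x y) {r s : R}
    (hrs : r * D.opt x + s * D.opt y = 0) : r * D.opt x = 0 ∧ s * D.opt y = 0 := by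
  have h₁ : r * D.opt x = 0 := by
    cases x with
    | none => simp
    | some α =>
      cases y with
      | none => simpa using hrs
      | some β =>
        refine D.disjoint r (-s) α β (fun h' => h.ne α rfl (by rw [h'])) ?_
        rw [neg_mul]
        exact eq_neg_of_add_eq_zero_left hrs
  exact ⟨h₁, by rwa [h₁, zero_add] at hrs⟩

theorem opt_mul_e {v : V} {x : Option E} (h : ∀ α, x = some α → D.src α = v) :
    D.opt x * D.e v = D.opt x := by
  cases x with
  | none => simp
  | some α => rw [← h α rfl]; exact D.a_mul_e α

/-! #### The radical of a module -/

section Radical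

variable (P : Type u) [AddCommGroup P] [Module R P]

/-- The submodule generated by all elements `a α • p`. -/
def rad : Submodule R P := Submodule.span R {x | ∃ (α : E) (p : P), x = D.a α • p}

variable {P}

theorem a_smul_mem_rad (α : E) (p : P) : D.a α • p ∈ D.rad P :=
  Submodule.subset_span ⟨α, p, rfl⟩

theorem opt_smul_mem_rad (x : Option E) (p : P) : D.opt x • p ∈ D.rad P := by
  cases x with
  | none => simp
  | some α => exact D.a_smul_mem_rad α p

theorem map_mem_rad {P' : Type u} [AddCommGroup P'] [Module R P'] (f : P →ₗ[R] P') {p : P}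
    (hp : p ∈ D.rad P) : f p ∈ D.rad P' := by
  have : D.rad P ≤ (D.rad P').comap f := by
    refine Submodule.span_le.2 ?_
    rintro _ ⟨α, p, rfl⟩
    change f (D.a α • p) ∈ D.rad P'
    rw [map_smul]
    exact D.a_smul_mem_rad α _
  exact this hp

/-- Nakayama's lemma for a nilpotent radical J. By descending induction on d, J^d P lies in N: in p
= n + j with j in the radical of P, multiplication by J^d sends n into N and j into J^(d+1) P. -/
theorem eq_top_of_sup_rad {N : Submodule R P} (h : N ⊔ D.rad P = ⊤) : N = ⊤ := by
  obtain ⟨m, hm⟩ := D.exists_radPow_eq_bot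
  have key : ∀ k d, d + k = m → ∀ x ∈ D.radPow d, ∀ p : P, x • p ∈ N := by
    intro k
    induction k with
    | zero =>
      intro d hd x hx p
      rw [add_zero] at hd
      rw [hd, hm, Submodule.mem_bot] at hx
      simp [hx]
    | succ k ih =>
      intro d hd x hx p
      have hp : p ∈ N ⊔ D.rad P := h ▸ Submodule.mem_top
      obtain ⟨n, hn, j, hj, rfl⟩ := Submodule.mem_sup.1 hp
      rw [smul_add]
      refine N.add_mem (N.smul_mem _ hn) ?_
      clear hp
      induction hj using Submodule.span_induction generalizing x with
      | mem y hy =>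
        obtain ⟨α, q, rfl⟩ := hy
        rw [← mul_smul]
        exact ih (d + 1) (by omega) _ (D.mul_a_mem_radPow hx α) q
      | zero => simp
      | add y z _ _ hy hz => rw [smul_add]; exact N.add_mem (hy x hx) (hz x hx)
      | smul r y _ hy =>
        rw [← mul_smul]
        exact hy (x * r) (D.mul_mem_radPow hx r)
  refine eq_top_iff.2 fun p _ => ?_
  have := key m 0 (zero_add m) 1 D.one_mem_radPow p
  rwa [one_smul] at this

end Radical

end GentlePresentation

namespace GentlePresentation

variable {K R V E : Type u} [Field K] [Ring R] [Algebra K R] (D : GentlePresentation K R V E)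

/-! #### Radical presentations -/

/-- `N` is a first syzygy of `M`: there is a short exact sequence `0 → N → P → M → 0` in which `P` is
projective and `N` lies in the radical of `P`. -/
def RadSyzygy (M N : Type u) [AddCommGroup M] [Module R M] [AddCommGroup N] [Module R N] : Prop :=
  ∃ (P : Type u) (_ : AddCommGroup P) (_ : Module R P) (f : P →ₗ[R] M) (g : N →ₗ[R] P),
    Module.Projective R P ∧ Function.Surjective f ∧ Function.Injective g ∧
      LinearMap.ker f = LinearMap.range g ∧ LinearMap.range g ≤ D.rad P

section RadSyzygy

variable {D} {M N M' N' : Type u} [AddCommGroup M] [Module R M] [AddCommGroup N] [Module R N]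
  [AddCommGroup M'] [Module R M'] [AddCommGroup N'] [Module R N']

/-- A kernel inside the radical is superfluous by `eq_top_of_sup_rad`. Unlike superfluity, this
condition is visibly stable under direct sums, and it dualises well. -/
theorem RadSyzygy.isSyzygy (h : D.RadSyzygy M N) :
    IsSyzygy (ModuleCat.of R M) (ModuleCat.of R N) := by
  obtain ⟨P, _, _, f, g, hP, hf, hg, hfg, hr⟩ := h
  refine ⟨ModuleCat.of R P, f, ⟨hP, hf, fun N hN => ?_⟩, ⟨?_⟩⟩
  · refine D.eq_top_of_sup_rad (eq_top_iff.2 ?_)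
    rw [← hN]
    exact sup_le_sup_left (hfg.le.trans hr) N
  · exact (LinearEquiv.ofInjective g hg).trans (LinearEquiv.ofEq _ _ hfg.symm)

theorem RadSyzygy.prod (h : D.RadSyzygy M N) (h' : D.RadSyzygy M' N') :
    D.RadSyzygy (M × M') (N × N') := by
  obtain ⟨P, _, _, f, g, hP, hf, hg, hfg, hr⟩ := h
  obtain ⟨P', _, _, f', g', hP', hf', hg', hfg', hr'⟩ := h'
  refine ⟨P × P', inferInstance, inferInstance, f.prodMap f', g.prodMap g', inferInstance,
    ?_, ?_, ?_, ?_⟩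
  · exact hf.prodMap hf'
  · exact hg.prodMap hg'
  · rw [LinearMap.ker_prodMap, LinearMap.range_prodMap, hfg, hfg']
  · rw [LinearMap.range_prodMap]
    rintro ⟨p, p'⟩ ⟨hp, hp'⟩
    have h₁ := D.map_mem_rad (LinearMap.inl R P P') (hr hp)
    have h₂ := D.map_mem_rad (LinearMap.inr R P P') (hr' hp')
    simpa using add_mem h₁ h₂

theorem RadSyzygy.of_projective [Module.Projective R M] [Subsingleton N] : D.RadSyzygy M N :=
  ⟨M, inferInstance, inferInstance, LinearMap.id, 0, inferInstance, Function.surjective_id,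
    Function.injective_of_subsingleton _, by simp, by simp⟩

end RadSyzygy

/-! #### The left ideals generated by arrows and idempotents -/

/-- The projective module `R e v`. -/
abbrev proj (v : V) : Submodule R R := Submodule.span R {D.e v}

/-- The module generated by an optional arrow. -/
abbrev optSpan (x : Option E) : Submodule R R := Submodule.span R {D.opt x}

theorem mem_proj {v : V} {r : R} : r ∈ D.proj v ↔ r * D.e v = r := by
  rw [Submodule.mem_span_singleton]
  constructor
  · rintro ⟨s, rfl⟩
    rw [smul_eq_mul, mul_assoc, D.e_mul_self]
  · exact fun h => ⟨r, h⟩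

theorem mul_e_mem_proj (r : R) (v : V) : r * D.e v ∈ D.proj v :=
  D.mem_proj.2 (by rw [mul_assoc, D.e_mul_self])

instance projective_proj (v : V) : Module.Projective R (D.proj v) := by
  refine Module.Projective.of_split (M := R) (D.proj v).subtype
    ((LinearMap.toSpanSingleton R R (D.e v)).codRestrict _ fun r => D.mul_e_mem_proj r v) ?_
  exact LinearMap.ext fun x => Subtype.ext (D.mem_proj.1 x.2)

/-- The optional arrow `y` is the one that continues the arrow `β` with zero product. -/
def ContinuesZero (β : E) (y : Option E) : Prop :=
  ∀ α, y = some α ↔ D.src α = D.tgt β ∧ D.a α * D.a β = 0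

theorem exists_continuesZero (β : E) : ∃ y, D.ContinuesZero β y := by
  by_cases h : ∃ α, D.src α = D.tgt β ∧ D.a α * D.a β = 0
  · obtain ⟨α, hα, h⟩ := h
    refine ⟨some α, fun α' => ⟨?_, fun h' => by
      rw [D.next_zero_unique β α α' hα h'.1 h h'.2]⟩⟩
    rintro ⟨⟩
    exact ⟨hα, h⟩
  · exact ⟨none, fun α => ⟨by simp, fun h' => absurd ⟨α, h'⟩ h⟩⟩

variable {D} in
-- Every arrow that starts where `β` ends has either zero or nonzero product with `β`, and each kind
-- occurs at most once.
theorem Continues.starts {β : E} {x y : Option E} (hx : D.Continues β x)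
    (hy : D.ContinuesZero β y) : D.Starts (D.tgt β) x y where
  src_left α h := D.src_eq_tgt ((hx α).1 h)
  src_right α h := ((hy α).1 h).1
  ne α h h' := (hx α).1 h ((hy α).1 h').2
  exhaust α h := by
    by_cases h' : D.a α * D.a β = 0
    · exact Or.inr ((hy α).2 ⟨h, h'⟩)
    · exact Or.inl ((hx α).2 h')

/-- The cover is r ↦ r a_β on R e_v, where v is the end of β; its kernel is generated by the arrow
that annihilates β. -/
theorem radSyzygy_arrow {β : E} {y : Option E} (hy : D.ContinuesZero β y) :
    D.RadSyzygy (D.optSpan (some β)) (D.optSpan y) := by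
  obtain ⟨x, hx⟩ := D.exists_continues β
  have hs := hx.starts hy
  have hy0 : D.opt y * D.a β = 0 := by
    cases y with
    | none => simp
    | some α => exact ((hy α).1 rfl).2
  have hle : D.optSpan y ≤ D.proj (D.tgt β) := by
    rw [Submodule.span_singleton_le_iff_mem, mem_proj]
    exact D.opt_mul_e hs.src_right
  refine ⟨D.proj (D.tgt β), inferInstance, inferInstance,
    ((LinearMap.toSpanSingleton R R (D.a β)).codRestrict (D.optSpan (some β)) fun r =>
      Submodule.smul_mem _ r (Submodule.mem_span_singleton_self _)) ∘ₗ (D.proj (D.tgt β)).subtype,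
    Submodule.inclusion hle, inferInstance, ?_, Submodule.inclusion_injective hle, ?_, ?_⟩
  · rintro ⟨x, hx⟩
    obtain ⟨r, rfl⟩ := Submodule.mem_span_singleton.1 hx
    refine ⟨⟨_, D.mul_e_mem_proj r _⟩, Subtype.ext ?_⟩
    change r * D.e _ * D.a β = r * D.a β
    rw [mul_assoc, D.e_mul_a]
  · ext ⟨r, hr⟩
    rw [LinearMap.mem_ker, Submodule.range_inclusion, Submodule.mem_comap, Submodule.subtype_apply,
      ← Subtype.val_inj]
    change r * D.a β = 0 ↔ r ∈ _
    constructor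
    · intro h
      -- With r = c e_v + s a_x + t a_y, the last term kills a_β. Then (c + s a_x) a_β = 0 forces c
      -- = 0, since s a_x is nilpotent, and s a_x = 0 follows by cancellation.
      obtain ⟨c, s, t, hst⟩ := hs.exists_scalar r
      rw [D.mem_proj.1 hr] at hst
      rw [hst, add_mul, add_mul, smul_mul_assoc, D.e_mul_a, mul_assoc t, hy0, mul_zero,
        add_zero] at h
      have hc := D.eq_zero_of_smul_add_eq_zero (D.mul_mem_arrowSpan s (D.opt_mem_arrowSpan x))
        (D.a_ne_zero β) h
      rw [hc, zero_smul, zero_add] at h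
      rw [hst, hc, hx.cancel h, zero_smul, zero_add, zero_add]
      exact Submodule.smul_mem _ t (Submodule.mem_span_singleton_self _)
    · intro h
      obtain ⟨s, rfl⟩ := Submodule.mem_span_singleton.1 h
      rw [smul_eq_mul, mul_assoc, hy0, mul_zero]
  · rintro _ ⟨⟨r, hr⟩, rfl⟩
    obtain ⟨s, rfl⟩ := Submodule.mem_span_singleton.1 hr
    have h := Submodule.smul_mem _ s (D.opt_smul_mem_rad y
      (⟨D.e (D.tgt β), Submodule.mem_span_singleton_self _⟩ : D.proj (D.tgt β)))
    convert h using 1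
    refine Subtype.ext ?_
    change s * D.opt y = s * (D.opt y * D.e _)
    rw [D.opt_mul_e hs.src_right]

/-- The optional arrow that continues an optional arrow with zero product. -/
def nextZero : Option E → Option E
  | none => none
  | some β => (D.exists_continuesZero β).choose

theorem subsingleton_optSpan_none : Subsingleton (D.optSpan none) := by
  rw [optSpan, opt_none, Submodule.span_zero_singleton]; infer_instance

theorem radSyzygy_nextZero (x : Option E) :
    D.RadSyzygy (D.optSpan x) (D.optSpan (D.nextZero x)) := by
  cases x with
  | none =>
    have := D.subsingleton_optSpan_none
    have : Subsingleton (D.optSpan (D.nextZero none)) := this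
    exact RadSyzygy.of_projective
  | some β => exact D.radSyzygy_arrow (D.exists_continuesZero β).choose_spec

/-! #### Modules generated by an arrow are uniserial -/

/-- Induction along a path: a property of a path follows from that of its continuation. -/
theorem path_induction {C : R → Prop} (zero : C 0)
    (step : ∀ β x y, D.Continues β y → C (D.opt y * (D.a β * x)) → C (D.a β * x)) (β : E) (x : R) :
    C (D.a β * x) := by
  obtain ⟨m, hm⟩ := D.exists_arrowSpan_pow_eq_bot
  -- Each continuation raises the radical power d that contains the path, and the m-th power is
  -- zero.
  have key : ∀ k d, d + k = m → ∀ β x, D.a β * x ∈ D.arrowSpan ^ d → C (D.a β * x) := by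
    intro k
    induction k with
    | zero =>
      intro d hd β x hx
      rw [add_zero] at hd
      rw [hd, hm, Submodule.mem_bot] at hx
      rwa [hx]
    | succ k ih =>
      intro d hd β x hx
      obtain ⟨y, hy⟩ := D.exists_continues β
      refine step β x y hy ?_
      cases y with
      | none => simpa using zero
      | some α =>
        refine ih (d + 1) (by omega) α _ ?_
        rw [pow_succ']
        exact Submodule.mul_mem_mul (D.a_mem_arrowSpan α) hx
  -- If m = 0, the zeroth power contains 1 and vanishes, so R is the zero ring.
  by_cases hd : m = 0
  · have h : (1 : R) ∈ D.arrowSpan ^ m := by rw [hd, pow_zero]; exact Submodule.one_le.1 le_rfl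
    rw [hm, Submodule.mem_bot] at h
    rwa [← mul_one (D.a β * x), h, mul_zero]
  · refine key (m - 1) 1 (by omega) β x ?_
    rw [pow_one]
    obtain h := Submodule.mul_mem_mul (D.a_mem_arrowSpan β) (Submodule.mem_top (x := x) (R := K))
    exact D.arrowSpan_mul_top h

variable {D} in
theorem Continues.exists_scalar_mul {β : E} {y : Option E} (hy : D.Continues β y) (x r : R) :
    ∃ (c : K) (r' : R), r * (D.a β * x) = c • (D.a β * x) + r' * (D.opt y * (D.a β * x)) := by
  obtain ⟨c, r', h⟩ := hy.exists_scalar r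
  exact ⟨c, r', by rw [← mul_assoc, h, add_mul, smul_mul_assoc]; simp only [mul_assoc]⟩

theorem span_singleton_eq_of_smul_add {x r : R} {c : K} (hr : r ∈ D.arrowSpan) (hc : c ≠ 0) :
    Submodule.span R {c • x + r * x} = Submodule.span R {x} := by
  obtain ⟨u, hu⟩ := D.isUnit_algebraMap_add hr hc
  have hs : c • x + r * x = u • x := by
    rw [Units.smul_def, hu, smul_eq_mul, add_mul, Algebra.smul_def]
  rw [hs]
  exact Submodule.span_singleton_group_smul_eq R u x

/-- An element of R a_β x is a scalar multiple of a_β x plus an element of R a_y a_β x. If the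
scalar is nonzero, the element generates all of R a_β x; otherwise it already lies in the submodule
of the longer path, where induction applies. -/
theorem span_singleton_total (β : E) (x s t : R) (hs : s ∈ Submodule.span R {D.a β * x})
    (ht : t ∈ Submodule.span R {D.a β * x}) :
    Submodule.span R {s} ≤ Submodule.span R {t} ∨ Submodule.span R {t} ≤ Submodule.span R {s} := by
  revert s t
  refine D.path_induction (C := fun z => ∀ s t, s ∈ Submodule.span R {z} →
    t ∈ Submodule.span R {z} → Submodule.span R {s} ≤ Submodule.span R {t} ∨
      Submodule.span R {t} ≤ Submodule.span R {s}) ?_ ?_ β x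
  · intro s t hs _
    rw [Submodule.span_zero_singleton, Submodule.mem_bot] at hs
    left
    rw [hs, Submodule.span_zero_singleton]
    exact bot_le
  · intro β x y hy ih s t hs ht
    have key : ∀ s ∈ Submodule.span R {D.a β * x},
        Submodule.span R {s} = Submodule.span R {D.a β * x} ∨
          s ∈ Submodule.span R {D.opt y * (D.a β * x)} := by
      intro s hs
      obtain ⟨r, rfl⟩ := Submodule.mem_span_singleton.1 hs
      obtain ⟨c, r', h⟩ := hy.exists_scalar_mul x r
      rw [smul_eq_mul, h]
      by_cases hc : c = 0
      · right
        rw [hc, zero_smul, zero_add]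
        exact Submodule.smul_mem _ _ (Submodule.mem_span_singleton_self _)
      · left
        rw [← mul_assoc r']
        exact D.span_singleton_eq_of_smul_add
          (D.mul_mem_arrowSpan r' (D.opt_mem_arrowSpan y)) hc
    rcases key s hs with h | h
    · right; rw [h]; exact (Submodule.span_singleton_le_iff_mem _ _).2 ht
    · rcases key t ht with h' | h'
      · left; rw [h']; exact (Submodule.span_singleton_le_iff_mem _ _).2 hs
      · exact ih s t h h'

theorem isUniserial_optSpan (α : E) : IsUniserial R (D.optSpan (some α)) := by
  intro N N'
  by_contra! h
  obtain ⟨⟨s, hs⟩, hsN, hsN'⟩ := SetLike.not_le_iff_exists.1 h.1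
  obtain ⟨⟨t, ht⟩, htN', htN⟩ := SetLike.not_le_iff_exists.1 h.2
  have hα : D.opt (some α) = D.a α * 1 := (mul_one _).symm
  rcases D.span_singleton_total α 1 s t (hα ▸ hs) (hα ▸ ht) with h | h
  · obtain ⟨r, hr⟩ := Submodule.mem_span_singleton.1 ((Submodule.span_singleton_le_iff_mem _ _).1 h)
    refine hsN' ?_
    convert N'.smul_mem r htN' using 1
    exact Subtype.ext hr.symm
  · obtain ⟨r, hr⟩ := Submodule.mem_span_singleton.1 ((Submodule.span_singleton_le_iff_mem _ _).1 h)
    refine htN ?_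
    convert N.smul_mem r hsN using 1
    exact Subtype.ext hr.symm

/-- Each step along the path contributes at most one dimension. Finiteness is what allows
uniseriality to pass to the dual. -/
theorem finite_optSpan (x : Option E) : Module.Finite K (D.optSpan x) := by
  cases x with
  | none => have := D.subsingleton_optSpan_none; infer_instance
  | some α =>
    have key := D.path_induction
      (C := fun z => ((Submodule.span R {z}).restrictScalars K).FG) ?_ ?_ α 1
    · rw [mul_one] at key
      exact Module.Finite.iff_fg.2 key
    · rw [Submodule.span_zero_singleton, Submodule.restrictScalars_bot]
      exact Submodule.fg_bot
    · intro β x y hy ih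
      have : (Submodule.span R {D.a β * x}).restrictScalars K = Submodule.span K {D.a β * x} ⊔
          (Submodule.span R {D.opt y * (D.a β * x)}).restrictScalars K := by
        refine le_antisymm ?_ (sup_le ?_ ?_)
        · intro s hs
          obtain ⟨r, rfl⟩ := Submodule.mem_span_singleton.1 hs
          obtain ⟨c, r', h⟩ := hy.exists_scalar_mul x r
          rw [smul_eq_mul, h]
          exact Submodule.add_mem_sup (Submodule.smul_mem _ _ (Submodule.mem_span_singleton_self _))
            (Submodule.smul_mem _ r' (Submodule.mem_span_singleton_self _))
        · rw [Submodule.span_singleton_le_iff_mem]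
          exact Submodule.mem_span_singleton_self _
        · intro s hs
          obtain ⟨r, rfl⟩ := Submodule.mem_span_singleton.1 hs
          rw [smul_eq_mul, ← mul_assoc]
          exact Submodule.smul_mem _ _ (Submodule.mem_span_singleton_self _)
      rw [this]
      exact (Submodule.fg_span_singleton _).sup ih

end GentlePresentation

namespace GentlePresentation

variable {K R V E : Type u} [Field K] [Ring R] [Algebra K R] (D : GentlePresentation K R V E)

/-! #### String modules and their projective covers -/

section Strings

section Chain

variable {D} {M : Type u} [AddCommGroup M] [Module R M]

theorem exists_smul_eq_of_chain (ζ : ℕ → M) (b : ℕ → E) (n : ℕ)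
    (hζ : ∀ k < n, D.a (b k) • ζ k = ζ (k + 1)) (k : ℕ) (hk : k ≤ n) : ∃ r : R, r • ζ 0 = ζ k := by
  induction k with
  | zero => exact ⟨1, one_smul _ _⟩
  | succ k ih =>
    obtain ⟨r, hr⟩ := ih (by omega)
    exact ⟨D.a (b k) * r, by rw [mul_smul, hr, hζ k (by omega)]⟩

end Chain

variable {M : Type u} [AddCommGroup M] [Module K M] [Module R M]

/-- The elements `z 0, …, z m` form a basis of `M` on which the arrows act along the walk with
letters `w 0, …, w (m - 1)`: the letter `(true, α)` at `i` takes `z i` to `z (i + 1)`, and the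
letter `(false, α)` takes `z (i + 1)` to `z i`. -/
structure IsStringBasis (m : ℕ) (z : ℕ → M) (w : ℕ → Bool × E) : Prop where
  span_eq : Submodule.span K (z '' Set.Icc 0 m) = ⊤
  coord : ∃ ε : ℕ → M →ₗ[K] K, ∀ k ≤ m, ∀ l ≤ m, ε k (z l) = if k = l then 1 else 0
  smul_direct : ∀ i < m, ∀ α, w i = (true, α) → D.a α • z i = z (i + 1)
  smul_inverse : ∀ i < m, ∀ α, w i = (false, α) → D.a α • z (i + 1) = z i
  smul_eq_zero : ∀ i ≤ m, ∀ α, (i < m → w i ≠ (true, α)) → (∀ k, k + 1 = i → w k ≠ (false, α)) →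
    D.a α • z i = 0
  vertex : ∀ i ≤ m, ∃ v, D.e v • z i = z i
  reduced : ∀ i, i + 1 < m → (w (i + 1)).1 ≠ (w i).1 → (w (i + 1)).2 ≠ (w i).2
  direct : ∀ i, i + 1 < m → ∀ α β, w i = (true, α) → w (i + 1) = (true, β) → D.a β * D.a α ≠ 0
  inverse : ∀ i, i + 1 < m → ∀ α β, w i = (false, α) → w (i + 1) = (false, β) →
    D.a α * D.a β ≠ 0

/-- A projective presentation of the submodule spanned by `z j, …, z n`, with kernel the direct sum
of the module generated by `x`, a projective module, and the module generated by `y`. -/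
structure IsCover (z : ℕ → M) (j n : ℕ) (x y : Option E) {P Q : Type u} [AddCommGroup P]
    [Module R P] [AddCommGroup Q] [Module R Q] (f : P →ₗ[R] M) (h : Q →ₗ[R] P) (q p : P) :
    Prop where
  projective : Module.Projective R P
  projective_kernel : Module.Projective R Q
  map_left : f q = z j
  map_right : f p = z n
  map_kernel : ∀ s, f (h s) = 0
  opt_left : D.opt x • z j = 0
  opt_right : D.opt y • z n = 0
  exists_of_eq_zero : ∀ t, f t = 0 → ∃ r s r', t = (r * D.opt x) • q + h s + (r' * D.opt y) • p
  independent : ∀ r s r', (r * D.opt x) • q + h s + (r' * D.opt y) • p = 0 →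
    r * D.opt x = 0 ∧ s = 0 ∧ r' * D.opt y = 0
  mem_rad : ∀ s, h s ∈ D.rad P
  mem_span : ∀ t, f t ∈ Submodule.span K (z '' Set.Icc j n)
  mem_range : ∀ k ∈ Set.Icc j n, z k ∈ LinearMap.range f

variable {D} {z : ℕ → M} {m : ℕ} {w : ℕ → Bool × E}

namespace IsStringBasis

theorem ne_zero (hz : D.IsStringBasis m z w) {i : ℕ} (hi : i ≤ m) : z i ≠ 0 := by
  obtain ⟨ε, hε⟩ := hz.coord
  intro h
  have := hε i hi i hi
  simp [h] at this

theorem eq_zero_of_smul (hz : D.IsStringBasis m z w) {i : ℕ} (hi : i ≤ m) {c : K}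
    (h : c • z i = 0) : c = 0 :=
  (_root_.smul_eq_zero.1 h).resolve_right (hz.ne_zero hi)

/-- The intersection of the spans of two segments with a common end. -/
theorem exists_smul_eq (hz : D.IsStringBasis m z w) {j n l : ℕ} (hjn : j ≤ n) (hnl : n ≤ l)
    (hl : l ≤ m) {x : M} (h₁ : x ∈ Submodule.span K (z '' Set.Icc j n))
    (h₂ : x ∈ Submodule.span K (z '' Set.Icc n l)) : ∃ c : K, x = c • z n := by
  obtain ⟨ε, hε⟩ := hz.coord
  have hsum : ∀ x ∈ Submodule.span K (z '' Set.Icc j n),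
      x = ∑ k ∈ Finset.Icc j n, ε k x • z k := by
    intro x hx
    induction hx using Submodule.span_induction with
    | mem x hx =>
      obtain ⟨k, hk, rfl⟩ := hx
      rw [Finset.sum_eq_single k]
      · rw [hε k (hk.2.trans (hnl.trans hl)) k (hk.2.trans (hnl.trans hl)), if_pos rfl, one_smul]
      · intro k' hk' hne
        rw [hε k' ((Finset.mem_Icc.1 hk').2.trans (hnl.trans hl)) k (hk.2.trans (hnl.trans hl)),
          if_neg hne, zero_smul]
      · exact fun h => absurd (Finset.mem_Icc.2 hk) h
    | zero => simp
    | add x y _ _ hx hy =>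
      simp only [map_add, add_smul, Finset.sum_add_distrib]
      rw [← hx, ← hy]
    | smul c x _ hx =>
      simp only [map_smul, smul_assoc]
      rw [← Finset.smul_sum, ← hx]
  have hzero : ∀ k < n, ε k x = 0 := by
    intro k hk
    have hle : Submodule.span K (z '' Set.Icc n l) ≤ LinearMap.ker (ε k) := by
      rw [Submodule.span_le]
      rintro _ ⟨k', hk', rfl⟩
      change ε k (z k') = 0
      rw [hε k (by omega) k' (hk'.2.trans hl), if_neg]
      have := hk'.1
      omega
    exact hle h₂
  refine ⟨ε n x, ?_⟩
  conv_lhs => rw [hsum x h₁]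
  refine Finset.sum_eq_single n (fun k hk hne => ?_) fun h =>
    absurd (Finset.mem_Icc.2 ⟨hjn, le_rfl⟩) h
  rw [hzero k (lt_of_le_of_ne (Finset.mem_Icc.1 hk).2 hne), zero_smul]

end IsStringBasis

variable [IsScalarTower K R M]

/-- The product of the arrows along a path that descends from `ζ 0`, with its continuation `y`. -/
theorem exists_path (ζ : ℕ → M) (b : ℕ → E) (n : ℕ) (y₀ : Option E) (v : V)
    (h0 : D.e v • ζ 0 = ζ 0) (hy : D.opt y₀ * D.e v = D.opt y₀) (hb0 : 0 < n → y₀ = some (b 0))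
    (hζ : ∀ k < n, D.a (b k) • ζ k = ζ (k + 1))
    (hb : ∀ k, k + 1 < n → D.a (b (k + 1)) * D.a (b k) ≠ 0) :
    ∃ (y : Option E) (p : R), p * D.e v = p ∧ p • ζ 0 = ζ n ∧ (n = 0 → y = y₀) ∧
      (∀ k, k + 1 = n → D.Continues (b k) y ∧ ∃ p', p' * D.e v = p' ∧ p = D.a (b k) * p') ∧
      (∃ c, D.opt y * p = c * D.opt y₀) ∧ (∀ r, r * D.opt y * p = 0 → r * D.opt y = 0) ∧
      ∀ r, ∃ (κ : ℕ → K) (s r' : R), r * D.opt y₀ = s + r' * D.opt y * p ∧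
        s • ζ 0 = ∑ k ∈ Finset.range n, κ k • ζ (k + 1) ∧ ((∀ k < n, κ k = 0) → s = 0) := by
  induction n with
  | zero =>
    -- The empty path: the product is e_v, and its continuation is the prescribed arrow `y₀`.
    refine ⟨y₀, D.e v, D.e_mul_self v, h0, fun _ => rfl, by simp, ⟨1, by rw [hy, one_mul]⟩, ?_, ?_⟩
    · intro r h
      rwa [mul_assoc, hy] at h
    · exact fun r => ⟨0, 0, r, by rw [zero_add, mul_assoc, hy], by simp, fun _ => rfl⟩
  | succ n ih =>
    obtain ⟨y, p, hp, hpz, hn0, hc, ⟨c, hcy⟩, hinj, hdec⟩ := ih (fun h => hb0 (by omega))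
      (fun k hk => hζ k (by omega)) fun k hk => hb k (by omega)
    -- The continuation of the path so far is the next letter: by the choice of `y₀` at the start,
    -- and afterwards because nonzero continuations are unique.
    have hyb : y = some (b n) := by
      rcases Nat.eq_zero_or_pos n with rfl | hn
      · rw [hn0 rfl, hb0 (by omega)]
      · obtain ⟨k, rfl⟩ : ∃ k, n = k + 1 := ⟨n - 1, by omega⟩
        exact ((hc k rfl).1 _).2 (hb k (by omega))
    obtain ⟨y', hy'⟩ := D.exists_continues (b n)
    rw [hyb] at hcy
    simp only [hyb, D.opt_some] at hinj hdec
    refine ⟨y', D.a (b n) * p, by rw [mul_assoc, hp], ?_, by omega, ?_, ?_, ?_, ?_⟩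
    · rw [mul_smul, hpz, hζ n (by omega)]
    · intro k hk
      obtain rfl : k = n := by omega
      exact ⟨hy', p, hp, rfl⟩
    · exact ⟨D.opt y' * c, by rw [mul_assoc, ← hcy]; rfl⟩
    · intro r h
      refine hy'.cancel (hinj (r * D.opt y') ?_)
      rwa [mul_assoc (r * D.opt y')]
    · intro r
      obtain ⟨κ, s, r', h₁, h₂, h₃⟩ := hdec r
      -- The scalar `d` is the coefficient of the new basis vector ζ (n + 1); the rest is passed on
      -- to the next continuation.
      obtain ⟨d, r'', h₄⟩ := hy'.exists_scalar r'
      refine ⟨Function.update κ n d, s + d • (D.a (b n) * p), r'', ?_, ?_, ?_⟩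
      · rw [h₁, h₄, add_mul, smul_mul_assoc, add_assoc]
        simp only [mul_assoc]
      · rw [add_smul, h₂, Finset.sum_range_succ, Function.update_self, smul_assoc, mul_smul, hpz,
          hζ n (by omega)]
        congr 1
        refine Finset.sum_congr rfl fun k hk => ?_
        rw [Function.update_of_ne (Finset.mem_range.1 hk).ne]
      · intro h
        have hd := h n (by omega)
        rw [Function.update_self] at hd
        rw [h₃ fun k hk => ?_, hd, zero_smul, add_zero]
        have := h k (by omega)
        rwa [Function.update_of_ne hk.ne] at this

variable (D) in
/-- The projective part of the kernel of the sum of two covers that agree at one end. -/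
def glueKernel {P Q P' Q' : Type u} [AddCommGroup P] [Module R P] [AddCommGroup Q] [Module R Q]
    [AddCommGroup P'] [Module R P'] [AddCommGroup Q'] [Module R Q'] (h : Q →ₗ[R] P)
    (h' : Q' →ₗ[R] P') (p : P) (q' : P') (v : V) : Q × D.proj v × Q' →ₗ[R] P × P' :=
  ((h ∘ₗ LinearMap.fst R Q (D.proj v × Q')) + (LinearMap.toSpanSingleton R P p ∘ₗ
      (D.proj v).subtype ∘ₗ LinearMap.fst R (D.proj v) Q' ∘ₗ LinearMap.snd R Q _)).prod
    ((h' ∘ₗ LinearMap.snd R (D.proj v) Q' ∘ₗ LinearMap.snd R Q _) -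
      (LinearMap.toSpanSingleton R P' q' ∘ₗ (D.proj v).subtype ∘ₗ
        LinearMap.fst R (D.proj v) Q' ∘ₗ LinearMap.snd R Q _))

theorem glueKernel_apply {P Q P' Q' : Type u} [AddCommGroup P] [Module R P] [AddCommGroup Q]
    [Module R Q] [AddCommGroup P'] [Module R P'] [AddCommGroup Q'] [Module R Q'] (h : Q →ₗ[R] P)
    (h' : Q' →ₗ[R] P') (p : P) (q' : P') (v : V) (s : Q) (ρ : D.proj v) (s' : Q') :
    D.glueKernel h h' p q' v (s, ρ, s') = (h s + ρ.1 • p, h' s' - ρ.1 • q') := rfl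

/-- The kernel of f + f' consists of the two kernels and the relation (p, -q') that comes from f p =
z n = f' q'. Since R e_v = K e_v + R a_y + R a_x', where a_x' kills p and a_y kills q', the
multiples of (p, -q') by R e_v account for this relation and absorb both inner end terms. They form
the new projective summand. -/
theorem IsCover.glue {j n l : ℕ} {x y x' y' : Option E} {P Q P' Q' : Type u} [AddCommGroup P]
    [Module R P] [AddCommGroup Q] [Module R Q] [AddCommGroup P'] [Module R P'] [AddCommGroup Q']
    [Module R Q'] {f : P →ₗ[R] M} {h : Q →ₗ[R] P} {q p : P} {f' : P' →ₗ[R] M} {h' : Q' →ₗ[R] P'}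
    {q' p' : P'} (hz : D.IsStringBasis m z w) (hjn : j ≤ n) (hnl : n ≤ l) (hl : l ≤ m)
    (hc : D.IsCover z j n x y f h q p) (hc' : D.IsCover z n l x' y' f' h' q' p') {γ δ : E} {v : V}
    {p₀ : P} {q₀ : P'} (hp : p = D.a γ • p₀) (hq : q' = D.a δ • q₀) (hne : γ ≠ δ)
    (hγ : D.tgt γ = v) (hδ : D.tgt δ = v) (hy : D.Continues γ y) (hx : D.Continues δ x') :
    D.IsCover z j l x y' (f.coprod f') (D.glueKernel h h' p q' v)
      (q, 0) (0, p') := by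
  -- An arrow at v cannot have nonzero product with both γ and δ, nor zero product with both, as
  -- either would force γ = δ. Hence the continuations of γ and of δ are distinct and are all the
  -- arrows at v.
  have hs : D.Starts v y x' :=
    { src_left := fun α h => hγ ▸ D.src_eq_tgt ((hy α).1 h)
      src_right := fun α h => hδ ▸ D.src_eq_tgt ((hx α).1 h)
      ne := fun α h h' => hne (D.prev_unique α γ δ ((hy α).1 h) ((hx α).1 h'))
      exhaust := fun α hα => by
        by_contra! h'
        refine hne (D.prev_zero_unique α γ δ (hα.trans hγ.symm) (hα.trans hδ.symm) ?_ ?_)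
        · by_contra h''
          exact h'.1 ((hy α).2 h'')
        · by_contra h''
          exact h'.2 ((hx α).2 h'') }
  have hyq : D.opt y • q' = 0 := by
    cases y with
    | none => simp
    | some α =>
      rw [hq, D.opt_some, ← mul_smul]
      by_cases h₀ : D.a α * D.a δ = 0
      · rw [h₀, zero_smul]
      · exact absurd (D.prev_unique α γ δ ((hy α).1 rfl) h₀) hne
  have hxp : D.opt x' • p = 0 := by
    cases x' with
    | none => simp
    | some α =>
      rw [hp, D.opt_some, ← mul_smul]
      by_cases h₀ : D.a α * D.a γ = 0
      · rw [h₀, zero_smul]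
      · exact absurd (D.prev_unique α γ δ h₀ ((hx α).1 rfl)) hne
  have hep : D.e v • p = p := by rw [hp, ← mul_smul, ← hγ, D.e_mul_a]
  have heq : D.e v • q' = q' := by rw [hq, ← mul_smul, ← hδ, D.e_mul_a]
  have hez : D.e v • z n = z n := by rw [← hc.map_right, ← map_smul, hep]
  have := hc.projective
  have := hc'.projective
  have := hc.projective_kernel
  have := hc'.projective_kernel
  refine ⟨inferInstance, inferInstance, ?_, ?_, ?_, hc.opt_left, hc'.opt_right, ?_, ?_, ?_, ?_, ?_⟩
  · simp [hc.map_left]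
  · simp [hc'.map_right]
  · rintro ⟨s, ρ, s'⟩
    simp [glueKernel_apply, hc.map_kernel, hc'.map_kernel, hc.map_right, hc'.map_left]
  · rintro ⟨t, t'⟩ ht
    rw [LinearMap.coprod_apply] at ht
    have h₁ := hc.mem_span t
    have h₂ : f t ∈ Submodule.span K (z '' Set.Icc n l) := by
      rw [eq_neg_of_add_eq_zero_left ht]
      exact Submodule.neg_mem _ (hc'.mem_span t')
    -- The two segments share only z n, so f t = -f' t' is a multiple of z n. Correcting t and t' by
    -- this multiple of p and q' brings them into the two kernels.
    obtain ⟨c, hcz⟩ := hz.exists_smul_eq hjn hnl hl h₁ h₂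
    have hcz' : (c • D.e v) • z n = c • z n := by rw [smul_assoc, hez]
    obtain ⟨r, s, r', h₃⟩ := hc.exists_of_eq_zero (t - (c • D.e v) • p) (by
      rw [map_sub, map_smul, hc.map_right, hcz', hcz, sub_self])
    obtain ⟨r₁, s', r₁', h₄⟩ := hc'.exists_of_eq_zero (t' + (c • D.e v) • q') (by
      rw [map_add, map_smul, hc'.map_left, hcz', ← hcz, add_comm]; exact ht)
    -- The minus sign before r₁ compensates for that of -q'. In the first component only c e_v and
    -- a_y act on p, in the second only c e_v and a_x' act on q'.
    refine ⟨r, (s, ⟨c • D.e v + r' * D.opt y - r₁ * D.opt x', D.mem_proj.2 ?_⟩, s'), r₁', ?_⟩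
    · rw [sub_mul, add_mul, smul_mul_assoc, D.e_mul_self, mul_assoc, mul_assoc,
        D.opt_mul_e hs.src_left, D.opt_mul_e hs.src_right]
    · rw [sub_eq_iff_eq_add] at h₃
      rw [← eq_sub_iff_add_eq] at h₄
      refine Prod.ext ?_ ?_
      · simp only [h₃, glueKernel_apply, Prod.fst_add, Prod.smul_fst, smul_zero, add_zero,
          sub_smul, add_smul, mul_smul r₁, hxp, sub_zero]
        abel
      · simp only [h₄, glueKernel_apply, Prod.snd_add, Prod.smul_snd, smul_zero, zero_add,
          sub_smul, add_smul, mul_smul r', hyq, add_zero]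
        abel
  · rintro r ⟨s, ρ, s'⟩ r' h₀
    have h₁ := congrArg Prod.fst h₀
    have h₂ := congrArg Prod.snd h₀
    simp only [glueKernel_apply, Prod.fst_add, Prod.smul_fst, smul_zero, add_zero,
      Prod.fst_zero] at h₁
    simp only [glueKernel_apply, Prod.snd_add, Prod.smul_snd, smul_zero, zero_add,
      Prod.snd_zero] at h₂
    obtain ⟨c, r₁, r₂, hρ⟩ := hs.exists_scalar ρ.1
    rw [D.mem_proj.1 ρ.2] at hρ
    -- Applying f leaves only the scalar part of ρ, as c z_n = 0; so c = 0, and the parts of ρ in R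
    -- a_y and R a_x' are tested in P and P' separately.
    have h₃ := congrArg f h₁
    rw [map_add, map_add, map_smul, map_smul, hc.map_left, hc.map_kernel, hc.map_right, mul_smul,
      hc.opt_left, smul_zero, zero_add, zero_add, map_zero, hρ, add_smul, add_smul, mul_smul,
      mul_smul, hc.opt_right, hc'.opt_left, smul_zero, smul_zero, add_zero, add_zero, smul_assoc,
      hez] at h₃
    have hc0 := hz.eq_zero_of_smul (hnl.trans hl) h₃
    rw [hc0, zero_smul, zero_add] at hρ
    rw [hρ, add_smul, mul_smul r₂, hxp, smul_zero, add_zero, ← add_assoc] at h₁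
    rw [hρ, add_smul, mul_smul r₁, hyq, smul_zero, zero_add, sub_eq_neg_add, ← neg_smul,
      ← neg_mul] at h₂
    obtain ⟨h₄, h₅, h₆⟩ := hc.independent _ _ _ h₁
    obtain ⟨h₇, h₈, h₉⟩ := hc'.independent _ _ _ h₂
    rw [neg_mul, neg_eq_zero] at h₇
    refine ⟨h₄, ?_, h₉⟩
    rw [h₆, h₇, zero_add] at hρ
    exact Prod.ext h₅ (Prod.ext (Subtype.ext hρ) h₈)
  · rintro ⟨s, ρ, s'⟩
    have h₁ := D.map_mem_rad (LinearMap.inl R P P')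
      (add_mem (hc.mem_rad s) ((D.rad P).smul_mem ρ.1 (D.a_smul_mem_rad γ p₀)))
    have h₂ := D.map_mem_rad (LinearMap.inr R P P')
      (sub_mem (hc'.mem_rad s') ((D.rad P').smul_mem ρ.1 (D.a_smul_mem_rad δ q₀)))
    rw [← hp] at h₁
    rw [← hq] at h₂
    simpa [glueKernel_apply] using add_mem h₁ h₂
  · rintro ⟨t, t'⟩
    rw [LinearMap.coprod_apply]
    exact add_mem
      (Submodule.span_mono (Set.image_mono (Set.Icc_subset_Icc_right hnl)) (hc.mem_span t))
      (Submodule.span_mono (Set.image_mono (Set.Icc_subset_Icc_left hjn)) (hc'.mem_span t'))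
  · intro k hk
    rw [LinearMap.range_coprod]
    rcases le_total k n with h' | h'
    · exact Submodule.mem_sup_left (hc.mem_range k ⟨hk.1, h'⟩)
    · exact Submodule.mem_sup_right (hc'.mem_range k ⟨h', hk.2⟩)

end Strings

end GentlePresentation

/-! ### Covers of segments with a single peak, and the cover of a whole string. -/

namespace GentlePresentation

variable {K R V E : Type u} [Field K] [Ring R] [Algebra K R] {D : GentlePresentation K R V E}

section Strings

variable {M : Type u} [AddCommGroup M] [Module R M]
  {z : ℕ → M} {m : ℕ} {w : ℕ → Bool × E}

theorem src_eq_of_smul_ne_zero {α : E} {v : V} {x : M} (hx : D.e v • x = x)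
    (h : D.a α • x ≠ 0) : D.src α = v := by
  by_contra h'
  refine h ?_
  rw [← hx, ← mul_smul, D.a_mul_e_of_ne h', zero_smul]

theorem tgt_eq_of_smul_eq {α : E} {v : V} {x y : M} (hy : D.e v • y = y) (hne : y ≠ 0)
    (h : D.a α • x = y) : D.tgt α = v := by
  by_contra h'
  refine hne ?_
  rw [← hy, ← h, ← mul_smul, D.e_mul_a_of_ne h', zero_smul]

variable [Module K M]

namespace IsStringBasis

theorem smul_right (hz : D.IsStringBasis m z w) {i : ℕ} (hi : i < m) (h : (w i).1 = true) :
    D.a (w i).2 • z i = z (i + 1) :=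
  hz.smul_direct i hi _ (Prod.ext h rfl)

theorem smul_left (hz : D.IsStringBasis m z w) {i : ℕ} (hi : i < m) (h : (w i).1 = false) :
    D.a (w i).2 • z (i + 1) = z i :=
  hz.smul_inverse i hi _ (Prod.ext h rfl)

theorem opt_smul_eq_zero (hz : D.IsStringBasis m z w) {i : ℕ} (hi : i ≤ m) {x : Option E}
    (h₁ : ∀ α, x = some α → i < m → w i ≠ (true, α))
    (h₂ : ∀ α, x = some α → ∀ k, k + 1 = i → w k ≠ (false, α)) : D.opt x • z i = 0 := by
  cases x with
  | none => simp
  | some α => exact hz.smul_eq_zero i hi α (h₁ α rfl) (h₂ α rfl)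

/-- The indices i, i - (k + 1) with k < a, and i + (k + 1) with k < b are distinct, so the
coordinate forms separate the terms; a ≤ i keeps the truncated subtraction harmless. -/
theorem eq_zero_of_sum (hz : D.IsStringBasis m z w) {i a b : ℕ} (ha : a ≤ i) (hb : i + b ≤ m)
    {c : K} {κ κ' : ℕ → K} (h : c • z i + ∑ k ∈ Finset.range a, κ k • z (i - (k + 1)) +
      ∑ k ∈ Finset.range b, κ' k • z (i + (k + 1)) = 0) :
    c = 0 ∧ (∀ k < a, κ k = 0) ∧ ∀ k < b, κ' k = 0 := by
  obtain ⟨ε, hε⟩ := hz.coord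
  have key : ∀ l ≤ m, c * (if l = i then 1 else 0) +
      ∑ k ∈ Finset.range a, κ k * (if l = i - (k + 1) then 1 else 0) +
      ∑ k ∈ Finset.range b, κ' k * (if l = i + (k + 1) then 1 else 0) = 0 := by
    intro l hl
    have h' := congrArg (ε l) h
    simp only [map_add, map_sum, map_smul, smul_eq_mul, map_zero] at h'
    rw [hε l hl i (by omega)] at h'
    refine Eq.trans ?_ h'
    congr 1
    · congr 1
      exact Finset.sum_congr rfl fun k _ => by rw [hε l hl _ (by omega)]
    · refine Finset.sum_congr rfl fun k hk => ?_
      have := Finset.mem_range.1 hk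
      rw [hε l hl _ (by omega)]
  refine ⟨?_, fun k hk => ?_, fun k hk => ?_⟩
  · have := key i (by omega)
    rw [if_pos rfl, mul_one, Finset.sum_eq_zero, Finset.sum_eq_zero, add_zero, add_zero] at this
    · exact this
    · exact fun k _ => by rw [if_neg (by omega), mul_zero]
    · intro k hk
      have := Finset.mem_range.1 hk
      rw [if_neg (by omega), mul_zero]
  · have := key (i - (k + 1)) (by omega)
    rw [if_neg (by omega), mul_zero, zero_add, Finset.sum_eq_single k, if_pos rfl, mul_one,
      Finset.sum_eq_zero, add_zero] at this
    · exact this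
    · exact fun k _ => by rw [if_neg (by omega), mul_zero]
    · intro k' hk' hne
      have := Finset.mem_range.1 hk'
      rw [if_neg (by omega), mul_zero]
    · exact fun h => absurd (Finset.mem_range.2 hk) h
  · have := key (i + (k + 1)) (by omega)
    rw [if_neg (by omega), mul_zero, zero_add, add_comm, Finset.sum_eq_single k, if_pos rfl,
      mul_one, Finset.sum_eq_zero, add_zero] at this
    · exact this
    · exact fun k _ => by rw [if_neg (by omega), mul_zero]
    · intro k' _ hne
      rw [if_neg (by omega), mul_zero]
    · exact fun h => absurd (Finset.mem_range.2 hk) h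

variable [IsScalarTower K R M]

/-- The projective cover of a segment of a string with a single peak. -/
theorem exists_cover_peak (hz : D.IsStringBasis m z w) {j i n : ℕ} (hji : j ≤ i) (hin : i ≤ n)
    (hn : n ≤ m) (hl : ∀ k, j ≤ k → k < i → (w k).1 = false)
    (hr : ∀ k, i ≤ k → k < n → (w k).1 = true)
    (hj : 0 < j → j < i ∧ ∀ k, k + 1 = j → (w k).1 = true)
    (hn' : n < m → i < n ∧ (w n).1 = false) :
    ∃ (x y : Option E) (v : V) (f : D.proj v →ₗ[R] M) (q p : D.proj v),
      D.IsCover z j n x y f (0 : PUnit.{u + 1} →ₗ[R] D.proj v) q p ∧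
        (j < i → D.Continues (w j).2 x ∧ ∃ q₀, q = D.a (w j).2 • q₀) ∧
        (∀ k, k + 1 = n → i < n → D.Continues (w k).2 y ∧ ∃ p₀, p = D.a (w k).2 • p₀) := by
  obtain ⟨v, hv⟩ := hz.vertex i (hin.trans hn)
  obtain ⟨x₀, y₀, hs, hx₀, hy₀⟩ : ∃ x₀ y₀, D.Starts v x₀ y₀ ∧
      (∀ k, k + 1 = i → j < i → x₀ = some (w k).2) ∧ (i < n → y₀ = some (w i).2) := by
    -- If the slope on one side is empty, no arrow is prescribed there, and `exists_starts` supplies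
    -- the remaining arrow at v, if there is one.
    have hx : ∀ α, (if j < i then some (w (i - 1)).2 else none) = some α → D.src α = v := by
      intro α h
      split_ifs at h with hlt
      cases h
      have := hz.smul_left (i := i - 1) (by omega) (hl _ (by omega) (by omega))
      rw [Nat.sub_add_cancel (by omega)] at this
      refine src_eq_of_smul_ne_zero hv ?_
      rw [this]
      exact hz.ne_zero (by omega)
    have hy : ∀ α, (if i < n then some (w i).2 else none) = some α → D.src α = v := by
      intro α h
      split_ifs at h with hlt
      cases h
      refine src_eq_of_smul_ne_zero hv ?_
      rw [hz.smul_right (by omega) (hr _ le_rfl hlt)]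
      exact hz.ne_zero (by omega)
    obtain ⟨x₀, y₀, hs, h₁, h₂⟩ := D.exists_starts v _ _ hx hy (by
      intro α h h'
      split_ifs at h h' with hlt hlt'
      obtain ⟨k, rfl⟩ : ∃ k, i = k + 1 := ⟨i - 1, by omega⟩
      rw [Nat.add_sub_cancel] at h
      refine hz.reduced k (by omega) ?_ (Option.some.inj (h'.trans h.symm))
      rw [hr _ le_rfl hlt', hl k (by omega) (by omega)]
      simp)
    refine ⟨x₀, y₀, hs, fun k hk hlt => h₁ _ ?_, fun hlt => h₂ _ ?_⟩
    · rw [if_pos hlt, ← hk, Nat.add_sub_cancel]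
    · rw [if_pos hlt]
  have hζ : ∀ k < i - j, D.a (w (i - 1 - k)).2 • z (i - k) = z (i - (k + 1)) := by
    intro k hk
    have := hz.smul_left (i := i - 1 - k) (by omega) (hl _ (by omega) (by omega))
    rwa [show i - 1 - k + 1 = i - k by omega, show z (i - 1 - k) = z (i - (k + 1)) from
      congrArg z (by omega)] at this
  have hζ' : ∀ k < n - i, D.a (w (i + k)).2 • z (i + k) = z (i + (k + 1)) := fun k hk =>
    hz.smul_right (by omega) (hr _ (by omega) (by omega))
  -- The left slope is read downwards from the peak, against the numbering of the string.
  obtain ⟨x, q, hq, hqz, hx0, hxc, ⟨d, hd⟩, hxinj, hxdec⟩ := exists_path (D := D)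
    (fun k => z (i - k)) (fun k => (w (i - 1 - k)).2) (i - j) x₀ v hv (D.opt_mul_e hs.src_left)
    (fun h => hx₀ _ (by omega) (by omega)) hζ (fun k hk => by
      refine hz.inverse (i - 1 - (k + 1)) (by omega) _ _
        (Prod.ext (hl _ (by omega) (by omega)) rfl) ?_
      rw [show i - 1 - (k + 1) + 1 = i - 1 - k by omega]
      exact Prod.ext (hl _ (by omega) (by omega)) rfl)
  obtain ⟨y, p, hp, hpz, hy0, hyc, ⟨d', hd'⟩, hyinj, hydec⟩ := exists_path (D := D)
    (fun k => z (i + k)) (fun k => (w (i + k)).2) (n - i) y₀ v hv (D.opt_mul_e hs.src_right)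
    (fun h => hy₀ (by omega)) hζ' (fun k hk =>
      hz.direct (i + k) (by omega) _ _ (Prod.ext (hr _ (by omega) (by omega)) rfl)
        (Prod.ext (hr _ (by omega) (by omega)) rfl))
  simp only [Nat.sub_zero, Nat.add_zero, Nat.sub_sub_self hji, Nat.add_sub_cancel' hin]
    at hqz hpz hxdec hydec
  -- No letter lets x act on z j. On a nonempty slope the letter at j points into z j; on an empty
  -- one it belongs to the other arrow at the peak. A letter before j also points into z j.
  have hxz : D.opt x • z j = 0 := by
    refine hz.opt_smul_eq_zero (by omega) (fun α hα hjm h => ?_) fun α hα k hk h => ?_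
    · rcases hji.lt_or_eq with hlt | rfl
      · have := hl j le_rfl hlt
        simp [h] at this
      · have hjn : j < n := by
          by_contra h'
          exact h' (hn' (by omega)).1
        have h₁ := hy₀ hjn
        rw [h] at h₁
        exact hs.ne α (by rw [← hx0 (by omega), hα]) h₁
    · have := (hj (by omega)).2 k hk
      simp [h] at this
  have hyz : D.opt y • z n = 0 := by
    refine hz.opt_smul_eq_zero hn (fun α hα hnm h => ?_) fun α hα k hk h => ?_
    · have := (hn' hnm).2
      simp [h] at this
    · rcases hin.lt_or_eq with hlt | rfl
      · have := hr k (by omega) (by omega)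
        simp [h] at this
      · have hji' : j < i := by
          by_contra h'
          exact h' (hj (by omega)).1
        have h₁ := hx₀ k hk hji'
        rw [h] at h₁
        exact hs.ne α h₁ (by rw [← hy0 (by omega), hα])
  -- An element of R e_v has a scalar part, a part s and s' that moves z i along the two slopes and
  -- vanishes with its coefficients, and a part beyond the ends of the slopes that kills z i. By
  -- linear independence the kernel is exactly the last part.
  have hdec : ∀ r : R, r * D.e v = r → ∃ (c : K) (κ κ' : ℕ → K) (s s' t t' : R),
      r = c • D.e v + (s + t * D.opt x * q) + (s' + t' * D.opt y * p) ∧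
      r • z i = c • z i + ∑ k ∈ Finset.range (i - j), κ k • z (i - (k + 1)) +
        ∑ k ∈ Finset.range (n - i), κ' k • z (i + (k + 1)) ∧
      ((∀ k < i - j, κ k = 0) → s = 0) ∧ ((∀ k < n - i, κ' k = 0) → s' = 0) := by
    intro r hrv
    obtain ⟨c, s₀, t₀, h⟩ := hs.exists_scalar r
    obtain ⟨κ, s, t, h₁, h₂, h₃⟩ := hxdec s₀
    obtain ⟨κ', s', t', h₁', h₂', h₃'⟩ := hydec t₀
    rw [hrv, h₁, h₁'] at h
    refine ⟨c, κ, κ', s, s', t, t', h, ?_, h₃, h₃'⟩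
    rw [h, add_smul, add_smul, add_smul, add_smul, smul_assoc, hv, h₂, h₂', mul_smul, hqz,
      mul_smul, hxz, smul_zero, add_zero, mul_smul, hpz, mul_smul, hyz, smul_zero, add_zero]
  refine ⟨x, y, v, LinearMap.toSpanSingleton R M (z i) ∘ₗ (D.proj v).subtype,
    ⟨q, D.mem_proj.2 hq⟩, ⟨p, D.mem_proj.2 hp⟩, ?_, ?_, ?_⟩
  · refine ⟨inferInstance, inferInstance, hqz, hpz, ?_, hxz, hyz, ?_, ?_, ?_, ?_, ?_⟩
    · simp
    · rintro ⟨r, hrv⟩ h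
      change r • z i = 0 at h
      obtain ⟨c, κ, κ', s, s', t, t', h₁, h₂, h₃, h₃'⟩ := hdec r (D.mem_proj.1 hrv)
      rw [h₂] at h
      obtain ⟨h₄, h₅, h₆⟩ := hz.eq_zero_of_sum (by omega) (by omega) h
      rw [h₄, h₃ h₅, h₃' h₆, zero_smul, zero_add, zero_add, zero_add] at h₁
      refine ⟨t, 0, t', Subtype.ext ?_⟩
      rw [map_zero, add_zero]
      exact h₁
    · intro r s r' h
      have h₁ : r * D.opt x * q + r' * D.opt y * p = 0 := by
        have := congrArg Subtype.val h
        rwa [LinearMap.zero_apply, add_zero] at this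
      -- Both terms become multiples of the two initial arrows at the peak, whose left ideals meet
      -- in zero; afterwards the paths q and p are cancelled.
      rw [mul_assoc, hd, mul_assoc r', hd', ← mul_assoc, ← mul_assoc] at h₁
      obtain ⟨h₂, h₃⟩ := hs.disjoint h₁
      rw [mul_assoc, ← hd, ← mul_assoc] at h₂
      rw [mul_assoc, ← hd', ← mul_assoc] at h₃
      exact ⟨hxinj r h₂, Subsingleton.elim _ _, hyinj r' h₃⟩
    · intro s
      rw [LinearMap.zero_apply]
      exact Submodule.zero_mem _
    · rintro ⟨r, hrv⟩
      change r • z i ∈ _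
      obtain ⟨c, κ, κ', s, s', t, t', -, h₂, -, -⟩ := hdec r (D.mem_proj.1 hrv)
      rw [h₂]
      refine add_mem (add_mem (Submodule.smul_mem _ _ (Submodule.subset_span ⟨i, ⟨hji, hin⟩, rfl⟩))
        (Submodule.sum_mem _ fun k hk => ?_)) (Submodule.sum_mem _ fun k hk => ?_)
      · have := Finset.mem_range.1 hk
        exact Submodule.smul_mem _ _ (Submodule.subset_span ⟨_, ⟨by omega, by omega⟩, rfl⟩)
      · have := Finset.mem_range.1 hk
        exact Submodule.smul_mem _ _ (Submodule.subset_span ⟨_, ⟨by omega, by omega⟩, rfl⟩)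
    · intro k hk
      obtain ⟨r, hrz⟩ : ∃ r : R, r • z i = z k := by
        rcases le_total k i with h | h
        · obtain ⟨r, hr⟩ := exists_smul_eq_of_chain (D := D) _ _ _ hζ (i - k)
            (by have := hk.1; omega)
          exact ⟨r, by simpa [Nat.sub_sub_self h] using hr⟩
        · obtain ⟨r, hr⟩ := exists_smul_eq_of_chain (D := D) (fun k => z (i + k)) _ _ hζ' (k - i)
            (by have := hk.2; omega)
          exact ⟨r, by simpa [Nat.add_sub_cancel' h] using hr⟩
      refine ⟨⟨_, D.mul_e_mem_proj r v⟩, ?_⟩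
      change (r * D.e v) • z i = z k
      rw [mul_smul, hv, hrz]
  · intro hlt
    obtain ⟨h₁, q', hq', h₂⟩ := hxc (i - 1 - j) (by omega)
    rw [show i - 1 - (i - 1 - j) = j by omega] at h₁ h₂
    exact ⟨h₁, ⟨q', D.mem_proj.2 hq'⟩, Subtype.ext h₂⟩
  · intro k hk hlt
    obtain ⟨h₁, p', hp', h₂⟩ := hyc (k - i) (by omega)
    rw [show i + (k - i) = k by omega] at h₁ h₂
    exact ⟨h₁, ⟨p', D.mem_proj.2 hp'⟩, Subtype.ext h₂⟩

/-- Applied to the directions of the letters, this finds the next peak and then the next valley. -/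
theorem _root_.GentleAlgebra.exists_run (p : ℕ → Prop) {j m : ℕ} (hjm : j ≤ m) :
    ∃ i, j ≤ i ∧ i ≤ m ∧ (∀ k, j ≤ k → k < i → p k) ∧ (i < m → ¬ p i) := by
  induction m, hjm using Nat.le_induction with
  | base => exact ⟨j, le_rfl, le_rfl, fun k h h' => by omega, fun h => by omega⟩
  | succ m hjm ih =>
    obtain ⟨i, h₁, h₂, h₃, h₄⟩ := ih
    rcases h₂.lt_or_eq with h | rfl
    · exact ⟨i, h₁, by omega, h₃, fun _ => h₄ h⟩
    · by_cases hp : p i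
      · refine ⟨i + 1, by omega, le_rfl, fun k hk hk' => ?_, fun h => by omega⟩
        rcases Nat.lt_succ_iff_lt_or_eq.1 hk' with h | rfl
        · exact h₃ k hk h
        · exact hp
      · exact ⟨i, h₁, by omega, h₃, fun _ => hp⟩

/-- The projective cover of a final segment of a string that starts at an end or in a valley. -/
theorem exists_cover (hz : D.IsStringBasis m z w) {j : ℕ} (hjm : j ≤ m)
    (hj : 0 < j → j < m ∧ (w j).1 = false ∧ ∀ k, k + 1 = j → (w k).1 = true) :
    ∃ (x y : Option E) (P Q : Type u) (_ : AddCommGroup P) (_ : Module R P) (_ : AddCommGroup Q)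
      (_ : Module R Q) (f : P →ₗ[R] M) (h : Q →ₗ[R] P) (q p : P),
      D.IsCover z j m x y f h q p ∧
        (j < m → (w j).1 = false → D.Continues (w j).2 x ∧ ∃ q₀, q = D.a (w j).2 • q₀) := by
  induction hd : m - j using Nat.strong_induction_on generalizing j with
  | _ d ih =>
  -- Here i is the next peak, and n below is the valley after it or the end m of the string.
  obtain ⟨i, hji, him, hl, hi⟩ := exists_run (fun k => (w k).1 = false) hjm
  obtain ⟨n, hin, hnm, hr, hn⟩ := exists_run (fun k => (w k).1 = true) him
  simp only [Bool.not_eq_false] at hi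
  simp only [Bool.not_eq_true] at hn
  have hlt : j < m → (w j).1 = false → j < i := by
    intro h₁ h₂
    rcases hji.lt_or_eq with h | rfl
    · exact h
    · rw [hi h₁] at h₂
      cases h₂
  have hin' : n < m → i < n := by
    intro h₁
    rcases hin.lt_or_eq with h | rfl
    · exact h
    · have := hi h₁
      rw [hn h₁] at this
      cases this
  obtain ⟨x, y, v, f, q, p, hc, hcl, hcr⟩ := hz.exists_cover_peak hji hin hnm hl hr
    (fun h => ⟨hlt (hj h).1 (hj h).2.1, (hj h).2.2⟩) fun h => ⟨hin' h, hn h⟩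
  rcases hnm.lt_or_eq with hnm' | rfl
  · have hn0 := hin' hnm'
    obtain ⟨k, rfl⟩ : ∃ k, n = k + 1 := ⟨n - 1, by omega⟩
    have hkt : (w k).1 = true := hr k (by omega) (by omega)
    obtain ⟨x', y', P', Q', _, _, _, _, f', h', q', p', hc', hcl'⟩ := ih (m - (k + 1)) (by omega) hnm
      (fun _ => ⟨hnm', hn hnm', fun k' hk' => by
        obtain rfl : k' = k := by omega
        exact hkt⟩) rfl
    obtain ⟨hy, p₀, hp₀⟩ := hcr k rfl hn0
    obtain ⟨hx', q₀, hq₀⟩ := hcl' hnm' (hn hnm')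
    obtain ⟨v', hv'⟩ := hz.vertex (k + 1) hnm
    -- The arrows into the valley from its two sides are the letters k and k + 1. They have opposite
    -- directions, so they are different arrows because the string is reduced.
    have hglue := hc.glue hz (hji.trans hin) hnm le_rfl hc' hp₀ hq₀ (v := v') ?_ ?_ ?_ hy hx'
    · refine ⟨x, y', _, _, _, _, _, _, _, _, _, _, hglue, fun h₁ h₂ => ?_⟩
      obtain ⟨h₃, q₁, hq₁⟩ := hcl (hlt h₁ h₂)
      exact ⟨h₃, (q₁, 0), by rw [hq₁, Prod.smul_mk, smul_zero]⟩
    · refine fun h => hz.reduced k hnm' ?_ h.symm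
      rw [hkt, hn hnm']
      simp
    · exact tgt_eq_of_smul_eq hv' (hz.ne_zero hnm) (hz.smul_right (by omega) hkt)
    · exact tgt_eq_of_smul_eq hv' (hz.ne_zero hnm) (hz.smul_left hnm' (hn hnm'))
  · exact ⟨x, y, _, _, _, _, _, _, _, _, _, _, hc, fun h₁ h₂ => hcl (hlt h₁ h₂)⟩

/-- The first syzygy of a string module. -/
theorem exists_radSyzygy (hz : D.IsStringBasis m z w) :
    ∃ (x y : Option E) (Q : Type u) (_ : AddCommGroup Q) (_ : Module R Q),
      Module.Projective R Q ∧ D.RadSyzygy M (D.optSpan x × Q × D.optSpan y) := by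
  obtain ⟨x, y, P, Q, _, _, _, _, f, h, q, p, hc, -⟩ := hz.exists_cover (Nat.zero_le m)
    fun h => absurd h (lt_irrefl 0)
  let g : D.optSpan x × Q × D.optSpan y →ₗ[R] P :=
    (LinearMap.toSpanSingleton R P q ∘ₗ (D.optSpan x).subtype).coprod
      (h.coprod (LinearMap.toSpanSingleton R P p ∘ₗ (D.optSpan y).subtype))
  have hg : ∀ t, g t = t.1.1 • q + (h t.2.1 + t.2.2.1 • p) := fun _ => rfl
  have hmul : ∀ x (r : R), r * D.opt x ∈ D.optSpan x := fun x r =>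
    Submodule.smul_mem _ r (Submodule.mem_span_singleton_self _)
  have hmem : ∀ t, ∃ (r : R) (s : Q) (r' : R), t = ((⟨r * D.opt x, hmul x r⟩ : D.optSpan x), s,
      (⟨r' * D.opt y, hmul y r'⟩ : D.optSpan y)) := by
    rintro ⟨⟨t, ht⟩, s, ⟨t', ht'⟩⟩
    obtain ⟨r, rfl⟩ := Submodule.mem_span_singleton.1 ht
    obtain ⟨r', rfl⟩ := Submodule.mem_span_singleton.1 ht'
    exact ⟨r, s, r', rfl⟩
  refine ⟨x, y, Q, _, _, hc.projective_kernel, P, _, _, f, g, hc.projective, ?_, ?_, ?_, ?_⟩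
  · intro t
    have ht : t ∈ Submodule.span K (z '' Set.Icc 0 m) := hz.span_eq ▸ Submodule.mem_top
    have hle : Submodule.span K (z '' Set.Icc 0 m) ≤ (LinearMap.range f).restrictScalars K := by
      rw [Submodule.span_le]
      rintro _ ⟨k, hk, rfl⟩
      exact hc.mem_range k hk
    exact hle ht
  · rw [← LinearMap.ker_eq_bot, LinearMap.ker_eq_bot']
    intro t ht
    obtain ⟨r, s, r', rfl⟩ := hmem t
    rw [hg, ← add_assoc] at ht
    obtain ⟨h₁, h₂, h₃⟩ := hc.independent r s r' ht
    exact Prod.ext (Subtype.ext h₁) (Prod.ext h₂ (Subtype.ext h₃))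
  · ext t
    constructor
    · intro ht
      obtain ⟨r, s, r', rfl⟩ := hc.exists_of_eq_zero t ht
      exact ⟨(⟨r * D.opt x, hmul x r⟩, s, ⟨r' * D.opt y, hmul y r'⟩), by rw [hg, ← add_assoc]⟩
    · rintro ⟨t, rfl⟩
      obtain ⟨r, s, r', rfl⟩ := hmem t
      rw [LinearMap.mem_ker, hg, map_add, map_add, map_smul, map_smul, hc.map_left, hc.map_right,
        hc.map_kernel, mul_smul, hc.opt_left, mul_smul, hc.opt_right]
      simp
  · rintro _ ⟨t, rfl⟩
    obtain ⟨r, s, r', rfl⟩ := hmem t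
    rw [hg, mul_smul, mul_smul]
    exact add_mem (Submodule.smul_mem _ _ (D.opt_smul_mem_rad x q))
      (add_mem (hc.mem_rad s) (Submodule.smul_mem _ _ (D.opt_smul_mem_rad y p)))

end IsStringBasis

end Strings

end GentlePresentation

/-! ### Uniqueness of syzygies and cosyzygies -/

section Uniqueness

variable {R : Type u} [Ring R]

/-- Lift one cover through the other. The lift is onto because the kernel of the second cover is
superfluous, so it splits; its section is onto because the kernel of the first cover is superfluous.
So the lift is an isomorphism and matches the kernels. -/
theorem IsSyzygy.unique {M M' N N' : ModuleCat.{u} R} (h : IsSyzygy M N) (h' : IsSyzygy M' N')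
    (e : Nonempty (M ≃ₗ[R] M')) : Nonempty (N ≃ₗ[R] N') := by
  obtain ⟨φ⟩ := e
  obtain ⟨P, f, hf, ⟨i⟩⟩ := h
  obtain ⟨P', f', hf', ⟨i'⟩⟩ := h'
  have := hf.projective
  have := hf'.projective
  obtain ⟨g, hg⟩ := Module.projective_lifting_property f' (φ.toLinearMap ∘ₗ f) hf'.surjective
  have hg' : ∀ p, f' (g p) = φ (f p) := fun p => LinearMap.congr_fun hg p
  have hsurj : Function.Surjective g := by
    rw [← LinearMap.range_eq_top]
    refine hf'.superfluous _ (eq_top_iff.2 fun p _ => ?_)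
    obtain ⟨q, hq⟩ := hf.surjective (φ.symm (f' p))
    rw [← add_sub_cancel (g q) p]
    refine Submodule.add_mem_sup ⟨q, rfl⟩ ?_
    rw [LinearMap.mem_ker, map_sub, hg', hq, φ.apply_symm_apply, sub_self]
  obtain ⟨s, hs⟩ := Module.projective_lifting_property g LinearMap.id hsurj
  have hs' : ∀ p, g (s p) = p := fun p => LinearMap.congr_fun hs p
  have hssurj : LinearMap.range s = ⊤ := by
    refine hf.superfluous _ (eq_top_iff.2 fun p _ => ?_)
    rw [← add_sub_cancel (s (g p)) p]
    refine Submodule.add_mem_sup ⟨_, rfl⟩ ?_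
    rw [LinearMap.mem_ker]
    refine φ.injective ?_
    rw [← hg', map_sub, hs', sub_self, map_zero, map_zero]
  have hinj : Function.Injective g := by
    intro p q hpq
    obtain ⟨p', rfl⟩ := LinearMap.range_eq_top.1 hssurj p
    obtain ⟨q', rfl⟩ := LinearMap.range_eq_top.1 hssurj q
    rw [hs', hs'] at hpq
    rw [hpq]
  let γ : P ≃ₗ[R] P' := LinearEquiv.ofBijective g ⟨hinj, hsurj⟩
  have hk : (LinearMap.ker f).map γ.toLinearMap = LinearMap.ker f' := by
    ext p
    constructor
    · rintro ⟨q, hq, rfl⟩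
      change f' (g q) = 0
      rw [hg', LinearMap.mem_ker.1 hq, map_zero]
    · intro hp
      obtain ⟨q, rfl⟩ := hsurj p
      refine ⟨q, φ.injective ?_, rfl⟩
      rw [← hg', map_zero]
      exact hp
  exact ⟨i.trans (((γ.submoduleMap _).trans (LinearEquiv.ofEq _ _ hk)).trans i'.symm)⟩

/-- The dual argument: essential images make both the extension g and its retraction s injective. -/
theorem IsCosyzygy.unique {M M' N N' : ModuleCat.{u} R} (h : IsCosyzygy M N)
    (h' : IsCosyzygy M' N') (e : Nonempty (M ≃ₗ[R] M')) : Nonempty (N ≃ₗ[R] N') := by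
  obtain ⟨φ⟩ := e
  obtain ⟨E, f, hf, ⟨i⟩⟩ := h
  obtain ⟨E', f', hf', ⟨i'⟩⟩ := h'
  obtain ⟨g, hg⟩ := hf'.injective_module.out f hf.injective (f' ∘ₗ φ.toLinearMap)
  replace hg : ∀ m, g (f m) = f' (φ m) := hg
  have hinj : Function.Injective g := by
    rw [← LinearMap.ker_eq_bot]
    refine hf.essential _ (eq_bot_iff.2 ?_)
    rintro _ ⟨h₁, m, rfl⟩
    have h₂ : f' (φ m) = 0 := (hg m).symm.trans h₁
    rw [(map_eq_zero_iff f' hf'.injective).1 h₂ |> (map_eq_zero_iff φ φ.injective).1, map_zero]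
    exact Submodule.zero_mem _
  obtain ⟨s, hs⟩ := hf.injective_module.out g hinj LinearMap.id
  replace hs : ∀ p, s (g p) = p := hs
  have hsinj : Function.Injective s := by
    rw [← LinearMap.ker_eq_bot]
    refine hf'.essential _ (eq_bot_iff.2 ?_)
    rintro _ ⟨h₁, m, rfl⟩
    obtain ⟨m, rfl⟩ := φ.surjective m
    rw [← hg] at h₁ ⊢
    have h₂ : f m = 0 := (hs _).symm.trans h₁
    rw [h₂, map_zero]
    exact Submodule.zero_mem _
  have hsurj : Function.Surjective g := fun p => ⟨s p, hsinj (hs _)⟩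
  let γ : E ≃ₗ[R] E' := LinearEquiv.ofBijective g ⟨hinj, hsurj⟩
  have hk : (LinearMap.range f).map γ.toLinearMap = LinearMap.range f' := by
    ext p
    constructor
    · rintro ⟨_, ⟨m, rfl⟩, rfl⟩
      exact ⟨φ m, (hg m).symm⟩
    · rintro ⟨m, rfl⟩
      refine ⟨f (φ.symm m), ⟨_, rfl⟩, ?_⟩
      change g (f _) = _
      rw [hg, φ.apply_symm_apply]
  exact ⟨i.trans ((Submodule.Quotient.equiv _ _ γ hk).trans i'.symm)⟩

theorem IsSyzygySequence.unique {M : ModuleCat.{u} R} {Ω Ω' : ℕ → ModuleCat.{u} R}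
    (h : IsSyzygySequence M Ω) (h' : IsSyzygySequence M Ω') (i : ℕ) :
    Nonempty (Ω i ≃ₗ[R] Ω' i) := by
  induction i with
  | zero =>
    obtain ⟨⟨e⟩, -⟩ := h
    obtain ⟨⟨e'⟩, -⟩ := h'
    exact ⟨e.trans e'.symm⟩
  | succ i ih => exact (h.2 i).unique (h'.2 i) ih

theorem IsCosyzygySequence.unique {M : ModuleCat.{u} R} {Ω Ω' : ℕ → ModuleCat.{u} R}
    (h : IsCosyzygySequence M Ω) (h' : IsCosyzygySequence M Ω') (i : ℕ) :
    Nonempty (Ω i ≃ₗ[R] Ω' i) := by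
  induction i with
  | zero =>
    obtain ⟨⟨e⟩, -⟩ := h
    obtain ⟨⟨e'⟩, -⟩ := h'
    exact ⟨e.trans e'.symm⟩
  | succ i ih => exact (h.2 i).unique (h'.2 i) ih

/-- A sequence of modules that is eventually governed by a self-map of a finite set is eventually
periodic. -/
theorem eventuallyPeriodic_of_finite {S : Type*} [Finite S] (T : S → S) (s : S)
    (G : S → ModuleCat.{u} R) {Ω : ℕ → ModuleCat.{u} R} {d : ℕ}
    (h : ∀ i, Nonempty (Ω (i + d) ≃ₗ[R] G (T^[i] s))) : EventuallyPeriodic Ω := by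
  -- Two iterates agree by the pigeonhole principle; their distance is a period.
  obtain ⟨a, b, hne, hab⟩ := Finite.exists_ne_map_eq_of_infinite fun i : ℕ => T^[i] s
  wlog hlt : a < b generalizing a b
  · exact this b a hne.symm hab.symm (by omega)
  have hper : ∀ i ≥ a, T^[i + (b - a)] s = T^[i] s := by
    intro i hi
    have h₁ : i + (b - a) = (i - a) + b := by omega
    have h₂ : i = (i - a) + a := by omega
    conv_rhs => rw [h₂]
    rw [h₁, Function.iterate_add_apply, Function.iterate_add_apply]
    exact congrArg _ hab.symm
  have hper' : ∀ l, ∀ i ≥ a, T^[l * (b - a) + i] s = T^[i] s := by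
    intro l
    induction l with
    | zero => simp
    | succ l ih =>
      intro i hi
      have h₁ : a ≤ l * (b - a) + i := hi.trans (Nat.le_add_left _ _)
      rw [show (l + 1) * (b - a) + i = l * (b - a) + i + (b - a) by rw [Nat.succ_mul]; ring,
        hper _ h₁, ih i hi]
  -- From index a + d on, shifting back by d lands in the periodic range; the extra 1 makes the
  -- bound positive.
  refine ⟨b - a, by omega, a + d + 1, by omega, fun i hi l => ?_⟩
  obtain ⟨e₁⟩ := h (l * (b - a) + (i - d))
  obtain ⟨e₂⟩ := h (i - d)
  rw [hper' l (i - d) (by omega)] at e₁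
  rw [show l * (b - a) + (i - d) + d = l * (b - a) + i by omega] at e₁
  rw [show i - d + d = i by omega] at e₂
  exact ⟨e₁.trans e₂.symm⟩

/-- A product of three modules as a product over `Fin 3`. -/
theorem exists_fin_equiv {R : Type u} [Ring R] (A B C : ModuleCat.{u} R) :
    ∃ L : Fin (2 + 1) → ModuleCat.{u} R, L 0 = A ∧ L 1 = B ∧ L 2 = C ∧
      Nonempty ((A × B × C) ≃ₗ[R] (∀ j, L j)) := by
  let L : Fin (2 + 1) → ModuleCat.{u} R := fun j => match j with
    | 0 => A
    | 1 => B
    | 2 => C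
  refine ⟨L, rfl, rfl, rfl, ⟨?_⟩⟩
  exact
    { toFun := fun t j => match j with
        | 0 => t.1
        | 1 => t.2.1
        | 2 => t.2.2
      invFun := fun t => (t 0, t 1, t 2)
      left_inv := fun t => rfl
      right_inv := fun t => funext fun j => by fin_cases j <;> rfl
      map_add' := fun s t => funext fun j => by fin_cases j <;> rfl
      map_smul' := fun r t => funext fun j => by fin_cases j <;> rfl }

end Uniqueness

/-! ### Duality -/

namespace KDual

variable {K R : Type u} [Field K] [Ring R] [Algebra K R]

section Basic

variable {M N : Type u} [AddCommGroup M] [Module K M] [Module R M] [IsScalarTower K R M]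
  [AddCommGroup N] [Module K N] [Module R N] [IsScalarTower K R N]

/-- An element of the dual as a linear form. -/
def form (φ : KDual K R M) : M →ₗ[K] K := φ

/-- A linear form as an element of the dual. -/
def ofForm (φ : M →ₗ[K] K) : KDual K R M := φ

@[ext] theorem ext {φ ψ : KDual K R M} (h : ∀ x, form φ x = form ψ x) : φ = ψ :=
  LinearMap.ext h

@[simp] theorem form_smul (r : Rᵐᵒᵖ) (φ : KDual K R M) (x : M) :
    form (r • φ) x = form φ (r.unop • x) := rfl

@[simp] theorem form_add (φ ψ : KDual K R M) (x : M) :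
    form (φ + ψ) x = form φ x + form ψ x := rfl

theorem form_smul_vector (c : K) (φ : KDual K R M) (x : M) :
    form φ ((algebraMap K R c) • x) = c * form φ x := by
  rw [algebraMap_smul, map_smul, smul_eq_mul]

/-- The dual of a homomorphism. -/
def map (f : M →ₗ[R] N) : KDual K R N →ₗ[Rᵐᵒᵖ] KDual K R M where
  toFun φ := ofForm ((form φ).comp (f.restrictScalars K))
  map_add' _ _ := rfl
  map_smul' r φ := by
    ext x
    exact congrArg (form φ) (map_smul f r.unop x).symm

@[simp] theorem form_map (f : M →ₗ[R] N) (φ : KDual K R N) (x : M) :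
    form (map (K := K) f φ) x = form φ (f x) := rfl

theorem map_injective {f : M →ₗ[R] N} (hf : Function.Surjective f) :
    Function.Injective (map (K := K) f) := by
  intro φ ψ h
  ext x
  obtain ⟨y, rfl⟩ := hf x
  rw [← form_map, h, form_map]

theorem map_surjective {f : M →ₗ[R] N} (hf : Function.Injective f) :
    Function.Surjective (map (K := K) f) :=
  LinearMap.dualMap_surjective_of_injective (f := f.restrictScalars K) hf

variable (K R M N) in
/-- The dual of a product. -/
def prodEquiv : KDual K R (M × N) ≃ₗ[Rᵐᵒᵖ] KDual K R M × KDual K R N :=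
  LinearEquiv.ofLinearMap ((map (LinearMap.inl R M N)).prod (map (LinearMap.inr R M N)))
    ((map (LinearMap.fst R M N)).coprod (map (LinearMap.snd R M N)))
    (by
      refine LinearMap.ext fun φ => ?_
      refine Prod.ext ?_ ?_ <;> ext x <;> simp)
    (by
      ext φ x
      simp [← map_add])

theorem subsingleton [Subsingleton M] : Subsingleton (KDual K R M) :=
  ⟨fun φ ψ => ext fun x => by rw [Subsingleton.elim x 0, map_zero, map_zero]⟩

/-- Taking common zeros reverses inclusions between submodules of the dual and submodules of M. In
finite dimension a subspace of the dual is recovered from its common zeros, so the chain condition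
passes over. -/
theorem isUniserial [FiniteDimensional K M] (h : IsUniserial R M) :
    IsUniserial Rᵐᵒᵖ (KDual K R M) := by
  let ann : Submodule Rᵐᵒᵖ (KDual K R M) → Submodule R M := fun X =>
    { carrier := {x | ∀ φ ∈ X, form φ x = 0}
      zero_mem' := fun φ _ => map_zero _
      add_mem' := fun {x y} hx hy φ hφ => by rw [map_add, hx φ hφ, hy φ hφ, add_zero]
      smul_mem' := fun r x hx φ hφ => hx (MulOpposite.op r • φ) (X.smul_mem _ hφ) }
  have key : ∀ X X', ann X ≤ ann X' → X' ≤ X := by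
    intro X X' hle φ hφ
    -- A submodule of the dual is a K-subspace, since scalars act through the algebra.
    let W : Submodule K (Module.Dual K M) :=
      { carrier := {ψ | ofForm ψ ∈ X}
        zero_mem' := X.zero_mem
        add_mem' := fun hx hy => X.add_mem hx hy
        smul_mem' := fun c ψ hψ => by
          have h₁ : MulOpposite.op (algebraMap K R c) • ofForm (R := R) ψ ∈ X :=
            X.smul_mem _ hψ
          have h₂ : MulOpposite.op (algebraMap K R c) • ofForm (R := R) ψ = ofForm (c • ψ) := by
            ext x
            rw [form_smul, MulOpposite.unop_op, form_smul_vector]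
            rfl
          rwa [h₂] at h₁ }
    have hW : form φ ∈ W.dualCoannihilator.dualAnnihilator := by
      rw [Submodule.mem_dualAnnihilator]
      intro x hx
      rw [Submodule.mem_dualCoannihilator] at hx
      exact hle (x := x) (fun ψ hψ => hx ψ hψ) φ hφ
    rw [Subspace.dualCoannihilator_dualAnnihilator_eq] at hW
    exact hW
  intro X X'
  rcases h (ann X) (ann X') with h | h
  · exact Or.inr (key _ _ h)
  · exact Or.inl (key _ _ h)

end Basic

/-! ### Duals of projective modules are injective. -/

section Injective

variable {P : Type u} [AddCommGroup P] [Module K P] [Module R P] [IsScalarTower K R P]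

/-- Homomorphisms X → D(P) correspond to homomorphisms P → D(X) by exchanging the arguments. Since f
is injective, D(f) is onto, so projectivity lifts the transpose of g to P → D(Y); transposing back
gives the extension. -/
theorem exists_extension (X Y : Type u) [AddCommGroup X] [Module K X] [Module Rᵐᵒᵖ X]
    [IsScalarTower K Rᵐᵒᵖ X] [AddCommGroup Y] [Module K Y] [Module Rᵐᵒᵖ Y]
    [IsScalarTower K Rᵐᵒᵖ Y] [Module.Projective R P] (f : X →ₗ[Rᵐᵒᵖ] Y)
    (hf : Function.Injective f) (g : X →ₗ[Rᵐᵒᵖ] KDual K R P) :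
    ∃ h : Y →ₗ[Rᵐᵒᵖ] KDual K R P, ∀ x, h (f x) = g x := by
  -- The dual of a right R-module is a module over the double opposite, hence a left R-module.
  let _ : Module R (KDual K Rᵐᵒᵖ X) := Module.compHom _ (RingEquiv.opOp R).toRingHom
  let _ : Module R (KDual K Rᵐᵒᵖ Y) := Module.compHom _ (RingEquiv.opOp R).toRingHom
  have hsX : ∀ (r : R) (φ : KDual K Rᵐᵒᵖ X) (x : X),
    form (r • φ) x = form φ (MulOpposite.op r • x) := fun _ _ _ => rfl
  have hsY : ∀ (r : R) (φ : KDual K Rᵐᵒᵖ Y) (x : Y),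
    form (r • φ) x = form φ (MulOpposite.op r • x) := fun _ _ _ => rfl
  let F : KDual K Rᵐᵒᵖ Y →ₗ[R] KDual K Rᵐᵒᵖ X :=
    { toFun := map f
      map_add' := fun _ _ => map_add _ _ _
      map_smul' := fun r φ => map_smul (map (K := K) f) (MulOpposite.op (MulOpposite.op r)) φ }
  have hgK : ∀ (c : K) (x : X), g (c • x) = MulOpposite.op (algebraMap K R c) • g x := fun c x => by
    rw [← map_smul]
    congr 1
    exact (algebraMap_smul Rᵐᵒᵖ c x).symm
  let G : P →ₗ[R] KDual K Rᵐᵒᵖ X :=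
    { toFun := fun p => ofForm
        { toFun := fun x => form (g x) p
          map_add' := fun x y => by rw [map_add, form_add]
          map_smul' := fun c x => by
            rw [hgK, form_smul, MulOpposite.unop_op, form_smul_vector]; rfl }
      map_add' := fun p q => ext fun x => map_add (form (g x)) p q
      map_smul' := fun r p => ext fun x => by
        rw [RingHom.id_apply, hsX]
        change form (g x) (r • p) = form (g (MulOpposite.op r • x)) p
        rw [map_smul g, form_smul, MulOpposite.unop_op] }
  obtain ⟨H, hH⟩ := Module.projective_lifting_property F G (map_surjective (K := K) hf)
  have hHK : ∀ (c : K) (p : P) (y : Y), form (H (c • p)) y = c * form (H p) y := fun c p y => by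
    rw [← algebraMap_smul R c p, map_smul, hsY]
    exact form_smul_vector c (H p) y
  refine ⟨{ toFun := fun y => ofForm
              { toFun := fun p => form (H p) y
                map_add' := fun p q => by rw [map_add, form_add]
                map_smul' := fun c p => hHK c p y }
            map_add' := fun y y' => ext fun p => map_add (form (H p)) y y'
            map_smul' := fun r y => ext fun p => by
              rw [RingHom.id_apply, form_smul]
              change form (H p) (r • y) = form (H (r.unop • p)) y
              rw [map_smul H, hsY, MulOpposite.op_unop] }, fun x => ext fun p => ?_⟩
  exact congrArg (fun φ => form φ x) (LinearMap.congr_fun hH p)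

/-- The dual of a projective left module is an injective right module. -/
theorem injective_of_projective [Module.Projective R P] :
    Module.Injective Rᵐᵒᵖ (KDual K R P) where
  out X Y _ _ _ _ f hf g := by
    let _ : Module K X := Module.compHom X (algebraMap K Rᵐᵒᵖ)
    let _ : Module K Y := Module.compHom Y (algebraMap K Rᵐᵒᵖ)
    have : IsScalarTower K Rᵐᵒᵖ X := ⟨fun c r x => by rw [Algebra.smul_def, mul_smul]; rfl⟩
    have : IsScalarTower K Rᵐᵒᵖ Y := ⟨fun c r x => by rw [Algebra.smul_def, mul_smul]; rfl⟩
    exact exists_extension X Y f hf g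

end Injective

end KDual

/-! ### From radical presentations to injective hulls. -/

namespace GentlePresentation

variable {K R V E : Type u} [Field K] [Ring R] [Algebra K R] {D : GentlePresentation K R V E}

/-- The dual of Nakayama's lemma: forms that vanish on rad P are the socle of D(P). If φ in X
vanishes on J^(k+1) P, then its translates by J^k lie in X and vanish on rad P, hence are zero; so φ
vanishes on J^k P, and finally on P. -/
theorem eq_bot_of_no_socle {P : Type u} [AddCommGroup P] [Module K P] [Module R P]
    [IsScalarTower K R P] {X : Submodule Rᵐᵒᵖ (KDual K R P)}
    (h : ∀ φ ∈ X, (∀ p ∈ D.rad P, φ.form p = 0) → φ = 0) : X = ⊥ := by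
  obtain ⟨m, hm⟩ := D.exists_radPow_eq_bot
  have key : ∀ k ≤ m, ∀ φ ∈ X, (∀ x ∈ D.radPow k, ∀ p, φ.form (x • p) = 0) → φ = 0 := by
    intro k
    induction k with
    | zero =>
      intro _ φ _ hφ
      ext p
      have := hφ 1 D.one_mem_radPow p
      rwa [one_smul] at this
    | succ k ih =>
      intro hk φ hφX hφ
      refine ih (by omega) φ hφX fun x hx p => ?_
      have h₁ : MulOpposite.op x • φ = 0 := by
        refine h _ (X.smul_mem _ hφX) fun q hq => ?_
        rw [KDual.form_smul, MulOpposite.unop_op]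
        clear p
        induction hq using Submodule.span_induction generalizing x with
        | mem q hq =>
          obtain ⟨α, p, rfl⟩ := hq
          rw [← mul_smul]
          exact hφ _ (D.mul_a_mem_radPow hx α) p
        | zero => rw [smul_zero, map_zero]
        | add q q' _ _ hq hq' => rw [smul_add, map_add, hq x hx, hq' x hx, add_zero]
        | smul r q _ hq =>
          rw [← mul_smul]
          exact hq _ (D.mul_mem_radPow hx r)
      exact congrArg (fun ψ => KDual.form ψ p) h₁
  refine eq_bot_iff.2 fun φ hφ => key m le_rfl φ hφ fun x hx p => ?_
  rw [hm, Submodule.mem_bot] at hx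
  rw [hx, zero_smul, map_zero]

/-- The dual sequence 0 → D(M) → D(P) → D(N) → 0 is exact. The image of D(M) consists of the forms
that vanish on the image of N; as that lies in rad P, it contains all forms that vanish on rad P and
is therefore essential. -/
theorem RadSyzygy.isCosyzygy {M N : Type u} [AddCommGroup M] [Module K M] [Module R M]
    [IsScalarTower K R M] [AddCommGroup N] [Module K N] [Module R N] [IsScalarTower K R N]
    (h : D.RadSyzygy M N) :
    IsCosyzygy (ModuleCat.of Rᵐᵒᵖ (KDual K R M)) (ModuleCat.of Rᵐᵒᵖ (KDual K R N)) := by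
  obtain ⟨P, _, _, f, g, hP, hf, hg, hfg, hr⟩ := h
  let _ : Module K P := Module.compHom P (algebraMap K R)
  have : IsScalarTower K R P := ⟨fun c r x => by rw [Algebra.smul_def, mul_smul]; rfl⟩
  have hker : LinearMap.range (KDual.map (K := K) f) = LinearMap.ker (KDual.map (K := K) g) := by
    ext φ
    have h₁ := SetLike.ext_iff.1
      (LinearMap.range_dualMap_eq_dualAnnihilator_ker (f.restrictScalars K)) φ.form
    have h₂ := SetLike.ext_iff.1
      (LinearMap.ker_dualMap_eq_dualAnnihilator_range (g.restrictScalars K)) φ.form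
    rw [LinearMap.ker_restrictScalars, hfg] at h₁
    rw [LinearMap.range_restrictScalars] at h₂
    exact h₁.trans h₂.symm
  refine ⟨ModuleCat.of Rᵐᵒᵖ (KDual K R P), KDual.map f,
    ⟨KDual.injective_of_projective, KDual.map_injective hf, fun X hX => ?_⟩, ⟨?_⟩⟩
  · refine D.eq_bot_of_no_socle fun φ hφ h => ?_
    have hφ' : φ ∈ X ⊓ LinearMap.range (KDual.map (K := K) f) := by
      refine ⟨hφ, ?_⟩
      rw [hker, SetLike.mem_coe, LinearMap.mem_ker]
      ext n
      exact h _ (hr ⟨n, rfl⟩)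
    rw [hX] at hφ'
    exact hφ'
  · exact ((Submodule.quotEquivOfEq _ _ hker).trans
      ((KDual.map (K := K) g).quotKerEquivOfSurjective (KDual.map_surjective hg))).symm

end GentlePresentation

namespace GentlePresentation

variable {K R V E : Type u} [Field K] [Ring R] [Algebra K R] {D : GentlePresentation K R V E}

/-! #### Syzygies and cosyzygies of string modules -/

theorem radSyzygy_nextZero_prod (x y : Option E) (Q : Type u) [AddCommGroup Q] [Module R Q]
    [Module.Projective R Q] : D.RadSyzygy (D.optSpan x × Q × D.optSpan y)
      (D.optSpan (D.nextZero x) × PUnit.{u + 1} × D.optSpan (D.nextZero y)) :=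
  (D.radSyzygy_nextZero x).prod (RadSyzygy.of_projective.prod (D.radSyzygy_nextZero y))

variable (D) in
/-- The first syzygy of `M` is the direct sum of two modules that are zero or generated by arrows,
and of a projective module. -/
def HasArrowSyzygy (M : Type u) [AddCommGroup M] [Module R M] : Prop :=
  ∃ (x y : Option E) (Q : Type u) (_ : AddCommGroup Q) (_ : Module R Q),
    Module.Projective R Q ∧ D.RadSyzygy M (D.optSpan x × Q × D.optSpan y)

/-- One explicit sequence is built from `nextZero`; by uniqueness every other sequence agrees with
it up to isomorphism. -/
theorem HasArrowSyzygy.syzygies [Finite E] {M : Type u} [AddCommGroup M] [Module R M]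
    (hM : D.HasArrowSyzygy M) :
    (∃ Ω, IsSyzygySequence (ModuleCat.of R M) Ω) ∧
      ∀ Ω, IsSyzygySequence (ModuleCat.of R M) Ω →
        (∃ (x y : Option E) (Q : ModuleCat.{u} R), Module.Projective R Q ∧
          Nonempty (Ω 1 ≃ₗ[R] D.optSpan x × Q × D.optSpan y)) ∧ EventuallyPeriodic Ω := by
  obtain ⟨x, y, Q, _, _, hQ, h⟩ := hM
  let G : Option E × Option E → ModuleCat.{u} R := fun s =>
    ModuleCat.of R (D.optSpan s.1 × PUnit.{u + 1} × D.optSpan s.2)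
  let T : Option E × Option E → Option E × Option E := Prod.map D.nextZero D.nextZero
  -- The projective summand of the first syzygy has zero syzygy, so from degree 2 on the pair of
  -- optional arrows describes the whole module.
  let Ω' : ℕ → ModuleCat.{u} R := fun i => match i with
    | 0 => ModuleCat.of R M
    | 1 => ModuleCat.of R (D.optSpan x × Q × D.optSpan y)
    | i + 2 => G (T^[i] (T (x, y)))
  have hΩ' : IsSyzygySequence (ModuleCat.of R M) Ω' := by
    refine ⟨⟨LinearEquiv.refl R M⟩, fun i => ?_⟩
    match i with
    | 0 => exact h.isSyzygy
    | 1 => exact (radSyzygy_nextZero_prod x y Q).isSyzygy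
    | i + 2 =>
      have h₁ : Ω' (i + 2 + 1) = G (T (T^[i] (T (x, y)))) := by
        rw [← Function.iterate_succ_apply' T i]
      rw [h₁]
      exact (radSyzygy_nextZero_prod _ _ PUnit.{u + 1}).isSyzygy
  refine ⟨⟨Ω', hΩ'⟩, fun Ω hΩ => ⟨⟨x, y, ModuleCat.of R Q, hQ, hΩ.unique hΩ' 1⟩, ?_⟩⟩
  exact eventuallyPeriodic_of_finite T (T (x, y)) G (d := 2) fun i => hΩ.unique hΩ' (i + 2)

theorem HasArrowSyzygy.cosyzygies [Finite E] {M : Type u} [AddCommGroup M] [Module K M]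
    [Module R M] [IsScalarTower K R M] (hM : D.HasArrowSyzygy M) :
    (∃ Ω, IsCosyzygySequence (ModuleCat.of Rᵐᵒᵖ (KDual K R M)) Ω) ∧
      ∀ Ω, IsCosyzygySequence (ModuleCat.of Rᵐᵒᵖ (KDual K R M)) Ω →
        (∃ (x y : Option E) (Q : ModuleCat.{u} Rᵐᵒᵖ), Module.Injective Rᵐᵒᵖ Q ∧
          Nonempty (Ω 1 ≃ₗ[Rᵐᵒᵖ] KDual K R (D.optSpan x) × Q × KDual K R (D.optSpan y))) ∧
        EventuallyPeriodic Ω := by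
  obtain ⟨x, y, Q, _, _, hQ, h⟩ := hM
  let _ : Module K Q := Module.compHom Q (algebraMap K R)
  have : IsScalarTower K R Q := ⟨fun c r x => by rw [Algebra.smul_def, mul_smul]; rfl⟩
  have : IsScalarTower K R PUnit.{u + 1} := ⟨fun c r x => rfl⟩
  let G : Option E × Option E → ModuleCat.{u} Rᵐᵒᵖ := fun s =>
    ModuleCat.of Rᵐᵒᵖ (KDual K R (D.optSpan s.1 × PUnit.{u + 1} × D.optSpan s.2))
  let T : Option E × Option E → Option E × Option E := Prod.map D.nextZero D.nextZero
  let Ω' : ℕ → ModuleCat.{u} Rᵐᵒᵖ := fun i => match i with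
    | 0 => ModuleCat.of Rᵐᵒᵖ (KDual K R M)
    | 1 => ModuleCat.of Rᵐᵒᵖ (KDual K R (D.optSpan x × Q × D.optSpan y))
    | i + 2 => G (T^[i] (T (x, y)))
  have hΩ' : IsCosyzygySequence (ModuleCat.of Rᵐᵒᵖ (KDual K R M)) Ω' := by
    refine ⟨⟨LinearEquiv.refl Rᵐᵒᵖ (KDual K R M)⟩, fun i => ?_⟩
    match i with
    | 0 => exact h.isCosyzygy
    | 1 =>
      have h₁ := (radSyzygy_nextZero_prod (D := D) x y Q).isCosyzygy
      exact h₁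
    | i + 2 =>
      have h₁ : Ω' (i + 2 + 1) = G (T (T^[i] (T (x, y)))) := by
        rw [← Function.iterate_succ_apply' T i]
      rw [h₁]
      have h₂ := (radSyzygy_nextZero_prod (D := D) (T^[i] (T (x, y))).1 (T^[i] (T (x, y))).2
        PUnit.{u + 1}).isCosyzygy
      exact h₂
  refine ⟨⟨Ω', hΩ'⟩, fun Ω hΩ => ⟨⟨x, y, ModuleCat.of Rᵐᵒᵖ (KDual K R Q),
    KDual.injective_of_projective, ?_⟩, ?_⟩⟩
  · obtain ⟨e⟩ := hΩ.unique hΩ' 1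
    exact ⟨e.trans ((KDual.prodEquiv K R _ _).trans
      ((LinearEquiv.refl _ _).prodCongr (KDual.prodEquiv K R _ _)))⟩
  · exact eventuallyPeriodic_of_finite T (T (x, y)) G (d := 2) fun i => hΩ.unique hΩ' (i + 2)

end GentlePresentation

/-! ### From a basis indexed by `Fin` to a string basis. -/

namespace GentlePresentation

variable {K R V E : Type u} [Field K] [Ring R] [Algebra K R] {D : GentlePresentation K R V E}
  {M : Type u} [AddCommGroup M] [Module K M] [Module R M] [IsScalarTower K R M]

/-- Without arrows R e_v is K e_v, so the module is projective. The case is separate because a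
string basis needs letters at all indices, even beyond the end. -/
theorem HasArrowSyzygy.of_isEmpty [IsEmpty E] {z : M} {v : V} (hv : D.e v • z = z) (hz : z ≠ 0)
    (hspan : Submodule.span K {z} = ⊤) : D.HasArrowSyzygy M := by
  let f : D.proj v →ₗ[R] M := LinearMap.toSpanSingleton R M z ∘ₗ (D.proj v).subtype
  have hf : Function.Bijective f := by
    constructor
    · rw [← LinearMap.ker_eq_bot, LinearMap.ker_eq_bot']
      rintro ⟨r, hr⟩ h
      obtain ⟨c, hc⟩ := D.exists_scalar r (D.e v) v (D.e_mul_self v) ⊥ fun α => isEmptyElim α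
      rw [D.mem_proj.1 hr, Submodule.mem_bot, sub_eq_zero] at hc
      change r • z = 0 at h
      rw [hc, smul_assoc, hv] at h
      refine Subtype.ext ?_
      change r = 0
      rw [hc, (smul_eq_zero.1 h).resolve_right hz, zero_smul]
    · intro x
      obtain ⟨c, rfl⟩ := Submodule.mem_span_singleton.1 (hspan ▸ Submodule.mem_top (x := x))
      refine ⟨⟨c • D.e v, D.mem_proj.2 (by rw [smul_mul_assoc, D.e_mul_self])⟩, ?_⟩
      change (c • D.e v) • z = c • z
      rw [smul_assoc, hv]
  have : Module.Projective R M := Module.Projective.of_equiv (LinearEquiv.ofBijective f hf)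
  have := D.subsingleton_optSpan_none
  exact ⟨none, none, PUnit.{u + 1}, inferInstance, inferInstance, inferInstance,
    RadSyzygy.of_projective⟩

/-- A module with a basis on which the arrows act along a walk with letters `w`. -/
theorem HasArrowSyzygy.of_letters {m : ℕ} (φ : M ≃ₗ[K] (Fin (m + 1) → K)) (w : Fin m → Bool × E)
    (hw : ∀ (α : E) (i j : Fin (m + 1)), φ (D.a α • φ.symm (Pi.single i 1)) j =
      open Classical in if ∃ k : Fin m, (w k = (true, α) ∧ i = k.castSucc ∧ j = k.succ) ∨
        (w k = (false, α) ∧ i = k.succ ∧ j = k.castSucc) then 1 else 0)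
    (hv : ∀ i, ∃ v, D.e v • φ.symm (Pi.single i 1) = φ.symm (Pi.single i 1))
    (hred : ∀ i j : Fin m, j.val = i.val + 1 → (w j).1 ≠ (w i).1 → (w j).2 ≠ (w i).2)
    (hdir : ∀ i j : Fin m, j.val = i.val + 1 → ∀ α β, w i = (true, α) → w j = (true, β) →
      D.a β * D.a α ≠ 0)
    (hinv : ∀ i j : Fin m, j.val = i.val + 1 → ∀ α β, w i = (false, α) → w j = (false, β) →
      D.a α * D.a β ≠ 0) : D.HasArrowSyzygy M := by
  classical
  let z : ℕ → M := fun i => if h : i < m + 1 then φ.symm (Pi.single ⟨i, h⟩ 1) else 0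
  have hz : ∀ i : Fin (m + 1), z i = φ.symm (Pi.single i 1) := fun i => dif_pos i.2
  have hspan : Submodule.span K (z '' Set.Icc 0 m) = ⊤ := by
    refine eq_top_iff.2 fun x _ => ?_
    rw [← φ.symm_apply_apply x, pi_eq_sum_univ' (φ x), map_sum]
    refine Submodule.sum_mem _ fun i _ => ?_
    rw [map_smul]
    refine Submodule.smul_mem _ _ (Submodule.subset_span ⟨i, ⟨Nat.zero_le _, by omega⟩, ?_⟩)
    rw [hz]
  have hne : ∀ i : Fin (m + 1), z i ≠ 0 := by
    intro i h
    rw [hz, LinearEquiv.map_eq_zero_iff] at h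
    simpa using congrFun h i
  rcases isEmpty_or_nonempty E with hE | hE
  · obtain rfl : m = 0 := by
      by_contra h
      exact hE.elim (w ⟨0, by omega⟩).2
    obtain ⟨v, hv⟩ := hv 0
    rw [← hz] at hv
    refine HasArrowSyzygy.of_isEmpty hv (hne 0) ?_
    rw [← hspan]
    congr 1
    simp
  -- The value beyond the last letter is arbitrary; the conditions of a string basis never look at
  -- it.
  · let w' : ℕ → Bool × E := fun i => if h : i < m then w ⟨i, h⟩ else (true, Classical.arbitrary E)
    have hw' : ∀ i : Fin m, w' i = w i := fun i => dif_pos i.2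
    have hw'' : ∀ i (h : i < m), w' i = w ⟨i, h⟩ := fun i h => dif_pos h
    have hsmul : ∀ (α : E) (i j : Fin (m + 1)), D.a α • z i = z j ↔ ∀ l : Fin (m + 1),
        (∃ k : Fin m, (w k = (true, α) ∧ i = k.castSucc ∧ l = k.succ) ∨
          (w k = (false, α) ∧ i = k.succ ∧ l = k.castSucc)) ↔ l = j := by
      intro α i j
      rw [← φ.injective.eq_iff, funext_iff, hz, hz, φ.apply_symm_apply]
      refine forall_congr' fun l => ?_
      rw [hw, Pi.single_apply]
      by_cases h₁ : ∃ k : Fin m, (w k = (true, α) ∧ i = k.castSucc ∧ l = k.succ) ∨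
        (w k = (false, α) ∧ i = k.succ ∧ l = k.castSucc)
      · by_cases h₂ : l = j
        · rw [if_pos h₁, if_pos h₂]; exact iff_of_true rfl (iff_of_true h₁ h₂)
        · rw [if_pos h₁, if_neg h₂]; exact iff_of_false one_ne_zero fun h => h₂ (h.1 h₁)
      · by_cases h₂ : l = j
        · rw [if_neg h₁, if_pos h₂]; exact iff_of_false zero_ne_one fun h => h₁ (h.2 h₂)
        · rw [if_neg h₁, if_neg h₂]; exact iff_of_true rfl (iff_of_false h₁ h₂)
    have hbasis : D.IsStringBasis m z w' := by
      refine ⟨hspan, ⟨fun k => if h : k < m + 1 then LinearMap.proj ⟨k, h⟩ ∘ₗ φ.toLinearMap else 0,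
        ?_⟩, ?_, ?_, ?_, ?_, ?_, ?_, ?_⟩
      · intro k hk l hl
        beta_reduce
        rw [dif_pos (show k < m + 1 by omega)]
        have := hz ⟨l, by omega⟩
        simp only at this
        rw [this]
        simp [Pi.single_apply]
      · intro i hi α hα
        rw [hw'' i hi] at hα
        refine (hsmul α ⟨i, by omega⟩ ⟨i + 1, by omega⟩).2 fun l => ⟨?_, ?_⟩
        · rintro ⟨k, ⟨h₁, h₂, rfl⟩ | ⟨h₁, h₂, rfl⟩⟩
          · rw [Fin.ext_iff] at h₂ ⊢
            simp only [Fin.val_castSucc, Fin.val_succ] at h₂ ⊢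
            omega
          · rw [Fin.ext_iff] at h₂
            -- A second image of z i under α would need α⁻¹ directly before α, which a reduced walk
            -- excludes.
            exact absurd (by rw [h₁, hα]) (hred k ⟨i, hi⟩ h₂ (by rw [h₁, hα]; simp))
        · rintro rfl
          exact ⟨⟨i, hi⟩, Or.inl ⟨hα, rfl, rfl⟩⟩
      · intro i hi α hα
        rw [hw'' i hi] at hα
        refine (hsmul α ⟨i + 1, by omega⟩ ⟨i, by omega⟩).2 fun l => ⟨?_, ?_⟩
        · rintro ⟨k, ⟨h₁, h₂, rfl⟩ | ⟨h₁, h₂, rfl⟩⟩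
          · rw [Fin.ext_iff] at h₂
            exact absurd (by rw [h₁, hα]) (hred ⟨i, hi⟩ k h₂.symm (by rw [h₁, hα]; simp))
          · rw [Fin.ext_iff] at h₂ ⊢
            simp only [Fin.val_castSucc, Fin.val_succ] at h₂ ⊢
            omega
        · rintro rfl
          exact ⟨⟨i, hi⟩, Or.inr ⟨hα, rfl, rfl⟩⟩
      · intro i hi α h₁ h₂
        refine φ.injective (funext fun j => ?_)
        have := hz ⟨i, by omega⟩
        simp only at this
        rw [this, hw, if_neg, map_zero, Pi.zero_apply]
        rintro ⟨k, ⟨h₃, h₄, -⟩ | ⟨h₃, h₄, -⟩⟩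
        · rw [Fin.ext_iff] at h₄
          simp only [Fin.val_castSucc] at h₄
          subst h₄
          exact h₁ k.2 (by rw [hw', h₃])
        · rw [Fin.ext_iff] at h₄
          simp only [Fin.val_succ] at h₄
          exact h₂ k h₄.symm (by rw [hw', h₃])
      · intro i hi
        obtain ⟨v, h⟩ := hv ⟨i, by omega⟩
        rw [← hz] at h
        exact ⟨v, h⟩
      · intro i hi
        rw [hw'' (i + 1) hi, hw'' i (by omega)]
        exact hred _ _ rfl
      · intro i hi α β
        rw [hw'' (i + 1) hi, hw'' i (by omega)]
        exact hdir _ _ rfl α β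
      · intro i hi α β
        rw [hw'' (i + 1) hi, hw'' i (by omega)]
        exact hinv _ _ rfl α β
    exact hbasis.exists_radSyzygy

end GentlePresentation

/-! ### A basis of a gentle algebra -/

section NormalForm

open PathAlgebra

variable {K V : Type u} [Field K] [Quiver.{u} V]

/-- The list of the arrows that a path runs through. -/
def word {a : V} : ∀ {b : V}, Quiver.Path a b → List (Arrow V)
  | _, Quiver.Path.nil => []
  | _, @Quiver.Path.cons _ _ _ b c p α => word p ++ [⟨b, c, α⟩]

theorem word_comp {a b c : V} (p : Quiver.Path a b) (q : Quiver.Path b c) :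
    word (p.comp q) = word p ++ word q := by
  induction q with
  | nil => simp [word]
  | cons q α ih => rw [Quiver.Path.comp_cons, word, word, ih, List.append_assoc]

theorem word_injective {a b c : V} (p : Quiver.Path a b) (q : Quiver.Path a c)
    (h : word p = word q) : (⟨a, b, p⟩ : QPath V) = ⟨a, c, q⟩ := by
  induction p generalizing c with
  | nil =>
    cases q with
    | nil => rfl
    | cons q β => simp [word] at h
  | cons p α ih =>
    cases q with
    | nil => simp [word] at h
    | cons q β =>
      simp only [word, List.append_singleton_inj] at h
      obtain ⟨h₁, h₂⟩ := h
      cases h₂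
      cases ih q h₁
      rfl

theorem ofPath_cons {a b c : V} (p : Quiver.Path a b) (α : b ⟶ c) :
    ofPath K ⟨a, c, p.cons α⟩ = ofPath K ⟨a, b, p⟩ * ofArrow K ⟨b, c, α⟩ := by
  rw [ofArrow, ofPath_mul, pathMul_comp]
  rfl

variable [Fintype V]

theorem ofPath_eq_prod {a b : V} (p : Quiver.Path a b) (h : word p ≠ []) :
    ofPath K ⟨a, b, p⟩ = ((word p).map (ofArrow K)).prod := by
  induction p with
  | nil => exact absurd rfl h
  | cons p α ih =>
    rw [word, List.map_append, List.prod_append, List.map_singleton, List.prod_singleton]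
    cases p with
    | nil => simp only [word, List.map_nil, List.prod_nil, one_mul]; rfl
    | cons p β => rw [ofPath_cons, ih (by simp [word])]

theorem prod_ofArrow (l : List (Arrow V)) (hl : l ≠ []) :
    (l.map (ofArrow K)).prod = 0 ∨
      ∃ p : QPath V, p.path.length = l.length ∧ (l.map (ofArrow K)).prod = ofPath K p := by
  induction l with
  | nil => exact absurd rfl hl
  | cons α l ih =>
    rw [List.map_cons, List.prod_cons]
    rcases eq_or_ne l [] with rfl | h
    · exact Or.inr ⟨⟨_, _, α.hom.toPath⟩, rfl, by simp [ofArrow]⟩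
    · obtain h' | ⟨⟨a, b, p⟩, hp, h'⟩ := ih h
      · left; rw [h', mul_zero]
      · rw [h', ofArrow, ofPath_mul]
        by_cases hs : a = α.tgt
        · subst hs
          refine Or.inr ⟨_, ?_, pathMul_comp _ _⟩
          simp only [Quiver.Path.length_comp, Quiver.Path.length_toPath, List.length_cons]
          simp only at hp
          omega
        · exact Or.inl (pathMul_of_ne (by simpa using hs))

variable (I : TwoSidedIdeal (PathAlgebra K V))

/-- A word is good if no product of two consecutive arrows lies in `I`. -/
def IsGoodWord (l : List (Arrow V)) : Prop :=
  l.IsChain fun α β => ofArrow K α * ofArrow K β ∉ I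

variable {I}

theorem IsGoodWord.append {l l' : List (Arrow V)} (h : IsGoodWord I (l ++ l')) :
    IsGoodWord I l ∧ IsGoodWord I l' :=
  ⟨(List.isChain_append.1 h).1, (List.isChain_append.1 h).2.1⟩

/-- A path whose word is not good contains two consecutive arrows with product in I. -/
theorem ofPath_mem {a b : V} (p : Quiver.Path a b) (h : ¬ IsGoodWord I (word p)) :
    ofPath K ⟨a, b, p⟩ ∈ I := by
  induction p with
  | nil => exact absurd List.isChain_nil h
  | cons p α ih =>
    by_cases hp : IsGoodWord I (word p)
    · cases p with
      | nil => exact absurd (List.isChain_singleton _) h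
      | cons p β =>
        rw [ofPath_cons, ofPath_cons, mul_assoc]
        refine I.mul_mem_left _ _ ?_
        by_contra h'
        refine h (List.isChain_append.2 ⟨hp, List.isChain_singleton _, ?_⟩)
        simpa [word] using h'
    · rw [ofPath_cons]
      exact I.mul_mem_right _ _ (ih hp)

variable (I)

open Classical in
/-- The coefficients of an element of the path algebra at the good paths. A path is encoded by its
source, its word and its target. -/
def goodCoeff : PathAlgebra K V →ₗ[K] (V × List (Arrow V) × V → K) :=
  lin fun p b => if b = (p.src, word p.path, p.tgt) ∧ IsGoodWord I b.2.1 then 1 else 0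

open Classical in
/-- The effect on the coefficients of the multiplication by a path from the left. -/
def leftShift (p : QPath V) :
    (V × List (Arrow V) × V → K) →ₗ[K] (V × List (Arrow V) × V → K) where
  toFun y b := if b.1 = p.src ∧ word p.path <+: b.2.1 ∧ IsGoodWord I b.2.1 then
    y (p.tgt, b.2.1.drop (word p.path).length, b.2.2) else 0
  map_add' y z := by ext b; simp only [Pi.add_apply]; split_ifs <;> simp
  map_smul' c y := by ext b; simp

open Classical in
/-- The effect on the coefficients of the multiplication by a path from the right. -/
def rightShift (p : QPath V) :
    (V × List (Arrow V) × V → K) →ₗ[K] (V × List (Arrow V) × V → K) where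
  toFun y b := if b.2.2 = p.tgt ∧ word p.path <:+ b.2.1 ∧ IsGoodWord I b.2.1 then
    y (b.1, b.2.1.take (b.2.1.length - (word p.path).length), p.src) else 0
  map_add' y z := by ext b; simp only [Pi.add_apply]; split_ifs <;> simp
  map_smul' c y := by ext b; simp

/-- The coefficient of p x at a good word is that of x at the word with the prefix p removed, which
is again good. So the good coefficients of p x depend only on those of x; with the version on the
right, the kernel of `goodCoeff` is an ideal. -/
theorem goodCoeff_ofPath_mul (p : QPath V) (x : PathAlgebra K V) :
    goodCoeff I (ofPath K p * x) = leftShift I p (goodCoeff I x) := by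
  refine LinearMap.congr_fun (f := (goodCoeff I).comp (LinearMap.mulLeft K (ofPath K p)))
    (g := (leftShift I p).comp (goodCoeff I)) (hom_ext fun q => ?_) x
  simp only [LinearMap.comp_apply, LinearMap.mulLeft_apply, ofPath_mul]
  obtain ⟨a, b, p⟩ := p
  obtain ⟨c, d, q⟩ := q
  by_cases h : c = b
  · subst h
    rw [pathMul_comp, goodCoeff, lin_ofPath, lin_ofPath]
    funext ⟨v, l, w⟩
    simp only [leftShift, LinearMap.coe_mk, AddHom.coe_mk, Prod.mk.injEq, word_comp, ← ite_and]
    congr 1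
    refine propext ⟨?_, ?_⟩
    · rintro ⟨⟨rfl, rfl, rfl⟩, h⟩
      rw [word_comp] at h ⊢
      simp [h, h.append]
    · rintro ⟨⟨rfl, ⟨l, rfl⟩, h⟩, h', -⟩
      simp only [Prod.mk.injEq, List.drop_left] at h'
      obtain ⟨-, h', rfl⟩ := h'
      subst h'
      simp [h, word_comp]
  · rw [pathMul_of_ne (by simpa using h), map_zero, goodCoeff, lin_ofPath]
    funext ⟨v, l, w⟩
    simp [leftShift, Ne.symm h]

theorem goodCoeff_mul_ofPath (x : PathAlgebra K V) (p : QPath V) :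
    goodCoeff I (x * ofPath K p) = rightShift I p (goodCoeff I x) := by
  refine LinearMap.congr_fun (f := (goodCoeff I).comp (LinearMap.mulRight K (ofPath K p)))
    (g := (rightShift I p).comp (goodCoeff I)) (hom_ext fun q => ?_) x
  simp only [LinearMap.comp_apply, LinearMap.mulRight_apply, ofPath_mul]
  obtain ⟨a, b, p⟩ := p
  obtain ⟨c, d, q⟩ := q
  by_cases h : a = d
  · subst h
    rw [pathMul_comp, goodCoeff, lin_ofPath, lin_ofPath]
    funext ⟨v, l, w⟩
    simp only [rightShift, LinearMap.coe_mk, AddHom.coe_mk, Prod.mk.injEq, word_comp, ← ite_and]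
    congr 1
    refine propext ⟨?_, ?_⟩
    · rintro ⟨⟨rfl, rfl, rfl⟩, h⟩
      rw [word_comp] at h ⊢
      simp [h, h.append]
    · rintro ⟨⟨rfl, ⟨l, rfl⟩, h⟩, h', -⟩
      simp only [Prod.mk.injEq, List.length_append, Nat.add_sub_cancel, List.take_left] at h'
      obtain ⟨rfl, h', -⟩ := h'
      subst h'
      simp [h, word_comp]
  · rw [pathMul_of_ne (by simpa using h), map_zero, goodCoeff, lin_ofPath]
    funext ⟨v, l, w⟩
    simp [rightShift, h]

theorem goodCoeff_apply (x : PathAlgebra K V) (p : QPath V) (hp : IsGoodWord I (word p.path)) :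
    goodCoeff I x (p.src, word p.path, p.tgt) = (show QPath V →₀ K from x) p := by
  refine LinearMap.congr_fun (f := (LinearMap.proj (p.src, word p.path, p.tgt)).comp (goodCoeff I))
    (g := Finsupp.lapply p) (hom_ext fun q => ?_) x
  have h : (p.src, word p.path, p.tgt) = (q.src, word q.path, q.tgt) ↔ q = p := by
    refine ⟨fun h => ?_, fun h => by rw [h]⟩
    obtain ⟨a, b, p⟩ := p
    obtain ⟨c, d, q⟩ := q
    simp only [Prod.mk.injEq] at h
    obtain ⟨rfl, h, rfl⟩ := h
    exact word_injective _ _ h.symm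
  classical
  simp only [LinearMap.comp_apply, goodCoeff, lin_ofPath, LinearMap.proj_apply, h, hp, and_true]
  refine Eq.trans ?_ (Finsupp.single_apply (a := q) (a' := p) (b := (1 : K))).symm
  congr

theorem goodCoeff_ofPath (p : QPath V) (hp : ¬ IsGoodWord I (word p.path)) :
    goodCoeff I (ofPath K p) = 0 := by
  rw [goodCoeff, lin_ofPath]
  funext b
  simp only [Pi.zero_apply, ite_eq_right_iff, one_ne_zero, imp_false, not_and]
  rintro rfl
  exact hp

variable {I}

/-- The good paths are a basis modulo I. An element without good coefficients is a combination of
paths that lie in I. Conversely, the kernel of `goodCoeff` is a two-sided ideal and contains the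
generators of I, since a path of length two in I is not good. -/
theorem goodCoeff_eq_zero_iff (hI : IsGentle I) (x : PathAlgebra K V) :
    goodCoeff I x = 0 ↔ x ∈ I := by
  constructor
  · intro h
    have hx : x = (show QPath V →₀ K from x).sum fun p c => c • ofPath K p := by
      refine (Finsupp.sum_single (show QPath V →₀ K from x)).symm.trans
        (Finsupp.sum_congr fun p _ => ?_)
      exact ((Finsupp.smul_single _ p (1 : K)).trans (by rw [smul_eq_mul, mul_one])).symm
    rw [hx]
    refine sum_mem fun p _ => ?_
    change (show QPath V →₀ K from x) p • ofPath K p ∈ I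
    by_cases hp : IsGoodWord I (word p.path)
    · rw [← goodCoeff_apply I x p hp, h, Pi.zero_apply, zero_smul]
      exact I.zero_mem
    · generalize (show QPath V →₀ K from x) p = c
      rw [← one_mul (ofPath K p), ← smul_mul_assoc]
      exact I.mul_mem_left _ _ (ofPath_mem p.path hp)
  · obtain ⟨S, hS, hIS⟩ := hI.generated
    let J : TwoSidedIdeal (PathAlgebra K V) := TwoSidedIdeal.mk' {x | goodCoeff I x = 0}
      (map_zero _) (fun {x y} hx hy => by
        rw [Set.mem_ofPred_eq] at *; rw [map_add, hx, hy, add_zero])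
      (fun {x} hx => by rw [Set.mem_ofPred_eq] at *; rw [map_neg, hx, neg_zero])
      (fun {x y} hy => by
        rw [Set.mem_ofPred_eq] at *
        refine induction_ofPath (P := fun x => goodCoeff I (x * y) = 0) x ?_ ?_ fun c p => ?_
        · rw [zero_mul, map_zero]
        · intro x z hx hz; rw [add_mul, map_add, hx, hz, add_zero]
        · rw [smul_mul_assoc, map_smul, goodCoeff_ofPath_mul, hy, map_zero, smul_zero])
      (fun {x y} hy => by
        rw [Set.mem_ofPred_eq] at *
        refine induction_ofPath (P := fun y => goodCoeff I (x * y) = 0) y ?_ ?_ fun c p => ?_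
        · rw [mul_zero, map_zero]
        · intro y z hx hz; rw [mul_add, map_add, hx, hz, add_zero]
        · rw [mul_smul_comm, map_smul, goodCoeff_mul_ofPath, hy, map_zero, smul_zero])
    have h : I ≤ J := by
      conv_lhs => rw [hIS]
      refine TwoSidedIdeal.span_le.2 ?_
      rintro _ ⟨p, hp, rfl⟩
      have hp' : ofPath K p ∈ I := hIS ▸ TwoSidedIdeal.subset_span ⟨p, hp, rfl⟩
      refine (TwoSidedIdeal.mem_mk' ..).2 (goodCoeff_ofPath I p fun hgood => ?_)
      have h := hS p hp
      obtain ⟨a, b, p⟩ := p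
      cases p with
      | nil => simp at h
      | cons p β =>
        cases p with
        | nil => simp at h
        | cons p α =>
          cases p with
          | nil =>
            refine List.isChain_pair.1 hgood ?_
            rw [ofPath_cons] at hp'
            exact hp'
          | cons p γ => simp at h
    intro hx
    exact (TwoSidedIdeal.mem_mk' (x := x) ..).1 (h hx)

end NormalForm

/-! ### Gentle algebras have gentle presentations -/

section Presentations

open PathAlgebra

variable {K V : Type u} [Field K] [Quiver.{u} V] [Fintype V]
variable {I : TwoSidedIdeal (PathAlgebra K V)}

theorem mk_eq_zero_iff (x : PathAlgebra K V) : I.ringCon.mk' x = 0 ↔ x ∈ I := by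
  rw [← map_zero I.ringCon.mk', TwoSidedIdeal.mem_iff]
  exact Quotient.eq''

theorem mk_eq_zero (hI : IsGentle I) (x : PathAlgebra K V) :
    I.ringCon.mk' x = 0 ↔ goodCoeff I x = 0 := by
  rw [mk_eq_zero_iff, goodCoeff_eq_zero_iff hI]

theorem goodCoeff_arrow_mul {α : Arrow V} {x : PathAlgebra K V} {b : V × List (Arrow V) × V}
    (h : goodCoeff I (ofArrow K α * x) b ≠ 0) :
    ∃ l w, b = (α.src, α :: l, w) ∧ IsGoodWord I (α :: l) := by
  rw [ofArrow, goodCoeff_ofPath_mul] at h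
  obtain ⟨v, l, w⟩ := b
  simp only [leftShift, LinearMap.coe_mk, AddHom.coe_mk, ne_eq, ite_eq_right_iff, not_forall] at h
  obtain ⟨⟨rfl, ⟨l, rfl⟩, h⟩, -⟩ := h
  exact ⟨l, w, rfl, h⟩

theorem goodCoeff_arrow_mul_apply {α : Arrow V} (x : PathAlgebra K V) {l : List (Arrow V)} (w : V)
    (h : IsGoodWord I (α :: l)) :
    goodCoeff I (ofArrow K α * x) (α.src, α :: l, w) = goodCoeff I x (α.tgt, l, w) := by
  rw [ofArrow, goodCoeff_ofPath_mul]
  exact if_pos ⟨rfl, ⟨l, rfl⟩, h⟩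

theorem goodCoeff_mul_arrow {α : Arrow V} {x : PathAlgebra K V} {b : V × List (Arrow V) × V}
    (h : goodCoeff I (x * ofArrow K α) b ≠ 0) :
    ∃ v l, b = (v, l ++ [α], α.tgt) ∧ IsGoodWord I (l ++ [α]) := by
  rw [ofArrow, goodCoeff_mul_ofPath] at h
  obtain ⟨v, l, w⟩ := b
  simp only [rightShift, LinearMap.coe_mk, AddHom.coe_mk, ne_eq, ite_eq_right_iff, not_forall] at h
  obtain ⟨⟨rfl, ⟨l, rfl⟩, h⟩, -⟩ := h
  exact ⟨v, l, rfl, h⟩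

theorem goodCoeff_mul_arrow_apply {α : Arrow V} (x : PathAlgebra K V) {l : List (Arrow V)} (v : V)
    (h : IsGoodWord I (l ++ [α])) :
    goodCoeff I (x * ofArrow K α) (v, l ++ [α], α.tgt) = goodCoeff I x (v, l, α.src) := by
  rw [ofArrow, goodCoeff_mul_ofPath]
  refine (if_pos ⟨rfl, ⟨l, rfl⟩, h⟩).trans ?_
  simp [word, Quiver.Hom.toPath]

theorem arrowClass_ne_zero (hI : IsGentle I) (α : Arrow V) : arrowClass I α ≠ 0 := by
  intro h
  rw [arrowClass, mk_eq_zero hI] at h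
  have h' := goodCoeff_apply I (ofArrow K α) ⟨α.src, α.tgt, α.hom.toPath⟩
    (List.isChain_singleton _)
  rw [h] at h'
  exact zero_ne_one (h'.trans (Finsupp.single_eq_same (M := K)))

/-- The good words that occur in α r start with α, those in β s start with β. -/
theorem arrowClass_mul_disjoint (hI : IsGentle I) {r s : QuotAlgebra I} {α β : Arrow V}
    (hαβ : α ≠ β) (h : arrowClass I α * r = arrowClass I β * s) : arrowClass I α * r = 0 := by
  obtain ⟨x, rfl⟩ := I.ringCon.mk'_surjective r
  obtain ⟨y, rfl⟩ := I.ringCon.mk'_surjective s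
  rw [← sub_eq_zero, arrowClass, arrowClass, ← map_mul, ← map_mul, ← map_sub, mk_eq_zero hI,
    map_sub, sub_eq_zero] at h
  rw [arrowClass, ← map_mul, mk_eq_zero hI]
  funext b
  by_contra hb
  obtain ⟨l, w, rfl, -⟩ := goodCoeff_arrow_mul hb
  rw [h] at hb
  obtain ⟨l', w', h', -⟩ := goodCoeff_arrow_mul hb
  simp only [Prod.mk.injEq, List.cons.injEq] at h'
  exact hαβ h'.2.1.1

theorem mul_arrowClass_disjoint (hI : IsGentle I) {r s : QuotAlgebra I} {α β : Arrow V}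
    (hαβ : α ≠ β) (h : r * arrowClass I α = s * arrowClass I β) : r * arrowClass I α = 0 := by
  obtain ⟨x, rfl⟩ := I.ringCon.mk'_surjective r
  obtain ⟨y, rfl⟩ := I.ringCon.mk'_surjective s
  rw [← sub_eq_zero, arrowClass, arrowClass, ← map_mul, ← map_mul, ← map_sub, mk_eq_zero hI,
    map_sub, sub_eq_zero] at h
  rw [arrowClass, ← map_mul, mk_eq_zero hI]
  funext b
  by_contra hb
  obtain ⟨l, w, rfl, -⟩ := goodCoeff_mul_arrow hb
  rw [h] at hb
  obtain ⟨l', w', h', -⟩ := goodCoeff_mul_arrow hb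
  simp only [Prod.mk.injEq] at h'
  exact hαβ (List.append_singleton_inj.1 h'.2.1).2

theorem arrowClass_mul_arrowClass_eq_zero (α β : Arrow V) :
    arrowClass I α * arrowClass I β = 0 ↔ ofArrow K α * ofArrow K β ∈ I := by
  rw [arrowClass, arrowClass, ← map_mul, mk_eq_zero_iff]

/-- A good word that starts with β stays good when α is put in front, as αβ is not in I; so no
coefficient of β r is lost. -/
theorem arrowClass_mul_cancel (hI : IsGentle I) {r : QuotAlgebra I} {α β : Arrow V}
    (hαβ : arrowClass I α * arrowClass I β ≠ 0)
    (h : arrowClass I α * (arrowClass I β * r) = 0) : arrowClass I β * r = 0 := by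
  obtain ⟨x, rfl⟩ := I.ringCon.mk'_surjective r
  rw [ne_eq, arrowClass_mul_arrowClass_eq_zero] at hαβ
  have hs : β.src = α.tgt := by
    by_contra hs
    refine hαβ ?_
    rw [ofArrow, ofArrow, ofPath_mul, pathMul_of_ne hs]
    exact I.zero_mem
  rw [arrowClass, arrowClass, ← map_mul, ← map_mul, mk_eq_zero hI] at h
  rw [arrowClass, ← map_mul, mk_eq_zero hI]
  funext b
  by_contra hb
  obtain ⟨l, w, rfl, hl⟩ := goodCoeff_arrow_mul hb
  refine hb ?_
  rw [hs, ← goodCoeff_arrow_mul_apply _ w (List.isChain_cons_cons.2 ⟨hαβ, hl⟩), h]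
  rfl

theorem mul_arrowClass_cancel (hI : IsGentle I) {r : QuotAlgebra I} {α β : Arrow V}
    (hαβ : arrowClass I β * arrowClass I α ≠ 0)
    (h : r * arrowClass I β * arrowClass I α = 0) : r * arrowClass I β = 0 := by
  obtain ⟨x, rfl⟩ := I.ringCon.mk'_surjective r
  rw [ne_eq, arrowClass_mul_arrowClass_eq_zero] at hαβ
  have hs : α.src = β.tgt := by
    by_contra hs
    refine hαβ ?_
    rw [ofArrow, ofArrow, ofPath_mul, pathMul_of_ne hs]
    exact I.zero_mem
  rw [arrowClass, arrowClass, ← map_mul, ← map_mul, mk_eq_zero hI] at h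
  rw [arrowClass, ← map_mul, mk_eq_zero hI]
  funext b
  by_contra hb
  obtain ⟨v, l, rfl, hl⟩ := goodCoeff_mul_arrow hb
  refine hb ?_
  rw [← hs, ← goodCoeff_mul_arrow_apply _ v (List.isChain_append.2
    ⟨hl, List.isChain_singleton α, by simpa using hαβ⟩), h]
  rfl

/-- Admissibility puts all paths of some length m into I, and a longer product has an initial factor
of length m. -/
theorem exists_prod_arrowClass_eq_zero (hI : IsGentle I) :
    ∃ N, ∀ l : List (Arrow V), N ≤ l.length → (l.map (arrowClass I)).prod = 0 := by
  obtain ⟨-, m, hm, hmI⟩ := hI.admissible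
  have key : ∀ l : List (Arrow V), l.length = m → (l.map (arrowClass I)).prod = 0 := by
    intro l hl
    have h : l.map (arrowClass I) = (l.map (ofArrow K)).map I.ringCon.mk' := by
      rw [List.map_map]; rfl
    rw [h, ← map_list_prod]
    obtain h' | ⟨p, hp, h'⟩ := prod_ofArrow (K := K) l (by rintro rfl; simp at hl; omega)
    · rw [h', map_zero]
    · rw [h', mk_eq_zero_iff]
      exact hmI (TwoSidedIdeal.subset_span ⟨p, hp.trans hl, rfl⟩)
  refine ⟨m, fun l hl => ?_⟩
  rw [← List.take_append_drop m l, List.map_append, List.prod_append,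
    key _ (by simpa using hl), zero_mul]

variable (I) in
/-- The class of a trivial path in `KQ/I`. -/
def vertexClass (v : V) : QuotAlgebra I :=
  I.ringCon.mk' (ofPath K ⟨v, v, Quiver.Path.nil⟩)

theorem mem_span_paths (r : QuotAlgebra I) :
    r ∈ Submodule.span K (Set.range (vertexClass I) ∪
      {x | ∃ l : List (Arrow V), l ≠ [] ∧ x = (l.map (arrowClass I)).prod}) := by
  obtain ⟨x, rfl⟩ := I.ringCon.mk'_surjective r
  refine induction_ofPath (P := fun x => I.ringCon.mk' x ∈ Submodule.span K
    (Set.range (vertexClass I) ∪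
      {x | ∃ l : List (Arrow V), l ≠ [] ∧ x = (l.map (arrowClass I)).prod})) x ?_ ?_ ?_
  · rw [map_zero]; exact zero_mem _
  · intro x y hx hy; rw [map_add]; exact add_mem hx hy
  · intro c p
    have hc : I.ringCon.mk' (c • ofPath K p) = c • I.ringCon.mk' (ofPath K p) := rfl
    rw [hc]
    refine Submodule.smul_mem _ c (Submodule.subset_span ?_)
    obtain ⟨a, b, p⟩ := p
    rcases eq_or_ne (word p) [] with h | h
    · left
      cases p with
      | nil => exact ⟨a, rfl⟩
      | cons p α => simp [word] at h
    · right
      refine ⟨word p, h, ?_⟩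
      rw [ofPath_eq_prod p h, map_list_prod, List.map_map]
      rfl

theorem vertexClass_mul_self (v : V) : vertexClass I v * vertexClass I v = vertexClass I v := by
  rw [vertexClass, ← map_mul, ofPath_mul, pathMul_comp]
  rfl

theorem vertexClass_mul_of_ne {v w : V} (h : v ≠ w) : vertexClass I v * vertexClass I w = 0 := by
  rw [vertexClass, vertexClass, ← map_mul, ofPath_mul, pathMul_of_ne h.symm, map_zero]

theorem vertexClass_mul_arrowClass (α : Arrow V) :
    vertexClass I α.src * arrowClass I α = arrowClass I α := by
  rw [vertexClass, arrowClass, ← map_mul, ofArrow, ofPath_mul, pathMul_comp, Quiver.Path.nil_comp]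

theorem arrowClass_mul_vertexClass (α : Arrow V) :
    arrowClass I α * vertexClass I α.tgt = arrowClass I α := by
  rw [vertexClass, arrowClass, ← map_mul, ofArrow, ofPath_mul, pathMul_comp, Quiver.Path.comp_nil]

theorem eq_or_eq_of_encard_le_two {X : Type*} {s : Set X} (hs : s.encard ≤ 2) {x y z : X}
    (hx : x ∈ s) (hy : y ∈ s) (hz : z ∈ s) : x = y ∨ y = z ∨ x = z := by
  by_contra! h
  have h3 : ({x, y, z} : Set X).encard = 3 :=
    Set.encard_eq_three.2 ⟨x, y, z, h.1, h.2.2, h.2.1, rfl⟩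
  have := (Set.encard_le_encard (s := {x, y, z}) (t := s) (by
    rintro _ (rfl | rfl | rfl) <;> assumption)).trans hs
  rw [h3] at this
  exact absurd this (by decide)

theorem IsGentle.finite_arrow (hI : IsGentle I) : Finite (Arrow V) := by
  have h : (⋃ v : V, {α : Arrow V | α.src = v}) = Set.univ := by ext α; simp
  rw [← Set.finite_univ_iff, ← h]
  exact Set.finite_iUnion fun v =>
    Set.finite_of_encard_le_coe (k := 2) (by exact_mod_cast hI.starting_le_two v)

/-- The presentation of the opposite of a gentle algebra, for right modules. -/
def rightPresentation (hI : IsGentle I) :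
    GentlePresentation K (QuotAlgebra I)ᵐᵒᵖ V (Arrow V) where
  e v := MulOpposite.op (vertexClass I v)
  a α := MulOpposite.op (arrowClass I α)
  src := Arrow.src
  tgt := Arrow.tgt
  e_mul_self v := by rw [← MulOpposite.op_mul, vertexClass_mul_self]
  e_mul_of_ne v w h := by
    rw [← MulOpposite.op_mul, vertexClass_mul_of_ne h.symm, MulOpposite.op_zero]
  a_mul_e α := by rw [← MulOpposite.op_mul, vertexClass_mul_arrowClass]
  e_mul_a α := by rw [← MulOpposite.op_mul, arrowClass_mul_vertexClass]
  a_ne_zero α := by simpa using arrowClass_ne_zero hI α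
  generates r := by
    have h := Submodule.mem_map_of_mem
      (f := (MulOpposite.opLinearEquiv K : QuotAlgebra I ≃ₗ[K] _).toLinearMap)
      (mem_span_paths r.unop)
    rw [Submodule.map_span] at h
    refine Submodule.span_mono ?_ h
    rintro _ ⟨_, ⟨v, rfl⟩ | ⟨l, hl, rfl⟩, rfl⟩
    · exact Or.inl ⟨v, rfl⟩
    -- Passing to the opposite algebra reverses the order of a product.
    · refine Or.inr ⟨l.reverse, by simpa using hl, ?_⟩
      rw [List.map_reverse]
      refine (MulOpposite.op_list_prod _).trans ?_
      rw [List.map_map]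
      rfl
  nilpotent := by
    obtain ⟨N, hN⟩ := exists_prod_arrowClass_eq_zero hI
    refine ⟨N, fun l hl => ?_⟩
    have h := congrArg MulOpposite.op (hN l.reverse (by simpa using hl))
    rw [MulOpposite.op_list_prod, List.map_map, ← List.map_reverse, List.reverse_reverse] at h
    exact h
  disjoint r s α β hαβ h := MulOpposite.unop_injective
    (arrowClass_mul_disjoint hI hαβ (congrArg MulOpposite.unop h))
  cancel r α β hαβ h := MulOpposite.unop_injective
    (arrowClass_mul_cancel hI (fun h' => hαβ (MulOpposite.unop_injective h'))
      (congrArg MulOpposite.unop h))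
  starting_le_two _ β _ h₁ h₂ :=
    eq_or_eq_of_encard_le_two (hI.starting_le_two β.src) h₁ rfl h₂.symm
  next_unique α _ _ h h' := hI.next_not_mem α
    (fun h'' => h (MulOpposite.unop_injective ((arrowClass_mul_arrowClass_eq_zero _ _).2 h'')))
    (fun h'' => h' (MulOpposite.unop_injective ((arrowClass_mul_arrowClass_eq_zero _ _).2 h'')))
  prev_unique α _ _ h h' := hI.prev_not_mem α
    (fun h'' => h (MulOpposite.unop_injective ((arrowClass_mul_arrowClass_eq_zero _ _).2 h'')))
    (fun h'' => h' (MulOpposite.unop_injective ((arrowClass_mul_arrowClass_eq_zero _ _).2 h'')))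
  next_zero_unique α _ _ h h' h₁ h₂ := hI.next_mem α
    ⟨h.symm, (arrowClass_mul_arrowClass_eq_zero _ _).1 (congrArg MulOpposite.unop h₁)⟩
    ⟨h'.symm, (arrowClass_mul_arrowClass_eq_zero _ _).1 (congrArg MulOpposite.unop h₂)⟩
  prev_zero_unique α _ _ h h' h₁ h₂ := hI.prev_mem α
    ⟨h.symm, (arrowClass_mul_arrowClass_eq_zero _ _).1 (congrArg MulOpposite.unop h₁)⟩
    ⟨h'.symm, (arrowClass_mul_arrowClass_eq_zero _ _).1 (congrArg MulOpposite.unop h₂)⟩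

/-- The presentation of a gentle algebra, for left modules. -/
def leftPresentation (hI : IsGentle I) : GentlePresentation K (QuotAlgebra I) V (Arrow V) where
  e := vertexClass I
  a := arrowClass I
  -- In Λ a product reads its left factor first, whereas a presentation reads the right factor
  -- first; so all arrows are turned around.
  src := Arrow.tgt
  tgt := Arrow.src
  e_mul_self := vertexClass_mul_self
  e_mul_of_ne _ _ := vertexClass_mul_of_ne
  a_mul_e := arrowClass_mul_vertexClass
  e_mul_a := vertexClass_mul_arrowClass
  a_ne_zero := arrowClass_ne_zero hI
  generates := mem_span_paths
  nilpotent := exists_prod_arrowClass_eq_zero hI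
  disjoint _ _ _ _ := mul_arrowClass_disjoint hI
  cancel _ _ _ := mul_arrowClass_cancel hI
  starting_le_two _ β _ h₁ h₂ :=
    eq_or_eq_of_encard_le_two (hI.ending_le_two β.tgt) h₁ rfl h₂.symm
  next_unique α _ _ h h' := hI.prev_not_mem α
    (fun h'' => h ((arrowClass_mul_arrowClass_eq_zero _ _).2 h''))
    (fun h'' => h' ((arrowClass_mul_arrowClass_eq_zero _ _).2 h''))
  prev_unique α _ _ h h' := hI.next_not_mem α
    (fun h'' => h ((arrowClass_mul_arrowClass_eq_zero _ _).2 h''))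
    (fun h'' => h' ((arrowClass_mul_arrowClass_eq_zero _ _).2 h''))
  next_zero_unique α _ _ h h' h₁ h₂ := hI.prev_mem α
    ⟨h, (arrowClass_mul_arrowClass_eq_zero _ _).1 h₁⟩
    ⟨h', (arrowClass_mul_arrowClass_eq_zero _ _).1 h₂⟩
  prev_zero_unique α _ _ h h' h₁ h₂ := hI.next_mem α
    ⟨h, (arrowClass_mul_arrowClass_eq_zero _ _).1 h₁⟩
    ⟨h', (arrowClass_mul_arrowClass_eq_zero _ _).1 h₂⟩

end Presentations

/-! ### String modules -/

namespace Letter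

variable {V : Type u} [Quiver.{u} V]

/-- The arrow of a letter, together with `true` if the letter is an arrow. -/
def code : Letter V → Bool × Arrow V
  | direct α => (true, α)
  | inverse α => (false, α)

/-- The arrow of a letter, together with `false` if the letter is an arrow. -/
def dualCode : Letter V → Bool × Arrow V
  | direct α => (false, α)
  | inverse α => (true, α)

theorem code_eq_true {x : Letter V} {α : Arrow V} : x.code = (true, α) ↔ x = direct α := by
  cases x <;> simp [code]

theorem code_eq_false {x : Letter V} {α : Arrow V} :
    x.code = (false, α) ↔ x = inverse α := by
  cases x <;> simp [code]

theorem dualCode_eq_false {x : Letter V} {α : Arrow V} :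
    x.dualCode = (false, α) ↔ x = direct α := by
  cases x <;> simp [dualCode]

theorem dualCode_eq_true {x : Letter V} {α : Arrow V} :
    x.dualCode = (true, α) ↔ x = inverse α := by
  cases x <;> simp [dualCode]

end Letter

section StringModules

open PathAlgebra

variable {K V : Type u} [Field K] [Quiver.{u} V] [Fintype V]
variable {I : TwoSidedIdeal (PathAlgebra K V)} (hI : IsGentle I) (w : QString I)

theorem QString.rep_arrowClass (α : Arrow V) : w.rep hI (arrowClass I α) = w.arrowMat α := by
  refine (RingCon.liftₐ_mk ..).trans ?_
  rw [ofArrow, w.repPathAlgebra_ofPath]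
  change w.vertexMat α.src * w.arrowMat α = _
  exact w.vertexMat_mul_arrowMat α

theorem QString.rep_vertexClass (v : V) : w.rep hI (vertexClass I v) = w.vertexMat v := by
  refine (RingCon.liftₐ_mk ..).trans ?_
  rw [w.repPathAlgebra_ofPath]
  rfl

instance : Module K (StringModule hI w) :=
  inferInstanceAs (Module K (Fin (w.length + 1) → K))

instance : IsScalarTower K (QuotAlgebra I)ᵐᵒᵖ (StringModule hI w) where
  smul_assoc c a x := by
    change Matrix.vecMul _ (w.rep hI (c • a.unop)) = c • Matrix.vecMul _ (w.rep hI a.unop)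
    rw [map_smul, Matrix.vecMul_smul]

/-- The left module of column vectors on which `KQ/I` acts by the matrices of a string. -/
def StringColumns {I : TwoSidedIdeal (PathAlgebra K V)} (_hI : IsGentle I) (w : QString I) :
    Type u := Fin (w.length + 1) → K

instance : AddCommGroup (StringColumns hI w) :=
  inferInstanceAs (AddCommGroup (Fin (w.length + 1) → K))

instance : Module K (StringColumns hI w) :=
  inferInstanceAs (Module K (Fin (w.length + 1) → K))

instance : Module (QuotAlgebra I) (StringColumns hI w) where
  smul a x := Matrix.mulVec (w.rep hI a) (show Fin (w.length + 1) → K from x)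
  one_smul x := by
    change Matrix.mulVec (w.rep hI 1) _ = _
    rw [map_one, Matrix.one_mulVec]
  mul_smul a b x := by
    change Matrix.mulVec (w.rep hI (a * b)) _ =
      Matrix.mulVec (w.rep hI a) (Matrix.mulVec (w.rep hI b) _)
    rw [map_mul, Matrix.mulVec_mulVec]
  smul_zero _ := Matrix.mulVec_zero _
  smul_add _ _ _ := Matrix.mulVec_add _ _ _
  add_smul a b x := by
    change Matrix.mulVec (w.rep hI (a + b)) _ =
      Matrix.mulVec (w.rep hI a) _ + Matrix.mulVec (w.rep hI b) _
    rw [map_add, Matrix.add_mulVec]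
  zero_smul x := by
    change Matrix.mulVec (w.rep hI 0) _ = 0
    rw [map_zero, Matrix.zero_mulVec]

instance : IsScalarTower K (QuotAlgebra I) (StringColumns hI w) where
  smul_assoc c a x := by
    change Matrix.mulVec (w.rep hI (c • a)) _ = c • Matrix.mulVec (w.rep hI a) _
    rw [map_smul, Matrix.smul_mulVec]

/-- A string module is the dual of the corresponding left module of column vectors. -/
def stringModuleEquiv :
    StringModule hI w ≃ₗ[(QuotAlgebra I)ᵐᵒᵖ] KDual K (QuotAlgebra I) (StringColumns hI w) :=
  { (dotProductEquiv K (Fin (w.length + 1))).toAddEquiv with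
    map_smul' := fun a y => LinearMap.ext fun x =>
      (Matrix.dotProduct_mulVec (show Fin (w.length + 1) → K from y) (w.rep hI a.unop)
        (show Fin (w.length + 1) → K from x)).symm }

/-- On row vectors an arrow acts in the direction of its letter, so the direction is kept. -/
theorem hasArrowSyzygy_stringModule :
    (rightPresentation hI).HasArrowSyzygy (StringModule hI w) := by
  let φ : StringModule hI w ≃ₗ[K] (Fin (w.length + 1) → K) := LinearEquiv.refl K _
  refine GentlePresentation.HasArrowSyzygy.of_letters φ (fun k => (w.letter k).code) ?_ ?_ ?_ ?_ ?_
  · intro α i j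
    change Matrix.vecMul (Pi.single i 1) (w.rep hI (arrowClass I α)) j = _
    rw [w.rep_arrowClass, Matrix.single_one_vecMul]
    classical
    change (if w.Step α i j then 1 else 0) = _
    exact if_congr (exists_congr fun k => or_congr
      (and_congr_left' Letter.code_eq_true.symm) (and_congr_left' Letter.code_eq_false.symm)) rfl rfl
  · intro i
    refine ⟨w.vertex i, ?_⟩
    change Matrix.vecMul (Pi.single i 1) (w.rep hI (vertexClass I (w.vertex i))) = _
    rw [w.rep_vertexClass, Matrix.single_one_vecMul]
    funext j
    change w.vertexMat (w.vertex i) i j = (Pi.single i (1 : K) : Fin (w.length + 1) → K) j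
    rcases eq_or_ne i j with rfl | h
    · simp [QString.vertexMat]
    · simp [QString.vertexMat, h, h.symm]
  · intro i j hij h₁ h₂
    refine w.reduced i j hij ?_
    revert h₁ h₂
    cases w.letter i <;> cases w.letter j <;> simp +contextual [Letter.code, Letter.inv]
  · intro i j hij α β h₁ h₂ h
    rw [Letter.code_eq_true] at h₁ h₂
    exact w.direct_not_mem i j hij α β h₁ h₂
      ((arrowClass_mul_arrowClass_eq_zero _ _).1 (congrArg MulOpposite.unop h))
  · intro i j hij α β h₁ h₂ h
    rw [Letter.code_eq_false] at h₁ h₂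
    exact w.inverse_not_mem i j hij α β h₁ h₂
      ((arrowClass_mul_arrowClass_eq_zero _ _).1 (congrArg MulOpposite.unop h))

/-- On column vectors the same matrices act by their transposes, so every arrow moves basis vectors
the other way along the string; hence `dualCode`. -/
theorem hasArrowSyzygy_stringColumns :
    (leftPresentation hI).HasArrowSyzygy (StringColumns hI w) := by
  let φ : StringColumns hI w ≃ₗ[K] (Fin (w.length + 1) → K) := LinearEquiv.refl K _
  refine GentlePresentation.HasArrowSyzygy.of_letters φ (fun k => (w.letter k).dualCode)
    ?_ ?_ ?_ ?_ ?_
  · intro α i j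
    change Matrix.mulVec (w.rep hI (arrowClass I α)) (Pi.single i 1) j = _
    rw [w.rep_arrowClass, Matrix.mulVec_single_one]
    classical
    change (if w.Step α j i then 1 else 0) = _
    refine if_congr (exists_congr fun k => or_comm.trans (or_congr ?_ ?_)) rfl rfl
    · rw [Letter.dualCode_eq_true]; tauto
    · rw [Letter.dualCode_eq_false]; tauto
  · intro i
    refine ⟨w.vertex i, ?_⟩
    change Matrix.mulVec (w.rep hI (vertexClass I (w.vertex i))) (Pi.single i 1) = _
    rw [w.rep_vertexClass, Matrix.mulVec_single_one]
    funext j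
    change w.vertexMat (w.vertex i) j i = (Pi.single i (1 : K) : Fin (w.length + 1) → K) j
    rcases eq_or_ne i j with rfl | h
    · simp [QString.vertexMat]
    · simp [QString.vertexMat, h.symm]
  · intro i j hij h₁ h₂
    refine w.reduced i j hij ?_
    revert h₁ h₂
    cases w.letter i <;> cases w.letter j <;> simp +contextual [Letter.dualCode, Letter.inv]
  · intro i j hij α β h₁ h₂ h
    rw [Letter.dualCode_eq_true] at h₁ h₂
    exact w.inverse_not_mem i j hij α β h₁ h₂ ((arrowClass_mul_arrowClass_eq_zero _ _).1 h)
  · intro i j hij α β h₁ h₂ h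
    rw [Letter.dualCode_eq_false] at h₁ h₂
    exact w.direct_not_mem i j hij α β h₁ h₂ ((arrowClass_mul_arrowClass_eq_zero _ _).1 h)

/-- The right module `αΛ` inside the opposite algebra and inside the algebra. -/
def optSpanEquivArrowR (α : Arrow V) :
    (rightPresentation hI).optSpan (some α) ≃ₗ[(QuotAlgebra I)ᵐᵒᵖ] arrowR I α :=
  let e : (QuotAlgebra I)ᵐᵒᵖ ≃ₗ[(QuotAlgebra I)ᵐᵒᵖ] QuotAlgebra I :=
    { MulOpposite.opAddEquiv.symm with map_smul' := fun _ _ => rfl }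
  e.ofSubmodules _ _ (by
    rw [GentlePresentation.optSpan, Submodule.map_span, Set.image_singleton]
    rfl)

end StringModules

/-! ### Assembly of the statements on syzygies and cosyzygies. -/

theorem IsSyzygySequence.congr {R : Type u} [Ring R] {M N : ModuleCat.{u} R}
    {Ω : ℕ → ModuleCat.{u} R} (e : M ≃ₗ[R] N) (h : IsSyzygySequence M Ω) :
    IsSyzygySequence N Ω :=
  ⟨h.1.map fun f => f.trans e, h.2⟩

theorem IsCosyzygySequence.congr {R : Type u} [Ring R] {M N : ModuleCat.{u} R}
    {Ω : ℕ → ModuleCat.{u} R} (e : M ≃ₗ[R] N) (h : IsCosyzygySequence M Ω) :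
    IsCosyzygySequence N Ω :=
  ⟨h.1.map fun f => f.trans e, h.2⟩

/-- A direct sum of three modules as a family: the first and the last member satisfy `P`, the middle
one satisfies `Q`. -/
theorem exists_fin_family {R : Type u} [Ring R] {M A B C : ModuleCat.{u} R}
    (e : M ≃ₗ[R] A × B × C) {P Q : ModuleCat.{u} R → Prop} (hA : P A) (hB : Q B) (hC : P C) :
    ∃ (k : ℕ) (L : Fin (k + 1) → ModuleCat.{u} R), Nonempty (M ≃ₗ[R] (∀ j, L j)) ∧
      (∀ j, j ≠ 0 → j ≠ Fin.last k → Q (L j)) ∧ ∀ j, j = 0 ∨ j = Fin.last k → P (L j) := by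
  obtain ⟨L, h₀, h₁, h₂, ⟨f⟩⟩ := exists_fin_equiv A B C
  refine ⟨2, L, ⟨e.trans f⟩, fun j hj hj' => ?_, ?_⟩
  · obtain rfl : j = 1 := by
      fin_cases j
      · exact absurd rfl hj
      · rfl
      · exact absurd rfl hj'
    rwa [h₁]
  · rintro j (rfl | rfl)
    · rwa [h₀]
    · rw [← h₂] at hC
      exact hC

end GentleAlgebra

end

theorem mainTheorem3 {K : Type u} [Field K] [IsAlgClosed K] {V : Type u} [Quiver.{u} V] [Fintype V]
    (I : TwoSidedIdeal (PathAlgebra K V)) (hI : IsGentle I)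
    (M : ModuleCat.{u} (QuotAlgebra I)ᵐᵒᵖ) (hM : IsStringModule hI M) :
    ((∃ Ω, IsSyzygySequence M Ω) ∧
      ∀ Ω, IsSyzygySequence M Ω →
        (∃ (k : ℕ) (L : Fin (k + 1) → ModuleCat.{u} (QuotAlgebra I)ᵐᵒᵖ),
          Nonempty (Ω 1 ≃ₗ[(QuotAlgebra I)ᵐᵒᵖ] (∀ j, L j)) ∧
          (∀ j, j ≠ 0 → j ≠ Fin.last k → Module.Projective (QuotAlgebra I)ᵐᵒᵖ (L j)) ∧
          ∀ j, j = 0 ∨ j = Fin.last k →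
            Subsingleton (L j) ∨
            (IsUniserial (QuotAlgebra I)ᵐᵒᵖ (L j) ∧
              ∃ α : Arrow V, Nonempty (L j ≃ₗ[(QuotAlgebra I)ᵐᵒᵖ] arrowR I α))) ∧
        ((∃ i > 0, Subsingleton (Ω i)) ∨ EventuallyPeriodic Ω)) ∧
    ((∃ Ω, IsCosyzygySequence M Ω) ∧
      ∀ Ω, IsCosyzygySequence M Ω →
        (∃ (k : ℕ) (N : Fin (k + 1) → ModuleCat.{u} (QuotAlgebra I)ᵐᵒᵖ),
          Nonempty (Ω 1 ≃ₗ[(QuotAlgebra I)ᵐᵒᵖ] (∀ j, N j)) ∧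
          (∀ j, j ≠ 0 → j ≠ Fin.last k → Module.Injective (QuotAlgebra I)ᵐᵒᵖ (N j)) ∧
          ∀ j, j = 0 ∨ j = Fin.last k →
            Subsingleton (N j) ∨
            (IsUniserial (QuotAlgebra I)ᵐᵒᵖ (N j) ∧
              ∃ β : Arrow V, Nonempty (N j ≃ₗ[(QuotAlgebra I)ᵐᵒᵖ] arrowU I β))) ∧
        ((∃ i > 0, Subsingleton (Ω i)) ∨ EventuallyPeriodic Ω)) := by
  obtain ⟨w, ⟨e⟩⟩ := hM
  have : Finite (Arrow V) := hI.finite_arrow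
  constructor
  · obtain ⟨⟨Ω₀, hΩ₀⟩, h⟩ := (hasArrowSyzygy_stringModule hI w).syzygies
    refine ⟨⟨Ω₀, hΩ₀.congr e.symm⟩, fun Ω hΩ => ?_⟩
    obtain ⟨⟨x, y, Q, hQ, ⟨f⟩⟩, hper⟩ := h Ω (hΩ.congr e)
    -- Periodicity holds in every case: a sequence that becomes zero is eventually constant up to
    -- isomorphism.
    refine ⟨?_, Or.inr hper⟩
    have key : ∀ x : Option (Arrow V),
        Subsingleton ((rightPresentation hI).optSpan x) ∨
          (IsUniserial (QuotAlgebra I)ᵐᵒᵖ ((rightPresentation hI).optSpan x) ∧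
            ∃ α : Arrow V, Nonempty
              ((rightPresentation hI).optSpan x ≃ₗ[(QuotAlgebra I)ᵐᵒᵖ] arrowR I α)) := by
      rintro (_ | α)
      · exact Or.inl (rightPresentation hI).subsingleton_optSpan_none
      · exact Or.inr ⟨(rightPresentation hI).isUniserial_optSpan α, α,
          ⟨optSpanEquivArrowR hI α⟩⟩
    exact exists_fin_family (A := ModuleCat.of _ ((rightPresentation hI).optSpan x))
      (C := ModuleCat.of _ ((rightPresentation hI).optSpan y)) f
      (P := fun L => Subsingleton L ∨ (IsUniserial (QuotAlgebra I)ᵐᵒᵖ L ∧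
        ∃ α : Arrow V, Nonempty (L ≃ₗ[(QuotAlgebra I)ᵐᵒᵖ] arrowR I α)))
      (Q := fun L => Module.Projective (QuotAlgebra I)ᵐᵒᵖ L) (key x) hQ (key y)
  -- M is the dual of the column module, so its cosyzygies are the duals of the syzygies of that
  -- left module.
  · obtain ⟨⟨Ω₀, hΩ₀⟩, h⟩ := (hasArrowSyzygy_stringColumns hI w).cosyzygies
    refine ⟨⟨Ω₀, hΩ₀.congr (e.trans (stringModuleEquiv hI w)).symm⟩, fun Ω hΩ => ?_⟩
    obtain ⟨⟨x, y, Q, hQ, ⟨f⟩⟩, hper⟩ := h Ω (hΩ.congr (e.trans (stringModuleEquiv hI w)))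
    refine ⟨?_, Or.inr hper⟩
    have key : ∀ x : Option (Arrow V),
        Subsingleton (KDual K (QuotAlgebra I) ((leftPresentation hI).optSpan x)) ∨
          (IsUniserial (QuotAlgebra I)ᵐᵒᵖ
              (KDual K (QuotAlgebra I) ((leftPresentation hI).optSpan x)) ∧
            ∃ β : Arrow V, Nonempty (KDual K (QuotAlgebra I) ((leftPresentation hI).optSpan x)
              ≃ₗ[(QuotAlgebra I)ᵐᵒᵖ] arrowU I β)) := by
      rintro (_ | β)
      · have := (leftPresentation hI).subsingleton_optSpan_none
        exact Or.inl KDual.subsingleton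
      · have := (leftPresentation hI).finite_optSpan (some β)
        exact Or.inr ⟨KDual.isUniserial ((leftPresentation hI).isUniserial_optSpan β), β,
          -- U(β) is by definition the dual of the left ideal generated by β, so no comparison map
          -- is needed.
          ⟨LinearEquiv.refl _ _⟩⟩
    exact exists_fin_family
      (A := ModuleCat.of _ (KDual K (QuotAlgebra I) ((leftPresentation hI).optSpan x)))
      (C := ModuleCat.of _ (KDual K (QuotAlgebra I) ((leftPresentation hI).optSpan y))) f
      (P := fun L => Subsingleton L ∨ (IsUniserial (QuotAlgebra I)ᵐᵒᵖ L ∧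
        ∃ β : Arrow V, Nonempty (L ≃ₗ[(QuotAlgebra I)ᵐᵒᵖ] arrowU I β)))
      (Q := fun L => Module.Injective (QuotAlgebra I)ᵐᵒᵖ L) (key x) hQ (key y)
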